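/- Let $M$ be a connected, paracompact, Hausdorff smooth ($C^\infty$) manifold. A linear connection $\nabla$ on $M$ is a smooth covariant derivative on $TM$, possibly with torsion. Its geodesic spray $S_\nabla$ is the vector field on $TM$ given at $v\in T_xM$ by $S_\nabla(v)=dY_x(v)-\mathrm{vl}_v(\nabla_vY)$, where $Y$ is any smooth local vector field with $Y(x)=v$ and $\mathrm{vl}_v(w)=\frac{d}{dt}\big|_{t=0}(v+tw)$; in local coordinates it is $(x,y)\mapsto(x,y,y,-\Gamma(x)(y,y))$. A geodesic of $\nabla$ is a curve $c:(a,b)\to M$ ($-\infty\le a<b\le\infty$) whose natural lift $\dot c$ to $TM$ is an integral curve of $S_\nabla$; it is inextendible if it is not the restriction of a geodesic with a strictly larger parameter interval. The connection $\nabla$ is * *pseudoconvex* if for each compact $K\subseteq M$ there is a compact $K'\subseteq M$ such that each geodesic segment with both endpoints in $K$ lies entirely within $K'$; * *disprisoning* if no nonconstant inextendible geodesic is contained in a compact subset of $M$. Let $h$ be any auxiliary Riemannian metric on $M$, with unit sphere bundle $UM\subset TM$. The $C^0$-fine topology on the space of linear connections on $M$ is the one obtained by regarding a linear connection $\nabla$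 as its quadratic spray $S_\nabla$, and the spray as a section of $TTM|_{UM}$ over $UM$: a basis of open sets is given by the sets $\{\nabla : S_\nabla(UM)\subseteq W\}$ with $W\subseteq TTM$ open. **Corollary.** The set of all linear connections on $M$ that are both pseudoconvex and disprisoning is open in the $C^0$-fine topology. In particular, if $g$ is a pseudoriemannian metric on $M$ whose Levi-Civita connection is pseudoconvex and disprisoning, then there is a $C^0$-fine open neighborhood $U$ of the Levi-Civita connection such that every linear connection in $U$ is pseudoconvex and disprisoning. -/

import Mathlib

open Set Topology Bundle
open scoped Manifold ContDiff

noncomputable section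

section LinearConnections

variable (E : Type*) [NormedAddCommGroup E] [NormedSpace ℝ E] [FiniteDimensional ℝ E]
  (M : Type*) [TopologicalSpace M] [ChartedSpace E M] [IsManifold 𝓘(ℝ, E) ∞ M]

/-- A smooth linear connection on `M`: a covariant derivative on `TM` (torsion is allowed) that
takes smooth vector fields to smooth sections of `Hom(TM, TM)`. In Mathlib's argument order,
`∇ Y x v` is the covariant derivative of the vector field `Y` in the direction `v ∈ T_x M`. -/
structure LinearConnection extends
    CovariantDerivative 𝓘(ℝ, E) E (TangentSpace 𝓘(ℝ, E) : M → Type _) where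
  smooth : CovariantDerivative.ContMDiffCovariantDerivative toCovariantDerivative ∞

/-- A smooth pseudo-Riemannian metric on `M`: a smooth field of nondegenerate symmetric bilinear
forms on the tangent spaces. -/
structure PseudoRiemannianMetric where
  inner (x : M) : TangentSpace 𝓘(ℝ, E) x →L[ℝ] TangentSpace 𝓘(ℝ, E) x →L[ℝ] ℝ
  symm (x : M) (v w : TangentSpace 𝓘(ℝ, E) x) : inner x v w = inner x w v
  nondegenerate (x : M) (v : TangentSpace 𝓘(ℝ, E) x) (hv : ∀ w, inner x v w = 0) : v = 0
  contMDiff : ContMDiff 𝓘(ℝ, E) (𝓘(ℝ, E).prod 𝓘(ℝ, E →L[ℝ] E →L[ℝ] ℝ)) ∞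
    (fun x ↦ TotalSpace.mk' (E →L[ℝ] E →L[ℝ] ℝ) x (inner x))

variable {E M}

/-- The vertical lift of `w ∈ T_x M` at `v ∈ T_x M`: the velocity at `t = 0` of the curve
`t ↦ v + t w` in the tangent bundle. -/
def verticalLift (v : TangentBundle 𝓘(ℝ, E) M) (w : TangentSpace 𝓘(ℝ, E) v.proj) :
    TangentSpace 𝓘(ℝ, E).tangent v :=
  mfderiv 𝓘(ℝ, ℝ) 𝓘(ℝ, E).tangent
    (fun t : ℝ ↦ (⟨v.proj, v.snd + t • w⟩ : TangentBundle 𝓘(ℝ, E) M)) 0 (1 : ℝ)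

namespace LinearConnection

/-- The geodesic spray of `∇`, a vector field on the tangent bundle. At `v ∈ T_x M` it is
`dY(v) - vl_v(∇_v Y)`, where `Y : M → TM` is any vector field near `x` with `Y(x) = v`. -/
def geodesicSpray (D : LinearConnection E M) (v : TangentBundle 𝓘(ℝ, E) M) :
    TangentSpace 𝓘(ℝ, E).tangent v :=
  letI Y : (x : M) → TangentSpace 𝓘(ℝ, E) x := FiberBundle.extend E v.snd
  letI dY : TangentSpace 𝓘(ℝ, E).tangent v := mfderiv 𝓘(ℝ, E) 𝓘(ℝ, E).tangent
    (fun x ↦ (⟨x, Y x⟩ : TangentBundle 𝓘(ℝ, E) M)) v.proj v.snd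
  dY - verticalLift v (D.toFun Y v.proj v.snd)

end LinearConnection

/-- The natural lift `t ↦ (c t, c'(t))` to the tangent bundle of a curve `c` in `M`. -/
def naturalLift (c : ℝ → M) (t : ℝ) : TangentBundle 𝓘(ℝ, E) M :=
  ⟨c t, mfderiv 𝓘(ℝ, ℝ) 𝓘(ℝ, E) c t (1 : ℝ)⟩

namespace LinearConnection

/-- `c`, restricted to the nonempty open interval `J`, is a geodesic: its natural lift is an
integral curve of the geodesic spray. -/
def IsGeodesicOn (D : LinearConnection E M) (c : ℝ → M) (J : Set ℝ) : Prop :=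
  J.Nonempty ∧ IsOpen J ∧ J.OrdConnected ∧
    IsMIntegralCurveOn (naturalLift (E := E) c) D.geodesicSpray J

/-- The geodesic `c` on `J` is inextendible: `J` is its maximal parameter interval. -/
def IsInextendibleGeodesicOn (D : LinearConnection E M) (c : ℝ → M) (J : Set ℝ) : Prop :=
  D.IsGeodesicOn c J ∧
    ∀ (c' : ℝ → M) (J' : Set ℝ), D.IsGeodesicOn c' J' → J ⊆ J' → EqOn c' c J → J' = J

/-- For each compact `K` there is a compact `K'` such that each geodesic segment with both
endpoints in `K` lies in `K'`. -/
def IsPseudoconvex (D : LinearConnection E M) : Prop :=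
  ∀ K : Set M, IsCompact K → ∃ K' : Set M, IsCompact K' ∧
    ∀ (c : ℝ → M) (J : Set ℝ), D.IsGeodesicOn c J →
      ∀ a ∈ J, ∀ b ∈ J, a ≤ b → c a ∈ K → c b ∈ K → ∀ t ∈ Icc a b, c t ∈ K'

/-- No inextendible (nonconstant) geodesic is contained in a compact set. -/
def IsDisprisoning (D : LinearConnection E M) : Prop :=
  ∀ (c : ℝ → M) (J : Set ℝ), D.IsInextendibleGeodesicOn c J → (c '' J).Nontrivial →
    ∀ K : Set M, IsCompact K → ¬ c '' J ⊆ K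

/-- The `C⁰`-fine (Whitney) topology on the space of linear connections: connections are regarded
as quadratic sprays, and a spray as the section of `TTM` over the unit sphere bundle `UM` of an
auxiliary Riemannian metric `h` that it restricts to. The basic open sets consist of the
connections whose section over `UM` takes its values in a given open subset `W` of `TTM`. -/
@[reducible] def c0FineTopology
    (h : ContMDiffRiemannianMetric 𝓘(ℝ, E) ∞ E (TangentSpace 𝓘(ℝ, E) : M → Type _)) :
    TopologicalSpace (LinearConnection E M) :=
  TopologicalSpace.generateFrom
    {N | ∃ W : Set (TangentBundle 𝓘(ℝ, E).tangent (TangentBundle 𝓘(ℝ, E) M)), IsOpen W ∧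
      N = {D | ∀ v : TangentBundle 𝓘(ℝ, E) M, h.inner v.proj v.snd v.snd = 1 →
        (⟨v, D.geodesicSpray v⟩ :
          TangentBundle 𝓘(ℝ, E).tangent (TangentBundle 𝓘(ℝ, E) M)) ∈ W}}

/-- `∇` is the Levi-Civita connection of `g`: it is torsion-free and
`d(g(Y, Z))(v) = g(∇_v Y, Z) + g(Y, ∇_v Z)`. -/
def IsLeviCivita (D : LinearConnection E M) (g : PseudoRiemannianMetric E M) : Prop :=
  D.toCovariantDerivative.torsion = 0 ∧
    ∀ (x : M) (v : TangentSpace 𝓘(ℝ, E) x) (Y Z : (y : M) → TangentSpace 𝓘(ℝ, E) y),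
      MDifferentiableAt 𝓘(ℝ, E) 𝓘(ℝ, E).tangent
        (fun y ↦ (⟨y, Y y⟩ : TangentBundle 𝓘(ℝ, E) M)) x →
      MDifferentiableAt 𝓘(ℝ, E) 𝓘(ℝ, E).tangent
        (fun y ↦ (⟨y, Z y⟩ : TangentBundle 𝓘(ℝ, E) M)) x →
      mvfderiv 𝓘(ℝ, E) (fun y ↦ g.inner y (Y y) (Z y)) x v =
        g.inner x (D.toFun Y x v) (Z x) + g.inner x (Y x) (D.toFun Z x v)

end LinearConnection

end LinearConnections

end

/-! Fix a pseudoconvex and disprisoning connection `D`. Pseudoconvexity gives an exhaustion of M by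
compact sets A_n such that `D`-segments with endpoints in A_n lie in int A_{n+1}
(`exists_exhaustion`). On the shell C_n = A_{n+2} \ int A_n two conditions are imposed on a
connection `D'`: its segments over C_n with endpoints in A_n lie in int A_{n+1}, and no nonconstant
maximal geodesic has its forward half over C_n. Both hold for every `D'` close enough to `D` over
the compact set C_n. The shells are locally finite, so all these conditions hold at once on a
C⁰-fine neighbourhood of `D` (`exists_isOpen_of_eventually_nhdsOver`).

The conditions suffice by descent (`isPseudoconvex_of_exhaustion`, `isDisprisoning_of_exhaustion`).
A `D'`-segment with endpoints in A_n is compact, so it lies in some A_{m+2} with m ≥ n; its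
excursions from A_m run in C_m, so it lies in A_{m+1}, and so on down to A_{n+1}. A nonconstant
inextendible `D'`-geodesic in A_{k+2} lies in A_{k+1}: around a point outside A_{k+1}, either it
meets A_k on both sides, against the segment condition, or one of its halves stays in C_k. Since A_1
is empty, no such geodesic lies in a compact set.

Closeness over a single compact C is treated by a limit argument. Counterexamples for connections
converging to `D` over C are rescaled so that their velocities converge to a nonzero v
(`exists_tendsto_scale`); sprays are quadratic, so geodesics remain geodesics. They converge to the
`D`-geodesic σ with velocity v by Gronwall (`tendsto_of_isMIntegralCurve`), which needs a Lipschitz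
bound for the limit spray only; hence C⁰ closeness is enough. Trapped forward halves would make a
half of σ trapped in C, but a disprisoning connection traps no half geodesic (`exists_ge_notMem`):
recentring at later and later times would produce a whole geodesic in C. For segments
(`not_segments`), σ leaves C in both directions, so the rescaled lengths converge and the endpoints
converge to points of σ in A. The segment condition for `D` then puts σ(0) in the open set O,
although it is a limit of points outside O. -/

open Filter

/-! ### Integral curves of C¹ vector fields: uniform existence, uniqueness, maximality, escape from
compact sets -/

section VectorFields

variable {F : Type*} [NormedAddCommGroup F] [NormedSpace ℝ F]
  {H : Type*} [TopologicalSpace H] {I : ModelWithCorners ℝ F H}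
  {N : Type*} [TopologicalSpace N] [ChartedSpace H N] [IsManifold I 1 N]

/-- A differentiable curve in a manifold, read in a chart. -/
lemma HasMFDerivAt.hasDerivAt_extChartAt_comp {w : ℝ → N} {t : ℝ} {ξ : F} {p : N}
    (hw : HasMFDerivAt 𝓘(ℝ, ℝ) I w t
      (ContinuousLinearMap.smulRight (1 : ℝ →L[ℝ] ℝ) ξ : ℝ →L[ℝ] F))
    (hp : w t ∈ (extChartAt I p).source) :
    HasDerivAt (extChartAt I p ∘ w) (tangentCoordChange I (w t) p (w t) ξ) t := by
  rw [extChartAt_source] at hp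
  have h0 := hasMFDerivAt_extChartAt (I := I) hp
  rw [mfderiv_chartAt_eq_tangentCoordChange hp] at h0
  have h : HasFDerivAt (extChartAt I p ∘ w) ((tangentCoordChange I (w t) p (w t)).comp
      (ContinuousLinearMap.smulRight (1 : ℝ →L[ℝ] ℝ) ξ)) t :=
    (HasMFDerivAt.comp t h0 hw).hasFDerivAt
  have h' := h.hasDerivAt
  rw [ContinuousLinearMap.comp_apply, ContinuousLinearMap.smulRight_apply] at h'
  simpa only [one_apply_eq_self, one_smul] using h'

/-- A curve that is differentiable in a chart is differentiable in the manifold. -/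
lemma hasMFDerivAt_of_hasDerivAt_extChartAt_comp [I.Boundaryless] {w : ℝ → N} {t : ℝ}
    {ξ : F} {p : N} (hc : ContinuousAt w t)
    (hp : w t ∈ (extChartAt I p).source)
    (hd : HasDerivAt (extChartAt I p ∘ w) (tangentCoordChange I (w t) p (w t) ξ) t) :
    HasMFDerivAt 𝓘(ℝ, ℝ) I w t
      (ContinuousLinearMap.smulRight (1 : ℝ →L[ℝ] ℝ) ξ : ℝ →L[ℝ] F) := by
  suffices hs : HasDerivAt (extChartAt I (w t) ∘ w) ξ t by
    refine ⟨hc, ?_⟩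
    have h1 : HasFDerivWithinAt (extChartAt I (w t) ∘ w)
        ((1 : ℝ →L[ℝ] ℝ).smulRight ξ) univ t := by
      have := hs.hasFDerivAt.hasFDerivWithinAt (s := univ)
      refine this.congr_fderiv ?_
      ext
      simp
    rw [← range_id (α := ℝ)] at h1
    exact h1
  have hself : w t ∈ (extChartAt I (w t)).source := mem_extChartAt_source (I := I) (w t)
  have key : HasDerivAt ((extChartAt I (w t) ∘ (extChartAt I p).symm) ∘ (extChartAt I p ∘ w))
      (tangentCoordChange I p (w t) (w t) (tangentCoordChange I (w t) p (w t) ξ)) t := by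
    apply HasFDerivAt.comp_hasDerivAt _ _ hd
    have := hasFDerivWithinAt_tangentCoordChange (I := I) (x := p) (y := w t) (z := w t)
      ⟨hp, hself⟩
    rwa [I.range_eq_univ, hasFDerivWithinAt_univ] at this
  rw [tangentCoordChange_comp ⟨⟨hself, hp⟩, hself⟩, tangentCoordChange_self hself] at key
  refine key.congr_of_eventuallyEq ?_
  filter_upwards [hc (extChartAt_source_mem_nhds' (I := I) hp)] with s hs
  simp only [Function.comp_apply, (extChartAt I p).left_inv hs]

/-- The representation of a vector field in the chart at `p`. -/
noncomputable def chartField (I : ModelWithCorners ℝ F H) [IsManifold I 1 N]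
    (S : (q : N) → TangentSpace I q) (p : N) (x : F) : F :=
  tangentCoordChange I ((extChartAt I p).symm x) p ((extChartAt I p).symm x)
    (S ((extChartAt I p).symm x))

lemma chartField_extChartAt (S : (q : N) → TangentSpace I q) {p q : N}
    (hq : q ∈ (extChartAt I p).source) :
    chartField I S p (extChartAt I p q) = tangentCoordChange I q p q (S q) := by
  simp only [chartField]
  rw [(extChartAt I p).left_inv hq]

lemma contDiffAt_chartField [I.Boundaryless] {S : (q : N) → TangentSpace I q} {p : N}
    (hS : ContMDiffAt I I.tangent 1 (fun q ↦ (⟨q, S q⟩ : TangentBundle I N)) p) :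
    ContDiffAt ℝ 1 (chartField I S p) (extChartAt I p p) := by
  rw [contMDiffAt_iff] at hS
  have := hS.2
  rw [I.range_eq_univ, contDiffWithinAt_univ] at this
  exact this.snd

variable [I.Boundaryless]

/-- Integral curves of a `C¹` vector field exist for a uniform time near a given point. -/
lemma exists_uniform_isMIntegralCurveOn [CompleteSpace F] {S : (q : N) → TangentSpace I q} {p : N}
    (hS : ContMDiffAt I I.tangent 1 (fun q ↦ (⟨q, S q⟩ : TangentBundle I N)) p) :
    ∃ ε > (0 : ℝ), ∀ᶠ q in 𝓝 p, ∀ t₀ : ℝ, ∃ w : ℝ → N, w t₀ = q ∧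
      IsMIntegralCurveOn w S (Ioo (t₀ - ε) (t₀ + ε)) := by
  obtain ⟨ε, hε, a, r, L, K, hr, hpl⟩ :=
    IsPicardLindelof.of_contDiffAt_one (contDiffAt_chartField hS)
  obtain ⟨α, hα, hcont⟩ :=
    (hpl 0).exists_forall_mem_closedBall_eq_hasDerivWithinAt_continuousOn
  set x₀ := extChartAt I p p
  have hr' : (0 : ℝ) < r := hr
  have hnb : Metric.closedBall x₀ r ×ˢ Icc (0 - ε) (0 + ε) ∈ 𝓝 (x₀, (0 : ℝ)) :=
    prod_mem_nhds (Metric.closedBall_mem_nhds _ hr') (Icc_mem_nhds (by linarith) (by linarith))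
  have hc0 : ContinuousAt α (x₀, 0) := hcont.continuousAt hnb
  have hα0 : α (x₀, 0) = x₀ := (hα x₀ (Metric.mem_closedBall_self hr'.le)).1
  have htar : ∀ᶠ y in 𝓝 (x₀, (0 : ℝ)), α y ∈ (extChartAt I p).target := by
    apply hc0
    rw [hα0]
    exact extChartAt_target_mem_nhds p
  rw [nhds_prod_eq, Filter.eventually_prod_iff] at htar
  obtain ⟨P, hP, Q, hQ, hPQ⟩ := htar
  obtain ⟨δ, hδ, hδQ⟩ := Metric.eventually_nhds_iff_ball.1 hQ
  -- ε bounds the time for which the local flow exists, δ the time for which it stays in the chart.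
  -- The field is autonomous, so the same bound serves every starting time t₀.
  refine ⟨min δ ε, lt_min hδ hε, ?_⟩
  filter_upwards [continuousAt_extChartAt (I := I) p hP, extChartAt_source_mem_nhds (I := I) p,
    continuousAt_extChartAt (I := I) p (Metric.closedBall_mem_nhds _ hr')] with q hq hqs hqr t₀
  set x := extChartAt I p q
  refine ⟨fun t ↦ (extChartAt I p).symm (α (x, t - t₀)), ?_, ?_⟩
  · have : α (x, 0) = x := (hα x hqr).1
    simp only [sub_self, this]
    exact (extChartAt I p).left_inv hqs
  · intro t ht
    have htδ : t - t₀ ∈ Metric.ball (0 : ℝ) δ := by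
      rw [Real.ball_eq_Ioo]
      have := min_le_left δ ε
      constructor <;> [linarith [ht.1]; linarith [ht.2]]
    have htε : t - t₀ ∈ Ioo (0 - ε) (0 + ε) := by
      have := min_le_right δ ε
      constructor <;> [linarith [ht.1]; linarith [ht.2]]
    have hta : α (x, t - t₀) ∈ (extChartAt I p).target := hPQ hq (hδQ _ htδ)
    have hd : HasDerivAt (fun s ↦ α (x, s)) (chartField I S p (α (x, t - t₀))) (t - t₀) :=
      ((hα x hqr).2 _ (Ioo_subset_Icc_self htε)).hasDerivAt (Icc_mem_nhds htε.1 htε.2)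
    have hd' : HasDerivAt (fun s ↦ α (x, s - t₀)) (chartField I S p (α (x, t - t₀))) t := by
      simpa using hd.comp_sub_const t t₀
    have hcw : ContinuousAt (fun t ↦ (extChartAt I p).symm (α (x, t - t₀))) t :=
      ContinuousAt.comp (f := fun t ↦ α (x, t - t₀)) (continuousAt_extChartAt_symm'' hta)
        hd'.continuousAt
    refine (hasMFDerivAt_of_hasDerivAt_extChartAt_comp (p := p) hcw
      ((extChartAt I p).map_target hta) ?_).hasMFDerivWithinAt
    refine hd'.congr_of_eventuallyEq ?_
    filter_upwards [hd'.continuousAt ((isOpen_extChartAt_target p).mem_nhds hta)] with s hs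
    exact (extChartAt I p).right_inv hs

/-- Integral curves of a `C¹` vector field on open intervals are unique. -/
lemma IsMIntegralCurveOn.eqOn_inter [T2Space N] {S : (q : N) → TangentSpace I q}
    (hS : ContMDiff I I.tangent 1 (fun q ↦ (⟨q, S q⟩ : TangentBundle I N))) {w w' : ℝ → N}
    {J J' : Set ℝ} (hJ : IsOpen J) (hJc : J.OrdConnected) (hJ' : IsOpen J') (hJc' : J'.OrdConnected)
    (hw : IsMIntegralCurveOn w S J) (hw' : IsMIntegralCurveOn w' S J') {t₀ : ℝ} (ht₀ : t₀ ∈ J)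
    (ht₀' : t₀ ∈ J') (h : w t₀ = w' t₀) : EqOn w w' (J ∩ J') := by
  rintro t ⟨ht, ht'⟩
  have hsub : uIcc t₀ t ⊆ J ∩ J' :=
    subset_inter (hJc.uIcc_subset ht₀ ht) (hJc'.uIcc_subset ht₀' ht')
  have hopen : IsOpen (J ∩ J') := hJ.inter hJ'
  obtain ⟨ε₁, hε₁, h₁⟩ := Metric.isOpen_iff.1 hopen (min t₀ t) (hsub (by simp [uIcc]))
  obtain ⟨ε₂, hε₂, h₂⟩ := Metric.isOpen_iff.1 hopen (max t₀ t) (hsub (by simp [uIcc]))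
  rw [Real.ball_eq_Ioo] at h₁ h₂
  -- Uniqueness is applied on an open interval slightly larger than the closed one between t₀ and t.
  have hIoo : Ioo (min t₀ t - ε₁) (max t₀ t + ε₂) ⊆ J ∩ J' := by
    intro s hs
    rcases lt_or_ge s (min t₀ t) with hs1 | hs1
    · exact h₁ ⟨hs.1, by linarith⟩
    rcases le_or_gt s (max t₀ t) with hs2 | hs2
    · exact hsub ⟨hs1, hs2⟩
    · exact h₂ ⟨by linarith, hs.2⟩
  have := min_le_left t₀ t
  have := min_le_right t₀ t
  have := le_max_left t₀ t
  have := le_max_right t₀ t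
  exact isMIntegralCurveOn_Ioo_eqOn_of_contMDiff_boundaryless (t₀ := t₀)
    ⟨by linarith, by linarith⟩ hS (hw.mono (hIoo.trans inter_subset_left))
    (hw'.mono (hIoo.trans inter_subset_right)) h ⟨by linarith, by linarith⟩

/-- `w` on `J` is a maximal integral curve of `S`. -/
structure IsMaximalMIntegralCurveOn (w : ℝ → N) (S : (q : N) → TangentSpace I q) (J : Set ℝ) :
    Prop where
  isOpen : IsOpen J
  ordConnected : J.OrdConnected
  isMIntegralCurveOn : IsMIntegralCurveOn w S J
  subset : ∀ (w' : ℝ → N) (J' : Set ℝ), IsOpen J' → J'.OrdConnected → IsMIntegralCurveOn w' S J' →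
    ∀ t ∈ J, t ∈ J' → w t = w' t → J' ⊆ J

/-- Integral curves on overlapping open intervals that agree at a point can be glued. -/
lemma IsMIntegralCurveOn.exists_union [T2Space N] {S : (q : N) → TangentSpace I q}
    (hS : ContMDiff I I.tangent 1 (fun q ↦ (⟨q, S q⟩ : TangentBundle I N))) {w w' : ℝ → N}
    {J J' : Set ℝ} (hJ : IsOpen J) (hJc : J.OrdConnected) (hJ' : IsOpen J') (hJc' : J'.OrdConnected)
    (hw : IsMIntegralCurveOn w S J) (hw' : IsMIntegralCurveOn w' S J') {t₀ : ℝ} (ht₀ : t₀ ∈ J)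
    (ht₀' : t₀ ∈ J') (h : w t₀ = w' t₀) :
    ∃ γ : ℝ → N, IsMIntegralCurveOn γ S (J ∪ J') ∧ EqOn γ w J ∧ EqOn γ w' J' := by
  classical
  have h1 : EqOn (J.piecewise w w') w J := piecewise_eqOn _ _ _
  have h2 : EqOn (J.piecewise w w') w' J' := by
    intro t ht
    by_cases htJ : t ∈ J
    · rw [h1 htJ]
      exact hw.eqOn_inter hS hJ hJc hJ' hJc' hw' ht₀ ht₀' h ⟨htJ, ht⟩
    · simp [htJ]
  refine ⟨J.piecewise w w', ?_, h1, h2⟩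
  have key : ∀ {u : ℝ → N} {K : Set ℝ}, IsOpen K → IsMIntegralCurveOn u S K →
      EqOn (J.piecewise w w') u K → IsMIntegralCurveOn (J.piecewise w w') S K := by
    intro u K hK hu he t ht
    have h3 := ((hu t ht).hasMFDerivAt (hK.mem_nhds ht)).congr_of_eventuallyEq
      (he.eventuallyEq_of_mem (hK.mem_nhds ht))
    rw [← he ht] at h3
    exact h3.hasMFDerivWithinAt
  rw [isMIntegralCurveOn_iff_isMIntegralCurveAt (hJ.union hJ')]
  rintro t (ht | ht)
  · exact (key hJ hw h1).isMIntegralCurveAt (hJ.mem_nhds ht)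
  · exact (key hJ' hw' h2).isMIntegralCurveAt (hJ'.mem_nhds ht)

lemma ordConnected_union_of_mem {J J' : Set ℝ} (hJ : J.OrdConnected) (hJ' : J'.OrdConnected)
    {t : ℝ} (ht : t ∈ J) (ht' : t ∈ J') : (J ∪ J').OrdConnected :=
  (hJ.isPreconnected.union t ht ht' hJ'.isPreconnected).ordConnected

/-- Through each point there is a maximal integral curve. -/
lemma exists_isMaximalMIntegralCurveOn [CompleteSpace F] [T2Space N]
    {S : (q : N) → TangentSpace I q}
    (hS : ContMDiff I I.tangent 1 (fun q ↦ (⟨q, S q⟩ : TangentBundle I N))) (t₀ : ℝ) (p : N) :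
    ∃ (w : ℝ → N) (J : Set ℝ), t₀ ∈ J ∧ w t₀ = p ∧ IsMaximalMIntegralCurveOn w S J := by
  classical
  let good : Set ℝ → (ℝ → N) → Prop := fun J γ ↦ IsOpen J ∧ J.OrdConnected ∧
    IsMIntegralCurveOn γ S J ∧ t₀ ∈ J ∧ γ t₀ = p
  have huniq : ∀ {J γ J' γ'}, good J γ → good J' γ' → EqOn γ γ' (J ∩ J') := by
    rintro J γ J' γ' ⟨h1, h2, h3, h4, h5⟩ ⟨h1', h2', h3', h4', h5'⟩
    exact h3.eqOn_inter hS h1 h2 h1' h2' h3' h4 h4' (h5.trans h5'.symm)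
  let J : Set ℝ := {t | ∃ K γ, good K γ ∧ t ∈ K}
  have hJ : ∀ t : ℝ, ∃ K γ, t ∈ J → good K γ ∧ t ∈ K := by
    intro t
    by_cases ht : t ∈ J
    · obtain ⟨K, γ, h⟩ := ht
      exact ⟨K, γ, fun _ ↦ h⟩
    · exact ⟨∅, fun _ ↦ p, fun h ↦ (ht h).elim⟩
  choose K γ hKγ using hJ
  -- All good curves agree where they overlap, so the choice made separately for each time is
  -- harmless.
  let w : ℝ → N := fun t ↦ γ t t
  have hsub : ∀ {L u}, good L u → L ⊆ J := fun hL t ht ↦ ⟨_, _, hL, ht⟩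
  have heq : ∀ {L u}, good L u → EqOn w u L := fun hL t ht ↦
    huniq (hKγ t (hsub hL ht)).1 hL ⟨(hKγ t (hsub hL ht)).2, ht⟩
  have hJo : IsOpen J := isOpen_iff_mem_nhds.2 fun t ht ↦
    Filter.mem_of_superset ((hKγ t ht).1.1.mem_nhds (hKγ t ht).2) (hsub (hKγ t ht).1)
  obtain ⟨L₀, u₀, hL₀⟩ : ∃ L u, good L u := by
    obtain ⟨γ, hγ, hγ'⟩ := exists_isMIntegralCurveAt_of_contMDiffAt_boundaryless (I := I) t₀
      (hS.contMDiffAt (x := p))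
    obtain ⟨ε, hε, hγ''⟩ := isMIntegralCurveAt_iff'.1 hγ'
    exact ⟨Metric.ball t₀ ε, γ, Metric.isOpen_ball, (convex_ball t₀ ε).ordConnected, hγ'',
      Metric.mem_ball_self hε, hγ⟩
  have ht₀ : t₀ ∈ J := hsub hL₀ hL₀.2.2.2.1
  have hwt₀ : w t₀ = p := (heq hL₀ hL₀.2.2.2.1).trans hL₀.2.2.2.2
  have hJc : J.OrdConnected := by
    refine ⟨fun a ha b hb x hx ↦ ?_⟩
    rcases le_total x t₀ with h | h
    · obtain ⟨h1, h2⟩ := hKγ a ha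
      exact hsub h1 (h1.2.1.out h2 h1.2.2.2.1 ⟨hx.1, h⟩)
    · obtain ⟨h1, h2⟩ := hKγ b hb
      exact hsub h1 (h1.2.1.out h1.2.2.2.1 h2 ⟨h, hx.2⟩)
  have hw : IsMIntegralCurveOn w S J := by
    intro t ht
    obtain ⟨h1, h2⟩ := hKγ t ht
    have h3 := ((h1.2.2.1 t h2).hasMFDerivAt (h1.1.mem_nhds h2)).congr_of_eventuallyEq
      ((heq h1).eventuallyEq_of_mem (h1.1.mem_nhds h2))
    exact h3.hasMFDerivWithinAt
  refine ⟨w, J, ht₀, hwt₀, hJo, hJc, hw, ?_⟩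
  intro w' J' hJ' hJc' hw' t ht ht' heqt
  obtain ⟨u, hu, huw, -⟩ := hw.exists_union hS hJo hJc hJ' hJc' hw' ht ht' heqt
  exact subset_union_right.trans (hsub (L := J ∪ J') (u := u) ⟨hJo.union hJ',
    ordConnected_union_of_mem hJc hJc' ht ht', hu, Or.inl ht₀, (huw ht₀).trans hwt₀⟩)

/-- A maximal integral curve whose interval is bounded above leaves every compact set. -/
lemma IsMaximalMIntegralCurveOn.exists_notMem_of_bddAbove [CompleteSpace F] [T2Space N]
    {S : (q : N) → TangentSpace I q}
    (hS : ContMDiff I I.tangent 1 (fun q ↦ (⟨q, S q⟩ : TangentBundle I N)))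
    {w : ℝ → N} {J : Set ℝ} (hw : IsMaximalMIntegralCurveOn w S J) (hJ : BddAbove J) {t₀ : ℝ}
    (ht₀ : t₀ ∈ J) {Z : Set N} (hZ : IsCompact Z) : ∃ t ∈ J, t₀ ≤ t ∧ w t ∉ Z := by
  by_contra! hcon
  have hlub := isLUB_csSup ⟨t₀, ht₀⟩ hJ
  set b := sSup J
  have hbJ : b ∉ J := by
    intro hb
    obtain ⟨ε, hε, hε'⟩ := Metric.isOpen_iff.1 hw.isOpen b hb
    have := hlub.1 (hε' (show b + ε / 2 ∈ _ by
      rw [Real.ball_eq_Ioo]; constructor <;> linarith))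
    linarith
  have hIco : ∀ t, t₀ ≤ t → t < b → t ∈ J := by
    intro t h1 h2
    obtain ⟨s, hs, hts⟩ := (lt_isLUB_iff hlub).1 h2
    exact hw.ordConnected.out ht₀ hs ⟨h1, hts.le⟩
  have ht₀b : t₀ < b := lt_of_le_of_ne (hlub.1 ht₀) fun h ↦ hbJ (h ▸ ht₀)
  have hev : ∀ᶠ t in 𝓝[<] b, t₀ ≤ t ∧ t < b := by
    filter_upwards [Ioo_mem_nhdsLT ht₀b] with t ht using ⟨ht.1.le, ht.2⟩
  obtain ⟨z, -, hz⟩ := hZ.exists_mapClusterPt (u := w) (f := 𝓝[<] b) (by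
    rw [Filter.le_principal_iff, Filter.mem_map]
    filter_upwards [hev] with t ht using hcon t (hIco t ht.1 ht.2) ht.1)
  -- Curves starting near the cluster point z live for the common time ε. Restarting within ε / 2 of
  -- b therefore continues the curve past b, against maximality.
  obtain ⟨ε, hε, hU⟩ := exists_uniform_isMIntegralCurveOn (hS.contMDiffAt (x := z))
  have hfr := hz.frequently hU
  have hev2 : ∀ᶠ t in 𝓝[<] b, t ∈ Ioo (b - ε / 2) b := Ioo_mem_nhdsLT (by linarith)
  obtain ⟨t, ht, ht1, ht2⟩ := (hfr.and_eventually (hev.and hev2)).exists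
  obtain ⟨u, hu, hu'⟩ := ht t
  have := hw.subset u _ isOpen_Ioo ordConnected_Ioo hu' t (hIco t ht1.1 ht1.2)
    ⟨by linarith, by linarith⟩ hu.symm
  exact hbJ (this ⟨by linarith [ht2.1, ht2.2], by linarith [ht2.1]⟩)

end VectorFields

/-! ### Continuous dependence on the field and the initial point, by Gronwall's inequality -/

section ContinuousDependence

variable {F : Type*} [NormedAddCommGroup F] [NormedSpace ℝ F]
  {H : Type*} [TopologicalSpace H] {I : ModelWithCorners ℝ F H}
  {N : Type*} [TopologicalSpace N] [ChartedSpace H N] [IsManifold I 1 N] {ι : Type*}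

lemma gronwallBound_mul (c δ K ε x : ℝ) :
    gronwallBound (c * δ) K (c * ε) x = c * gronwallBound δ K ε x := by
  unfold gronwallBound
  split_ifs <;> ring

/-- The bound is jointly homogeneous in the initial error and the defect, so taking both equal and
small makes it small. -/
lemma exists_gronwallBound_lt (K : ℝ) {η : ℝ} (hη : 0 < η) :
    ∃ ε > (0 : ℝ), gronwallBound ε K ε 1 < η := by
  refine ⟨η / (|gronwallBound 1 K 1 1| + 1), by positivity, ?_⟩
  have h := gronwallBound_mul (η / (|gronwallBound 1 K 1 1| + 1)) 1 K 1 1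
  rw [mul_one] at h
  rw [h, div_mul_eq_mul_div, div_lt_iff₀ (by positivity)]
  exact mul_lt_mul_of_pos_left ((le_abs_self _).trans_lt (lt_add_one _)) hη

/-- The vector fields `S' k` converge to `S` along `l`, locally uniformly on `Q` in charts. -/
def TendstoLocallyUniformlyInCharts (I : ModelWithCorners ℝ F H) [IsManifold I 1 N]
    (S' : ι → (q : N) → TangentSpace I q) (S : (q : N) → TangentSpace I q) (l : Filter ι)
    (Q : Set N) : Prop :=
  ∀ p : N, ∃ V ∈ 𝓝 p, ∀ ε > (0 : ℝ), ∀ᶠ k in l, ∀ q ∈ V, q ∈ Q →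
    ‖tangentCoordChange I q p q (S' k q) - tangentCoordChange I q p q (S q)‖ ≤ ε

variable [I.Boundaryless]

/-- A time set on which forward integral curves are considered: with each time it contains
all earlier nonnegative times. -/
def IsForwardTimeSet (T : Set ℝ) : Prop := ∀ s ∈ T, 0 ≤ s ∧ Icc 0 s ⊆ T

/-- The propagation step inside one chart. There w k is an approximate trajectory of the Lipschitz
field S, so Gronwall transports closeness from s₀ to later times. The width δ depends on the centre
t₀ and not on s₀. Since w k may stop early, everything is conditional on the time lying in T k. -/
lemma eventually_mem_nhds_of_tendsto_step [T2Space N] {S : (q : N) → TangentSpace I q}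
    {γ : ℝ → N} {J : Set ℝ} {t₀ : ℝ}
    (hS : ContMDiffAt I I.tangent 1 (fun q ↦ (⟨q, S q⟩ : TangentBundle I N)) (γ t₀))
    (hJ : J ∈ 𝓝 t₀) (hJo : IsOpen J) (hγ : IsMIntegralCurveOn γ S J) [CompleteSpace F] [ProperSpace F]
    {S' : ι → (q : N) → TangentSpace I q} {l : Filter ι} {Q : Set N}
    (hSS : TendstoLocallyUniformlyInCharts I S' S l Q)
    {w : ι → ℝ → N} {T : ι → Set ℝ} (hT : ∀ k, IsForwardTimeSet (T k))
    (hw : ∀ k, ∀ s ∈ T k, IsMIntegralCurveAt (w k) (S' k) s)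
    (hwQ : ∀ k, ∀ s ∈ T k, w k s ∈ Q) :
    ∃ δ > (0 : ℝ), ∀ s₀, 0 ≤ s₀ → |s₀ - t₀| < δ →
      (∀ O ∈ 𝓝 (γ s₀), ∀ᶠ k in l, s₀ ∈ T k → w k s₀ ∈ O) →
      ∀ t, s₀ ≤ t → t < t₀ + δ → ∀ O ∈ 𝓝 (γ t), ∀ᶠ x : ι × ℝ in l ×ˢ 𝓝 t,
        x.2 ∈ T x.1 → s₀ ≤ x.2 → w x.1 x.2 ∈ O := by
  set p := γ t₀ with hp
  set φ := extChartAt I p with hφ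
  obtain ⟨K, L, hL, hlip⟩ := (contDiffAt_chartField hS).exists_lipschitzOnWith
  obtain ⟨V, hV, hVε⟩ := hSS p
  have hVp : ∀ᶠ x in 𝓝 (φ p), φ.symm x ∈ V := by
    have h1 : ContinuousAt φ.symm (φ p) := continuousAt_extChartAt_symm p
    apply h1
    rwa [extChartAt_to_inv]
  obtain ⟨ρ, hρ, hball⟩ := Metric.nhds_basis_closedBall.mem_iff.1
    (Filter.inter_mem (Filter.inter_mem hL (extChartAt_target_mem_nhds (I := I) p)) hVp)
  have hγc : ∀ t ∈ J, ContinuousAt γ t := fun t ht ↦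
    (hγ.isMIntegralCurveAt (hJo.mem_nhds ht)).continuousAt
  have ht₀ : t₀ ∈ J := mem_of_mem_nhds hJ
  -- With δ ≤ 1 / 2 all time intervals have length at most 1, where the Gronwall bound was fixed.
  -- The radius ρ / 2 for γ leaves another ρ / 2 for the distance between w k and γ.
  obtain ⟨δ, hδ, hδ1, hδ2⟩ : ∃ δ > (0 : ℝ), δ ≤ 1 / 2 ∧ ∀ t, |t - t₀| < δ →
      t ∈ J ∧ γ t ∈ φ.source ∧ dist (φ (γ t)) (φ p) < ρ / 2 := by
    have h1 : ∀ᶠ t in 𝓝 t₀, t ∈ J ∧ γ t ∈ φ.source ∧ dist (φ (γ t)) (φ p) < ρ / 2 := by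
      refine Filter.Eventually.and hJ (Filter.Eventually.and
        (hγc t₀ ht₀ (extChartAt_source_mem_nhds (I := I) p)) ?_)
      exact (ContinuousAt.comp (continuousAt_extChartAt (I := I) p) (hγc t₀ ht₀))
        (Metric.ball_mem_nhds _ (half_pos hρ))
    obtain ⟨δ, hδ, h⟩ := Metric.eventually_nhds_iff.1 h1
    exact ⟨min δ (1 / 2), by positivity, min_le_right _ _,
      fun t ht ↦ h (by rw [Real.dist_eq]; exact ht.trans_le (min_le_left _ _))⟩
  have hgd : ∀ t, |t - t₀| < δ → HasDerivAt (φ ∘ γ) (chartField I S p (φ (γ t))) t := by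
    intro t ht
    obtain ⟨h1, h2, -⟩ := hδ2 t ht
    rw [chartField_extChartAt S h2]
    exact ((hγ t h1).hasMFDerivAt (hJo.mem_nhds h1)).hasDerivAt_extChartAt_comp h2
  refine ⟨δ, hδ, fun s₀ hs₀ hs₀δ hP ↦ ?_⟩
  have key : ∀ η > 0, η ≤ ρ / 2 → ∀ᶠ k in l, ∀ s ∈ T k, s₀ ≤ s → s < t₀ + δ →
      w k s ∈ φ.source ∧ dist (φ (w k s)) (φ (γ s)) < η := by
    intro η hη hηρ
    obtain ⟨ε, hε, hεη⟩ := exists_gronwallBound_lt K hη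
    have hεη' : ε < η := by
      refine lt_of_le_of_lt ?_ hεη
      have := gronwallBound_mono hε.le hε.le K.2 zero_le_one
      rwa [gronwallBound_x0] at this
    have hO : {q | q ∈ φ.source ∧ dist (φ q) (φ (γ s₀)) < ε} ∈ 𝓝 (γ s₀) := by
      have h2 := (hδ2 s₀ hs₀δ).2.1
      exact Filter.inter_mem (extChartAt_source_mem_nhds' (I := I) h2)
        ((continuousAt_extChartAt' (I := I) h2) (Metric.ball_mem_nhds _ hε))
    filter_upwards [hP _ hO, hVε ε hε] with k hk1 hk2 s hs hs₀s hsδ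
    by_contra hcon
    have hTs : Icc s₀ s ⊆ T k := (Icc_subset_Icc_left hs₀).trans (hT k s hs).2
    have hrδ : ∀ r ∈ Icc s₀ s, |r - t₀| < δ := by
      intro r hr
      rw [abs_lt] at hs₀δ ⊢
      constructor <;> [linarith [hr.1]; linarith [hr.2]]
    have hwc : ∀ r ∈ Icc s₀ s, ContinuousAt (w k) r := fun r hr ↦ (hw k r (hTs hr)).continuousAt
    let good : Set ℝ := {r | w k r ∈ φ.source ∧ dist (φ (w k r)) (φ (γ r)) < η}
    have hgood : ∀ r ∈ Icc s₀ s, r ∈ good → good ∈ 𝓝 r := by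
      intro r hr hrg
      refine Filter.inter_mem (hwc r hr (extChartAt_source_mem_nhds' (I := I) hrg.1)) ?_
      have h1 : ContinuousAt (fun r ↦ dist (φ (w k r)) (φ (γ r))) r :=
        ((continuousAt_extChartAt' (I := I) hrg.1).comp (hwc r hr)).dist
          (hgd r (hrδ r hr)).continuousAt
      exact h1 (Iio_mem_nhds hrg.2)
    have hclosed : IsClosed (Icc s₀ s ∩ goodᶜ) := by
      rw [← isOpen_compl_iff, isOpen_iff_mem_nhds]
      intro r hr
      by_cases hr1 : r ∈ Icc s₀ s
      · have hr2 : r ∈ good := by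
          by_contra h
          exact hr ⟨hr1, h⟩
        filter_upwards [hgood r hr1 hr2] with x hx using fun h ↦ h.2 hx
      · filter_upwards [isClosed_Icc.isOpen_compl.mem_nhds hr1] with x hx using fun h ↦ hx h.1
    -- b is the first time at which the estimate fails. Up to b the curve stays in the ball with the
    -- Lipschitz bound, so Gronwall gives the estimate at b as well.
    obtain ⟨b, ⟨hb, hbg⟩, hbl⟩ := (isCompact_Icc.of_isClosed_subset hclosed
      inter_subset_left).exists_isLeast ⟨s, ⟨hs₀s, le_rfl⟩, hcon⟩
    have hs₀g : s₀ ∈ good := by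
      obtain ⟨h1, h2⟩ := hk1 (hTs ⟨le_rfl, hs₀s⟩)
      exact ⟨h1, h2.trans hεη'⟩
    have hs₀b : s₀ < b := lt_of_le_of_ne hb.1 fun h ↦ hbg (h ▸ hs₀g)
    have hlt : ∀ r ∈ Ico s₀ b, r ∈ good := by
      intro r hr
      by_contra h
      exact absurd (hbl ⟨⟨hr.1, hr.2.le.trans hb.2⟩, h⟩) (not_le.2 hr.2)
    have hfr : ∀ r ∈ Ico s₀ b, φ (w k r) ∈ Metric.closedBall (φ p) ρ := by
      intro r hr
      have h1 := (hlt r hr).2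
      have h2 := (hδ2 r (hrδ r ⟨hr.1, hr.2.le.trans hb.2⟩)).2.2
      rw [Metric.mem_closedBall]
      linarith [dist_triangle (φ (w k r)) (φ (γ r)) (φ p)]
    -- A priori w k could leave the chart exactly at time b; the compact, hence closed, image of the
    -- ball excludes this.
    have hZ : IsClosed (φ.symm '' Metric.closedBall (φ p) ρ) := by
      refine ((isCompact_closedBall _ _).image_of_continuousOn ?_).isClosed
      exact (continuousOn_extChartAt_symm p).mono fun x hx ↦ (hball hx).1.2
    have hbZ : w k b ∈ φ.symm '' Metric.closedBall (φ p) ρ := by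
      refine hZ.mem_of_tendsto ((hwc b hb).tendsto.mono_left nhdsWithin_le_nhds :
        Tendsto (w k) (𝓝[<] b) _) ?_
      filter_upwards [Ioo_mem_nhdsLT hs₀b] with r hr
      exact ⟨φ (w k r), hfr r ⟨hr.1.le, hr.2⟩, φ.left_inv (hlt r ⟨hr.1.le, hr.2⟩).1⟩
    obtain ⟨x, hx, hxb⟩ := hbZ
    have hbs : w k b ∈ φ.source := hxb ▸ φ.map_target (hball hx).1.2
    have hsrc : ∀ r ∈ Icc s₀ b, w k r ∈ φ.source := by
      intro r hr
      rcases hr.2.eq_or_lt with h | h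
      · exact h ▸ hbs
      · exact (hlt r ⟨hr.1, h⟩).1
    have hfd : ∀ r ∈ Icc s₀ b, HasDerivAt (φ ∘ w k)
        (tangentCoordChange I (w k r) p (w k r) (S' k (w k r))) r := fun r hr ↦
      (hw k r (hTs ⟨hr.1, hr.2.trans hb.2⟩)).hasMFDerivAt.hasDerivAt_extChartAt_comp (hsrc r hr)
    have hgd' : ∀ r ∈ Icc s₀ b, HasDerivAt (φ ∘ γ) (chartField I S p (φ (γ r))) r :=
      fun r hr ↦ hgd r (hrδ r ⟨hr.1, hr.2.trans hb.2⟩)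
    have hG := dist_le_of_approx_trajectories_ODE_of_mem (v := fun _ ↦ chartField I S p)
      (s := fun _ ↦ L) (K := K) (f := φ ∘ w k) (g := φ ∘ γ) (a := s₀) (b := b) (εf := ε) (εg := 0)
      (δ := ε) (f' := fun r ↦ tangentCoordChange I (w k r) p (w k r) (S' k (w k r)))
      (g' := fun r ↦ chartField I S p (φ (γ r)))
      (fun _ _ ↦ hlip) (fun r hr ↦ (hfd r hr).continuousAt.continuousWithinAt)
      (fun r hr ↦ (hfd r (Ico_subset_Icc_self hr)).hasDerivWithinAt) (fun r hr ↦ ?_)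
      (fun r hr ↦ (hball (hfr r hr)).1.1)
      (fun r hr ↦ (hgd' r hr).continuousAt.continuousWithinAt)
      (fun r hr ↦ (hgd' r (Ico_subset_Icc_self hr)).hasDerivWithinAt) (fun r hr ↦ ?_)
      (fun r hr ↦ ?_) (hk1 (hTs ⟨le_rfl, hs₀s⟩)).2.le b ⟨hs₀b.le, le_rfl⟩
    · refine hbg ⟨hbs, lt_of_le_of_lt hG ?_⟩
      rw [add_zero]
      refine lt_of_le_of_lt (gronwallBound_mono hε.le hε.le K.2 ?_) hεη
      have h1 := (abs_lt.1 hs₀δ).1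
      linarith [hb.2]
    · have h1 := (hlt r hr).1
      rw [Function.comp_apply, hφ, chartField_extChartAt S h1, dist_eq_norm]
      refine hk2 _ ?_ (hwQ k r (hTs ⟨hr.1, hr.2.le.trans hb.2⟩))
      have h2 : φ.symm (φ (w k r)) ∈ V := (hball (hfr r hr)).2
      rwa [φ.left_inv h1] at h2
    · rw [Function.comp_apply, dist_self]
    · have h2 := (hδ2 r (hrδ r ⟨hr.1, hr.2.le.trans hb.2⟩)).2.2
      exact (hball (Metric.mem_closedBall.2 (by
        rw [Function.comp_apply]; linarith))).1.1
  intro t hst htδ O hO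
  have htδ' : |t - t₀| < δ := by
    rw [abs_lt] at hs₀δ ⊢
    constructor <;> linarith
  obtain ⟨-, h2, -⟩ := hδ2 t htδ'
  have hsymm : ∀ᶠ x in 𝓝 (φ (γ t)), φ.symm x ∈ O := by
    have h1 : ContinuousAt φ.symm (φ (γ t)) := continuousAt_extChartAt_symm' h2
    apply h1
    rwa [φ.left_inv h2]
  obtain ⟨η, hη, hηO⟩ := Metric.eventually_nhds_iff.1 hsymm
  have h3 := key (min (η / 2) (ρ / 2)) (by positivity) (min_le_right _ _)
  have h4 : ∀ᶠ s in 𝓝 t, s < t₀ + δ ∧ dist (φ (γ s)) (φ (γ t)) < η / 2 :=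
    Filter.Eventually.and (Iio_mem_nhds htδ) ((hgd t htδ').continuousAt (Metric.ball_mem_nhds _ (half_pos hη)))
  filter_upwards [h3.prod_mk h4] with x hx hxT hxs
  obtain ⟨h5, h6⟩ := hx.1 x.2 hxT hxs hx.2.1
  rw [← φ.left_inv h5]
  apply hηO
  have := min_le_left (η / 2) (ρ / 2)
  linarith [dist_triangle (φ (w x.1 x.2)) (φ (γ x.2)) (φ (γ t)), hx.2.2]

/-- Continuous dependence of integral curves on the vector field and on the initial point: if
`S' k → S` locally uniformly on a set that contains the integral curves `w k` of `S' k`, then these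
converge to the integral curve `γ` of `S`, locally uniformly on its interval of definition. -/
theorem tendsto_of_isMIntegralCurve [T2Space N] [CompleteSpace F] [ProperSpace F]
    {S : (q : N) → TangentSpace I q}
    (hS : ContMDiff I I.tangent 1 (fun q ↦ (⟨q, S q⟩ : TangentBundle I N)))
    {γ : ℝ → N} {J : Set ℝ} (hJo : IsOpen J) (hJc : J.OrdConnected)
    (hγ : IsMIntegralCurveOn γ S J)
    {S' : ι → (q : N) → TangentSpace I q} {l : Filter ι} {Q : Set N}
    (hSS : TendstoLocallyUniformlyInCharts I S' S l Q)
    {w : ι → ℝ → N} {T : ι → Set ℝ} (hT : ∀ k, IsForwardTimeSet (T k))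
    (hw : ∀ k, ∀ s ∈ T k, IsMIntegralCurveAt (w k) (S' k) s)
    (hwQ : ∀ k, ∀ s ∈ T k, w k s ∈ Q) (h0 : Tendsto (fun k ↦ w k 0) l (𝓝 (γ 0))) (h0J : 0 ∈ J)
    {t : ℝ} (ht : t ∈ J) (ht0 : 0 ≤ t) {O : Set N} (hO : O ∈ 𝓝 (γ t)) :
    ∀ᶠ x : ι × ℝ in l ×ˢ 𝓝 t, x.2 ∈ T x.1 → w x.1 x.2 ∈ O := by
  let P : ℝ → Prop := fun s ↦ ∀ O ∈ 𝓝 (γ s), ∀ᶠ x : ι × ℝ in l ×ˢ 𝓝 s,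
    x.2 ∈ T x.1 → w x.1 x.2 ∈ O
  have hP' : ∀ s, P s → ∀ O ∈ 𝓝 (γ s), ∀ᶠ k in l, s ∈ T k → w k s ∈ O := fun s hs O hO ↦
    (hs O hO).curry.mono fun k hk ↦ hk.self_of_nhds
  have hstep : ∀ s₀ ∈ Icc 0 t, ∃ δ > (0 : ℝ), ∀ s, 0 ≤ s → |s - s₀| < δ → P s →
      ∀ r, s ≤ r → r < s₀ + δ → P r := by
    intro s₀ hs₀
    have hs₀J := hJc.out h0J ht hs₀
    obtain ⟨δ, hδ, h⟩ := eventually_mem_nhds_of_tendsto_step hS.contMDiffAt (hJo.mem_nhds hs₀J) hJo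
      hγ hSS hT hw hwQ
    refine ⟨δ, hδ, fun s hs hsδ hPs r hsr hr O hO ↦ ?_⟩
    rcases hsr.eq_or_lt with rfl | hlt
    · exact hPs O hO
    · filter_upwards [h s hs hsδ (hP' s hPs) r hsr hr O hO,
        tendsto_snd.eventually (Ioi_mem_nhds hlt)] with x hx hxs hxT using hx hxT (le_of_lt hxs)
  have hP0 : P 0 := by
    intro O hO
    obtain ⟨δ, hδ, h⟩ := eventually_mem_nhds_of_tendsto_step hS.contMDiffAt (hJo.mem_nhds h0J) hJo
      hγ hSS hT hw hwQ
    have := h 0 le_rfl (by simpa using hδ) (fun O hO ↦ (h0.eventually hO).mono fun k hk _ ↦ hk) 0 le_rfl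
      (by linarith) O hO
    exact this.mono fun x hx hxT ↦ hx hxT (hT _ _ hxT).1
  -- Continuity method: the step centred at the supremum c can start from some s in A close to c,
  -- and it reaches past c unless c = t.
  let A : Set ℝ := {s | s ∈ Icc 0 t ∧ ∀ r ∈ Icc 0 s, P r}
  have h0A : (0 : ℝ) ∈ A := ⟨⟨le_rfl, ht0⟩, fun r hr ↦ by
    rwa [le_antisymm hr.2 hr.1]⟩
  have hlub := isLUB_csSup ⟨0, h0A⟩ ⟨t, fun s hs ↦ hs.1.2⟩
  set c := sSup A
  have hc : c ∈ Icc 0 t := ⟨hlub.1 h0A, hlub.2 fun s hs ↦ hs.1.2⟩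
  obtain ⟨δ, hδ, h⟩ := hstep c hc
  obtain ⟨s, hsA, hs⟩ := (lt_isLUB_iff hlub).1 (sub_lt_self c hδ)
  have hsc : s ≤ c := hlub.1 hsA
  have hPr : ∀ r ∈ Icc 0 t, r < c + δ → P r := by
    intro r hr hrc
    rcases le_total r s with hrs | hrs
    · exact hsA.2 r ⟨hr.1, hrs⟩
    · exact h s hsA.1.1 (by rw [abs_lt]; constructor <;> linarith)
        (hsA.2 s ⟨hsA.1.1, le_rfl⟩) r hrs hrc
  have hmem : min t (c + δ / 2) ∈ A := by
    refine ⟨⟨le_min ht0 (by linarith [hc.1]), min_le_left _ _⟩, fun r hr ↦ hPr r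
      ⟨hr.1, hr.2.trans (min_le_left _ _)⟩ ?_⟩
    linarith [hr.2.trans (min_le_right _ _)]
  have htc : t < c + δ := by
    have := hlub.1 hmem
    rcases min_le_iff.1 this with h | h <;> linarith
  exact hPr t ⟨ht0, le_rfl⟩ htc O hO

end ContinuousDependence

/-! ### Coordinates on the tangent bundle: vertical lifts and differentials of vector fields -/

section SprayCoordinates

/-- The derivative of a map between manifolds, with the target read in a chart. -/
lemma tangentCoordChange_mfderiv
    {F : Type*} [NormedAddCommGroup F] [NormedSpace ℝ F]
    {H : Type*} [TopologicalSpace H] {I : ModelWithCorners ℝ F H}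
    {N : Type*} [TopologicalSpace N] [ChartedSpace H N] [IsManifold I 1 N]
    {F' : Type*} [NormedAddCommGroup F'] [NormedSpace ℝ F']
    {H' : Type*} [TopologicalSpace H'] {I' : ModelWithCorners ℝ F' H'}
    {N' : Type*} [TopologicalSpace N'] [ChartedSpace H' N']
    {f : N' → N} {x : N'} {p q : N} (hf : MDifferentiableAt I' I f x) (hq : f x = q)
    (hp : q ∈ (extChartAt I p).source) (u : F') :
    tangentCoordChange I q p q ((mfderiv I' I f x : F' →L[ℝ] F) u) =
      (mfderiv I' 𝓘(ℝ, F) (extChartAt I p ∘ f) x : F' →L[ℝ] F) u := by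
  subst hq
  rw [extChartAt_source] at hp
  have h0 := hasMFDerivAt_extChartAt (I := I) hp
  rw [mfderiv_chartAt_eq_tangentCoordChange hp] at h0
  have h1 := (HasMFDerivAt.comp x h0 hf.hasMFDerivAt).mfderiv
  rw [h1]
  rfl

variable {E : Type*} [NormedAddCommGroup E] [NormedSpace ℝ E]
  {M : Type*} [TopologicalSpace M] [ChartedSpace E M] [IsManifold 𝓘(ℝ, E) ∞ M]

/-- The fibre coordinate of a tangent vector in the chart at `x`. -/
noncomputable def fiberCoord (x : M) (v : TangentBundle 𝓘(ℝ, E) M) : E :=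
  (trivializationAt E (TangentSpace 𝓘(ℝ, E)) x v).2

lemma extChartAt_tangent_apply (p v : TangentBundle 𝓘(ℝ, E) M) :
    extChartAt 𝓘(ℝ, E).tangent p v = (extChartAt 𝓘(ℝ, E) p.proj v.proj, fiberCoord p.proj v) := by
  rw [FiberBundle.extChartAt]
  rfl

/-- Charts of TM contain whole fibres, so rescaling a vector never leaves the chart. -/
lemma mem_extChartAt_tangent_source {p v : TangentBundle 𝓘(ℝ, E) M} :
    v ∈ (extChartAt 𝓘(ℝ, E).tangent p).source ↔ v.proj ∈ (chartAt E p.proj).source := by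
  rw [extChartAt_source, TangentBundle.mem_chart_source_iff]

lemma fiberCoord_add (x y : M) (u w : TangentSpace 𝓘(ℝ, E) y) :
    fiberCoord x (⟨y, u + w⟩ : TangentBundle 𝓘(ℝ, E) M) =
      fiberCoord x (⟨y, u⟩ : TangentBundle 𝓘(ℝ, E) M) +
      fiberCoord x (⟨y, w⟩ : TangentBundle 𝓘(ℝ, E) M) :=
  map_add (tangentCoordChange 𝓘(ℝ, E) y x y) u w

lemma fiberCoord_smul (x y : M) (r : ℝ) (u : TangentSpace 𝓘(ℝ, E) y) :
    fiberCoord x (⟨y, r • u⟩ : TangentBundle 𝓘(ℝ, E) M) =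
      r • fiberCoord x (⟨y, u⟩ : TangentBundle 𝓘(ℝ, E) M) :=
  map_smul (tangentCoordChange 𝓘(ℝ, E) y x y) r u

lemma contMDiffAt_fiberCoord {x : M} {v : TangentBundle 𝓘(ℝ, E) M}
    (hv : v.proj ∈ (chartAt E x).source) :
    ContMDiffAt 𝓘(ℝ, E).tangent 𝓘(ℝ, E) ∞ (fiberCoord (E := E) x) v := by
  have h := contMDiffAt_id (I := 𝓘(ℝ, E).tangent) (n := ∞) (x := v)
  exact (((trivializationAt E (TangentSpace 𝓘(ℝ, E)) x).contMDiffAt_iff (n := ∞)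
    (IM := 𝓘(ℝ, E).tangent) (IB := 𝓘(ℝ, E)) (f := id) (x₀ := v)
    ((Trivialization.mem_source _).2 hv)).1 h).2

/-- In a chart of TM the defining curve has constant base part and affine fibre part. -/
lemma tangentCoordChange_verticalLift {p v : TangentBundle 𝓘(ℝ, E) M}
    (hv : v.proj ∈ (chartAt E p.proj).source) (w : TangentSpace 𝓘(ℝ, E) v.proj) :
    tangentCoordChange 𝓘(ℝ, E).tangent v p v (verticalLift v w) =
      ((0 : E), fiberCoord p.proj (⟨v.proj, w⟩ : TangentBundle 𝓘(ℝ, E) M)) := by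
  set f : ℝ → TangentBundle 𝓘(ℝ, E) M := fun t ↦ ⟨v.proj, v.snd + t • w⟩ with hf
  have hext : extChartAt 𝓘(ℝ, E).tangent p ∘ f = fun t ↦ (extChartAt 𝓘(ℝ, E) p.proj v.proj,
      fiberCoord p.proj v + t • fiberCoord p.proj (⟨v.proj, w⟩ : TangentBundle 𝓘(ℝ, E) M)) := by
    ext1 t
    rw [Function.comp_apply, extChartAt_tangent_apply]
    have := fiberCoord_smul p.proj v.proj t w
    rw [hf, fiberCoord_add p.proj v.proj v.snd (t • w), this]
  have hd : MDifferentiableAt 𝓘(ℝ, ℝ) 𝓘(ℝ, E).tangent f 0 := by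
    refine ContMDiffAt.mdifferentiableAt (n := ∞) ?_ (by simp)
    refine ((trivializationAt E (TangentSpace 𝓘(ℝ, E)) p.proj).contMDiffAt_iff (n := ∞)
      (IM := 𝓘(ℝ, ℝ)) (IB := 𝓘(ℝ, E)) (f := f) (x₀ := (0 : ℝ))
      ((Trivialization.mem_source _).2 hv)).2 ⟨contMDiffAt_const, ?_⟩
    have h2 : (fun t ↦ (trivializationAt E (TangentSpace 𝓘(ℝ, E)) p.proj (f t)).2) = fun t ↦
        fiberCoord p.proj v + t • fiberCoord p.proj (⟨v.proj, w⟩ : TangentBundle 𝓘(ℝ, E) M) := by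
      ext1 t
      exact congrArg Prod.snd (congrFun hext t)
    rw [h2]
    apply ContDiffAt.contMDiffAt
    fun_prop
  have hf0 : f 0 = v := by simp [hf]
  have key := tangentCoordChange_mfderiv (p := p) hd hf0 (mem_extChartAt_tangent_source.2 hv) (1 : ℝ)
  refine key.trans ?_
  have h3 : HasDerivAt (fun t : ℝ ↦ (extChartAt 𝓘(ℝ, E) p.proj v.proj, fiberCoord p.proj v +
      t • fiberCoord p.proj (⟨v.proj, w⟩ : TangentBundle 𝓘(ℝ, E) M)))
      ((0 : E), fiberCoord p.proj (⟨v.proj, w⟩ : TangentBundle 𝓘(ℝ, E) M)) 0 := by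
    refine (hasDerivAt_const _ _).prodMk ?_
    simpa using ((hasDerivAt_id (0 : ℝ)).smul_const
      (fiberCoord p.proj (⟨v.proj, w⟩ : TangentBundle 𝓘(ℝ, E) M))).const_add (fiberCoord p.proj v)
  rw [hext, mfderiv_eq_fderiv]
  exact (congrArg (fun L : ℝ →L[ℝ] E × E ↦ L 1) h3.hasFDerivAt.fderiv).trans (by simp)

/-- The differential of a vector field `Y` at `x`, in coordinates. -/
lemma tangentCoordChange_mfderiv_section {p : TangentBundle 𝓘(ℝ, E) M} {x : M}
    {Y : (x : M) → TangentSpace 𝓘(ℝ, E) x} {v : TangentBundle 𝓘(ℝ, E) M} (hv : v.proj = x)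
    (hY : MDifferentiableAt 𝓘(ℝ, E) 𝓘(ℝ, E).tangent
      (fun y ↦ (⟨y, Y y⟩ : TangentBundle 𝓘(ℝ, E) M)) x) (hYv : (⟨x, Y x⟩ : TangentBundle 𝓘(ℝ, E) M) = v)
    (hx : x ∈ (chartAt E p.proj).source) (u : E) :
    tangentCoordChange 𝓘(ℝ, E).tangent v p v ((mfderiv 𝓘(ℝ, E) 𝓘(ℝ, E).tangent
        (fun y ↦ (⟨y, Y y⟩ : TangentBundle 𝓘(ℝ, E) M)) x : E →L[ℝ] E × E) u) =
      (fiberCoord p.proj (⟨x, u⟩ : TangentBundle 𝓘(ℝ, E) M),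
        (mfderiv 𝓘(ℝ, E) 𝓘(ℝ, E) (fun y ↦ fiberCoord p.proj
          (⟨y, Y y⟩ : TangentBundle 𝓘(ℝ, E) M)) x : E →L[ℝ] E) u) := by
  have hsrc : v ∈ (extChartAt 𝓘(ℝ, E).tangent p).source :=
    mem_extChartAt_tangent_source.2 (hv ▸ hx)
  refine (tangentCoordChange_mfderiv hY hYv hsrc u).trans ?_
  have hext : extChartAt 𝓘(ℝ, E).tangent p ∘ (fun y ↦ (⟨y, Y y⟩ : TangentBundle 𝓘(ℝ, E) M)) =
      fun y ↦ (extChartAt 𝓘(ℝ, E) p.proj y, fiberCoord p.proj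
          (⟨y, Y y⟩ : TangentBundle 𝓘(ℝ, E) M)) := by
    ext1 y
    rw [Function.comp_apply, extChartAt_tangent_apply]
  have h1 := hasMFDerivAt_extChartAt (I := 𝓘(ℝ, E)) hx
  rw [mfderiv_chartAt_eq_tangentCoordChange hx] at h1
  have h2 : MDifferentiableAt 𝓘(ℝ, E) 𝓘(ℝ, E) (fun y ↦ fiberCoord p.proj
      (⟨y, Y y⟩ : TangentBundle 𝓘(ℝ, E) M)) x := by
    have h3 := (contMDiffAt_fiberCoord (E := E) (x := p.proj) (v := ⟨x, Y x⟩) hx).mdifferentiableAt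
      (by simp)
    exact MDifferentiableAt.comp (g := fiberCoord p.proj) x h3 hY
  have h3 := h2.hasMFDerivAt
  have h4 : HasMFDerivAt 𝓘(ℝ, E) 𝓘(ℝ, E × E) (fun y ↦ (extChartAt 𝓘(ℝ, E) p.proj y,
      fiberCoord p.proj (⟨y, Y y⟩ : TangentBundle 𝓘(ℝ, E) M))) x
      (ContinuousLinearMap.prod (tangentCoordChange 𝓘(ℝ, E) x p.proj x)
        (mfderiv 𝓘(ℝ, E) 𝓘(ℝ, E) (fun y ↦ fiberCoord p.proj
          (⟨y, Y y⟩ : TangentBundle 𝓘(ℝ, E) M)) x : E →L[ℝ] E) : E →L[ℝ] E × E) :=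
    ⟨h1.1.prodMk h3.1, HasFDerivWithinAt.prodMk (E := E) (F := E) (G := E) h1.2 h3.2⟩
  rw [hext, h4.mfderiv]
  rfl

end SprayCoordinates

/-! ### The geodesic spray in coordinates and its quadratic homogeneity -/

section Spray

variable {E : Type*} [NormedAddCommGroup E] [NormedSpace ℝ E]
  {M : Type*} [TopologicalSpace M] [ChartedSpace E M] [IsManifold 𝓘(ℝ, E) ∞ M]

lemma fiberBundle_extend_smul {x y : M} (hy : y ∈ (chartAt E x).source) (r : ℝ)
    (u : TangentSpace 𝓘(ℝ, E) x) :
    (FiberBundle.extend E (r • u) y : TangentSpace 𝓘(ℝ, E) y) = r • FiberBundle.extend E u y := by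
  have h := fiberCoord_smul x x r u
  simp only [fiberCoord] at h
  simp only [FiberBundle.extend]
  rw [h]
  have h2 := map_smul ((trivializationAt E (TangentSpace 𝓘(ℝ, E)) x).symmₗ ℝ y) r
    (trivializationAt E (TangentSpace 𝓘(ℝ, E)) x ⟨x, u⟩).2
  rwa [Trivialization.coe_symmₗ _ hy] at h2

lemma mdifferentiableAt_fiberCoord_comp {x z : M} (hx : x ∈ (chartAt E z).source)
    {Y : (x : M) → TangentSpace 𝓘(ℝ, E) x}
    (hY : MDifferentiableAt 𝓘(ℝ, E) 𝓘(ℝ, E).tangent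
      (fun y ↦ (⟨y, Y y⟩ : TangentBundle 𝓘(ℝ, E) M)) x) :
    MDifferentiableAt 𝓘(ℝ, E) 𝓘(ℝ, E)
      (fun y ↦ fiberCoord z (⟨y, Y y⟩ : TangentBundle 𝓘(ℝ, E) M)) x := by
  have h3 := (contMDiffAt_fiberCoord (E := E) (x := z) (v := ⟨x, Y x⟩) hx).mdifferentiableAt
    (by simp)
  exact MDifferentiableAt.comp (g := fiberCoord z) x h3 hY

/-- The derivative of a vector field in the trivialization at `z`. -/
noncomputable def coordDeriv (z : M) (Y : (x : M) → TangentSpace 𝓘(ℝ, E) x) (x : M) : E →L[ℝ] E :=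
  mfderiv 𝓘(ℝ, E) 𝓘(ℝ, E) (fun y ↦ fiberCoord z (⟨y, Y y⟩ : TangentBundle 𝓘(ℝ, E) M)) x

namespace LinearConnection

variable (D : LinearConnection E M)

/-- The geodesic spray in coordinates. -/
lemma tangentCoordChange_geodesicSpray_aux {p v : TangentBundle 𝓘(ℝ, E) M}
    (hv : v.proj ∈ (chartAt E p.proj).source) :
    tangentCoordChange 𝓘(ℝ, E).tangent v p v (D.geodesicSpray v) =
      (fiberCoord p.proj v,
        coordDeriv p.proj (FiberBundle.extend E v.snd) v.proj v.snd -
        fiberCoord p.proj (⟨v.proj, D.toFun (FiberBundle.extend E v.snd) v.proj v.snd⟩ :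
          TangentBundle 𝓘(ℝ, E) M)) := by
  have h1 := tangentCoordChange_mfderiv_section (p := p) (x := v.proj) (v := v)
    (Y := FiberBundle.extend E v.snd) rfl (FiberBundle.mdifferentiableAt_extend 𝓘(ℝ, E) E v.snd)
    (by rw [FiberBundle.extend_apply_self]) hv v.snd
  have h2 := tangentCoordChange_verticalLift (p := p) hv
    (D.toFun (FiberBundle.extend E v.snd) v.proj v.snd)
  have h3 := map_sub (tangentCoordChange 𝓘(ℝ, E).tangent v p v)
    ((mfderiv 𝓘(ℝ, E) 𝓘(ℝ, E).tangent (fun y ↦ (⟨y, FiberBundle.extend E v.snd y⟩ :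
      TangentBundle 𝓘(ℝ, E) M)) v.proj : E →L[ℝ] E × E) v.snd)
    (verticalLift v (D.toFun (FiberBundle.extend E v.snd) v.proj v.snd))
  refine h3.trans ?_
  refine (congrArg₂ (fun a b : E × E ↦ a - b) h1 h2).trans ?_
  exact Prod.ext (sub_zero (fiberCoord p.proj v)) rfl

/-- The vertical component of the geodesic spray in the chart at `x`. -/
noncomputable def sprayCoord (x : M) (v : TangentBundle 𝓘(ℝ, E) M) : E :=
  (tangentCoordChange 𝓘(ℝ, E).tangent v (⟨x, 0⟩ : TangentBundle 𝓘(ℝ, E) M) v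
    (D.geodesicSpray v) : E × E).2

/-- The spray is a second-order field, and charts of TM depend on p only through its base point;
hence comparing sprays reduces to comparing `sprayCoord`. -/
lemma tangentCoordChange_geodesicSpray {p v : TangentBundle 𝓘(ℝ, E) M}
    (hv : v.proj ∈ (chartAt E p.proj).source) :
    tangentCoordChange 𝓘(ℝ, E).tangent v p v (D.geodesicSpray v) =
      (fiberCoord p.proj v, D.sprayCoord p.proj v) := by
  rw [sprayCoord, D.tangentCoordChange_geodesicSpray_aux (p := ⟨p.proj, 0⟩) hv,
    D.tangentCoordChange_geodesicSpray_aux hv]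

/-- Near the base point the extension of r • u is r times that of u. Both terms of the spray are
linear in the extension and linear in the direction, which gives the factor r². -/
lemma sprayCoord_smul {x : M} {v : TangentBundle 𝓘(ℝ, E) M} (hv : v.proj ∈ (chartAt E x).source)
    (r : ℝ) : D.sprayCoord x ⟨v.proj, r • v.snd⟩ = r ^ 2 • D.sprayCoord x v := by
  obtain ⟨y, u⟩ := v
  rw [sprayCoord, sprayCoord, D.tangentCoordChange_geodesicSpray_aux (p := ⟨x, 0⟩) hv,
    D.tangentCoordChange_geodesicSpray_aux (p := ⟨x, 0⟩) (v := ⟨y, r • u⟩) hv]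
  dsimp only at hv ⊢
  have hmd := FiberBundle.mdifferentiableAt_extend 𝓘(ℝ, E) E u
  have hev : ∀ᶠ z in 𝓝 y, (FiberBundle.extend E (r • u) : (z : M) → TangentSpace 𝓘(ℝ, E) z) z =
      (r • (FiberBundle.extend E u : (z : M) → TangentSpace 𝓘(ℝ, E) z)) z := by
    filter_upwards [(chartAt E y).open_source.mem_nhds (mem_chart_source E y)] with z hz
    exact fiberBundle_extend_smul hz r u
  have hmd' := FiberBundle.mdifferentiableAt_extend 𝓘(ℝ, E) E (r • u)
  have h1 : D.toFun (FiberBundle.extend E (r • u)) y = r • D.toFun (FiberBundle.extend E u) y := by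
    rw [← D.isCovariantDerivativeOnUniv.smul_const r hmd]
    exact D.isCovariantDerivativeOnUniv.congr_of_eventuallyEq hmd'
      (MDifferentiableAt.smul_const_section hmd) Filter.univ_mem hev
  have h2 : (fun z ↦ fiberCoord x (⟨z, FiberBundle.extend E (r • u) z⟩ :
      TangentBundle 𝓘(ℝ, E) M)) =ᶠ[𝓝 y] r • (fun z ↦ fiberCoord x (⟨z, FiberBundle.extend E u z⟩ :
      TangentBundle 𝓘(ℝ, E) M)) := by
    filter_upwards [hev] with z hz
    rw [hz, Pi.smul_apply, Pi.smul_apply, fiberCoord_smul]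
  have h3 : coordDeriv x (FiberBundle.extend E (r • u)) y =
      r • coordDeriv x (FiberBundle.extend E u) y :=
    (((mdifferentiableAt_fiberCoord_comp hv hmd).hasMFDerivAt.const_smul r).congr_of_eventuallyEq
      h2).mfderiv
  have h4 : (D.toFun (FiberBundle.extend E (r • u)) y) (r • u) =
      r ^ 2 • (D.toFun (FiberBundle.extend E u) y) u := by
    rw [h1, map_smul, pow_two, mul_smul]
    rfl
  have h5 : coordDeriv x (FiberBundle.extend E (r • u)) y (r • (u : E) : E) =
      r ^ 2 • coordDeriv x (FiberBundle.extend E u) y u := by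
    have hgen : ∀ (L : E →L[ℝ] E) (u : E), (r • L) (r • u) = r ^ 2 • L u := fun L u ↦ by
      rw [map_smul, pow_two, mul_smul, smul_apply]
    exact (congrArg (fun L : E →L[ℝ] E ↦ L (r • (u : E))) h3).trans (hgen _ u)
  rw [smul_sub, ← fiberCoord_smul, ← h4]
  exact congrArg (· - _) h5

end LinearConnection

end Spray

/-! ### Smoothness of the spray -/

section SpraySmooth

variable {E : Type*} [NormedAddCommGroup E] [NormedSpace ℝ E]
  {M : Type*} [TopologicalSpace M] [ChartedSpace E M] [IsManifold 𝓘(ℝ, E) ∞ M]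

lemma fiberCoord_self (x : M) (u : TangentSpace 𝓘(ℝ, E) x) :
    fiberCoord x (⟨x, u⟩ : TangentBundle 𝓘(ℝ, E) M) = u :=
  tangentCoordChange_self (mem_extChartAt_source x)

lemma fiberCoord_injective {x y : M} (hy : y ∈ (chartAt E x).source)
    {u w : TangentSpace 𝓘(ℝ, E) y}
    (h : fiberCoord x (⟨y, u⟩ : TangentBundle 𝓘(ℝ, E) M) =
      fiberCoord x (⟨y, w⟩ : TangentBundle 𝓘(ℝ, E) M)) : u = w := by
  have h1 : (trivializationAt E (TangentSpace 𝓘(ℝ, E)) x) (⟨y, u⟩ : TangentBundle 𝓘(ℝ, E) M) =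
      (trivializationAt E (TangentSpace 𝓘(ℝ, E)) x) (⟨y, w⟩ : TangentBundle 𝓘(ℝ, E) M) :=
    Prod.ext (((trivializationAt E (TangentSpace 𝓘(ℝ, E)) x).coe_fst'
        (x := (⟨y, u⟩ : TangentBundle 𝓘(ℝ, E) M)) hy).trans
      ((trivializationAt E (TangentSpace 𝓘(ℝ, E)) x).coe_fst'
        (x := (⟨y, w⟩ : TangentBundle 𝓘(ℝ, E) M)) hy).symm) h
  have h2 := (trivializationAt E (TangentSpace 𝓘(ℝ, E)) x).injOn
    (x₁ := (⟨y, u⟩ : TangentBundle 𝓘(ℝ, E) M)) (x₂ := (⟨y, w⟩ : TangentBundle 𝓘(ℝ, E) M))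
    ((Trivialization.mem_source _).2 hy) ((Trivialization.mem_source _).2 hy) h1
  simpa using h2

lemma fiberCoord_sum {ι : Type*} (s : Finset ι) (x y : M) (u : ι → TangentSpace 𝓘(ℝ, E) y) :
    fiberCoord x (⟨y, ∑ i ∈ s, u i⟩ : TangentBundle 𝓘(ℝ, E) M) =
      ∑ i ∈ s, fiberCoord x (⟨y, u i⟩ : TangentBundle 𝓘(ℝ, E) M) :=
  map_sum (tangentCoordChange 𝓘(ℝ, E) y x y) u s

lemma LinearConnection.toFun_sum_smul (D : LinearConnection E M) {ι : Type*} (s : Finset ι)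
    {g : ι → M → ℝ} {σ : ι → (x : M) → TangentSpace 𝓘(ℝ, E) x} {x : M}
    (hg : ∀ i, MDifferentiableAt 𝓘(ℝ, E) 𝓘(ℝ, ℝ) (g i) x)
    (hσ : ∀ i, MDifferentiableAt 𝓘(ℝ, E) 𝓘(ℝ, E).tangent
      (fun y ↦ (⟨y, σ i y⟩ : TangentBundle 𝓘(ℝ, E) M)) x) (v : TangentSpace 𝓘(ℝ, E) x) :
    D.toFun (fun y ↦ ∑ i ∈ s, g i y • σ i y) x v =
      ∑ i ∈ s, (g i x • D.toFun (σ i) x v + mvfderiv 𝓘(ℝ, E) (g i) x v • σ i x) := by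
  classical
  induction s using Finset.induction_on with
  | empty =>
    simp only [Finset.sum_empty]
    have : D.toFun (fun _ ↦ 0) x = 0 := D.isCovariantDerivativeOnUniv.zero
    rw [this]; rfl
  | insert j s hj ih =>
    simp only [Finset.sum_insert hj]
    rw [← ih]
    have h1 : MDifferentiableAt 𝓘(ℝ, E) 𝓘(ℝ, E).tangent
        (fun y ↦ (⟨y, (g j • σ j) y⟩ : TangentBundle 𝓘(ℝ, E) M)) x := (hg j).smul_section (hσ j)
    have h2 : MDifferentiableAt 𝓘(ℝ, E) 𝓘(ℝ, E).tangent
        (fun y ↦ (⟨y, (fun y ↦ ∑ i ∈ s, g i y • σ i y) y⟩ : TangentBundle 𝓘(ℝ, E) M)) x :=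
      MDifferentiableAt.sum_section fun i _ ↦ (hg i).smul_section (hσ i)
    have h3 := D.isCovariantDerivativeOnUniv.add h1 h2
    have h4 := D.isCovariantDerivativeOnUniv.leibniz (hσ j) (hg j)
    rw [h4] at h3
    exact congrArg (fun L : TangentSpace 𝓘(ℝ, E) x →L[ℝ] TangentSpace 𝓘(ℝ, E) x ↦ L v) h3

/-- A smooth vector field whose coordinates in the chart at `z` are constant near `z`. -/
lemma exists_contMDiff_fiberCoord_eventually_eq [FiniteDimensional ℝ E] [T2Space M] (z : M)
    (e : E) : ∃ σ : (x : M) → TangentSpace 𝓘(ℝ, E) x,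
      ContMDiff 𝓘(ℝ, E) 𝓘(ℝ, E).tangent ∞ (fun x ↦ (⟨x, σ x⟩ : TangentBundle 𝓘(ℝ, E) M)) ∧
      ∀ᶠ x in 𝓝 z, fiberCoord z (⟨x, σ x⟩ : TangentBundle 𝓘(ℝ, E) M) = e := by
  set u : TangentSpace 𝓘(ℝ, E) z := e
  obtain ⟨s, hs, hsm⟩ := FiberBundle.exists_contMDiffOn_extend (k := ∞) 𝓘(ℝ, E) E u
  obtain ⟨ψ, -, hψ⟩ := (SmoothBumpFunction.nhds_basis_tsupport (I := 𝓘(ℝ, E)) z).mem_iff.1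
    (interior_mem_nhds.2 hs)
  refine ⟨(ψ : M → ℝ) • FiberBundle.extend E u, ContMDiffOn.smul_section_of_tsupport
    (u := interior s) ψ.contMDiff.contMDiffOn isOpen_interior hψ (hsm.mono interior_subset), ?_⟩
  filter_upwards [ψ.eventuallyEq_one, (chartAt E z).open_source.mem_nhds (mem_chart_source E z)]
    with x hx hx2
  have h1 : ((ψ : M → ℝ) • FiberBundle.extend E u) x = FiberBundle.extend E u x := by
    rw [Pi.smul_apply', hx]; exact one_smul ℝ _
  rw [h1]
  have h2 := (trivializationAt E (TangentSpace 𝓘(ℝ, E)) z).apply_mk_symm (b := x) hx2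
    (fiberCoord z (⟨z, u⟩ : TangentBundle 𝓘(ℝ, E) M))
  exact (congrArg Prod.snd h2).trans (fiberCoord_self z u)

/-- The extension used to define the spray changes with v, so smoothness in v is not visible there.
After expansion in a fixed frame with constant coordinates, the derivative terms of the Leibniz rule
cancel the vertical part of dY(v), and the Christoffel expression remains. -/
lemma LinearConnection.sprayCoord_eq_sum (D : LinearConnection E M) {ι : Type*} [Fintype ι]
    (b : Module.Basis ι ℝ E) {z : M} {σ : ι → (x : M) → TangentSpace 𝓘(ℝ, E) x}
    (hσ : ∀ i, ContMDiff 𝓘(ℝ, E) 𝓘(ℝ, E).tangent ∞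
      (fun x ↦ (⟨x, σ i x⟩ : TangentBundle 𝓘(ℝ, E) M)))
    {v : TangentBundle 𝓘(ℝ, E) M} (hv : v.proj ∈ (chartAt E z).source)
    (hσz : ∀ᶠ x in 𝓝 v.proj, ∀ i,
      fiberCoord z (⟨x, σ i x⟩ : TangentBundle 𝓘(ℝ, E) M) = b i) :
    D.sprayCoord z v = -∑ i, b.repr (fiberCoord z v) i •
      fiberCoord z (⟨v.proj, D.toFun (σ i) v.proj v.snd⟩ : TangentBundle 𝓘(ℝ, E) M) := by
  have : FiniteDimensional ℝ E := b.finiteDimensional_of_finite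
  obtain ⟨y, u⟩ := v
  rw [sprayCoord, D.tangentCoordChange_geodesicSpray_aux (p := ⟨z, 0⟩) hv]
  dsimp only at hv hσz ⊢
  set Y : (x : M) → TangentSpace 𝓘(ℝ, E) x := FiberBundle.extend E u with hY
  have hmd : MDifferentiableAt 𝓘(ℝ, E) 𝓘(ℝ, E).tangent
    (fun x ↦ (⟨x, Y x⟩ : TangentBundle 𝓘(ℝ, E) M)) y :=
    FiberBundle.mdifferentiableAt_extend 𝓘(ℝ, E) E u
  have hYy : Y y = u := FiberBundle.extend_apply_self E u
  have hf := mdifferentiableAt_fiberCoord_comp hv hmd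
  set f : M → E := fun x ↦ fiberCoord z (⟨x, Y x⟩ : TangentBundle 𝓘(ℝ, E) M) with hfdef
  set c : ι → E →L[ℝ] ℝ := fun i ↦ LinearMap.toContinuousLinearMap (b.coord i) with hc
  have hg : ∀ i, HasMFDerivAt 𝓘(ℝ, E) 𝓘(ℝ, ℝ) (fun x ↦ c i (f x)) y
      (ContinuousLinearMap.comp (c i) (coordDeriv z Y y) : E →L[ℝ] ℝ) := fun i ↦ by
    have h1 : HasMFDerivAt 𝓘(ℝ, E) 𝓘(ℝ, ℝ) (c i) (f y) (c i) := (c i).hasFDerivAt.hasMFDerivAt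
    exact HasMFDerivAt.comp y h1 hf.hasMFDerivAt
  have hσd : ∀ i, MDifferentiableAt 𝓘(ℝ, E) 𝓘(ℝ, E).tangent
    (fun x ↦ (⟨x, σ i x⟩ : TangentBundle 𝓘(ℝ, E) M)) y := fun i ↦
    (hσ i).mdifferentiableAt (by simp)
  have hsum : ∀ᶠ x in 𝓝 y, Y x = ∑ i, c i (f x) • σ i x := by
    filter_upwards [hσz, (chartAt E z).open_source.mem_nhds hv] with x hx hxz
    refine fiberCoord_injective hxz ?_
    have h1 := fiberCoord_sum Finset.univ z x (fun i ↦ c i (f x) • σ i x)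
    rw [h1]
    have h2 : ∀ i, fiberCoord z (⟨x, c i (f x) • σ i x⟩ : TangentBundle 𝓘(ℝ, E) M) =
        c i (f x) • b i := fun i ↦ by
      have := fiberCoord_smul z x (c i (f x)) (σ i x)
      rw [this, hx i]
    simp only [h2]
    exact (b.sum_repr (f x)).symm
  have hmd2 : MDifferentiableAt 𝓘(ℝ, E) 𝓘(ℝ, E).tangent
      (fun x ↦ (⟨x, ∑ i, c i (f x) • σ i x⟩ : TangentBundle 𝓘(ℝ, E) M)) y :=
    MDifferentiableAt.sum_section fun i _ ↦ (hg i).mdifferentiableAt.smul_section (hσd i)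
  have h1 : D.toFun Y y u = ∑ i, (c i (f y) • D.toFun (σ i) y u +
      (c i (coordDeriv z Y y u)) • σ i y) := by
    rw [D.isCovariantDerivativeOnUniv.congr_of_eventuallyEq hmd hmd2 Filter.univ_mem hsum,
      D.toFun_sum_smul Finset.univ (fun i ↦ (hg i).mdifferentiableAt) hσd]
    refine Finset.sum_congr rfl fun i _ ↦ ?_
    congr 2
    exact congrArg (fun L : E →L[ℝ] ℝ ↦ L u) (hg i).mfderiv
  have hfy : f y = fiberCoord z (⟨y, u⟩ : TangentBundle 𝓘(ℝ, E) M) := by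
    rw [hfdef]; dsimp only; rw [hYy]
  have h2 : fiberCoord z (⟨y, D.toFun Y y u⟩ : TangentBundle 𝓘(ℝ, E) M) =
      (∑ i, c i (f y) • fiberCoord z (⟨y, D.toFun (σ i) y u⟩ : TangentBundle 𝓘(ℝ, E) M)) +
      coordDeriv z Y y u := by
    rw [h1, fiberCoord_sum Finset.univ z y (fun i ↦ c i (f y) • D.toFun (σ i) y u +
      (c i (coordDeriv z Y y u)) • σ i y), ← b.sum_repr (coordDeriv z Y y u),
      ← Finset.sum_add_distrib]
    refine Finset.sum_congr rfl fun i _ ↦ ?_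
    have e1 := fiberCoord_add z y (c i (f y) • D.toFun (σ i) y u)
      ((c i (coordDeriv z Y y u)) • σ i y)
    have e2 := fiberCoord_smul z y (c i (f y)) (D.toFun (σ i) y u)
    have e3 := fiberCoord_smul z y (c i (coordDeriv z Y y u)) (σ i y)
    rw [hσz.self_of_nhds i] at e3
    rw [e2, e3] at e1
    rw [b.sum_repr]
    exact e1
  refine (congrArg (fun a : E ↦ coordDeriv z Y y u - a) h2).trans ?_
  rw [hfy]
  simp only [hc]
  rw [sub_add_cancel_right]
  rfl

lemma LinearConnection.contMDiffAt_sprayCoord [FiniteDimensional ℝ E] [T2Space M]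
    (D : LinearConnection E M) (v : TangentBundle 𝓘(ℝ, E) M) :
    ContMDiffAt 𝓘(ℝ, E).tangent 𝓘(ℝ, E) ∞ (D.sprayCoord v.proj) v := by
  set z := v.proj with hz
  set b := Module.finBasis ℝ E
  choose σ hσ hσz using fun i ↦ exists_contMDiff_fiberCoord_eventually_eq z (b i)
  have hsrc : ∀ᶠ w in 𝓝 v, w.proj ∈ (chartAt E z).source :=
    (FiberBundle.continuous_proj E (TangentSpace 𝓘(ℝ, E) : M → Type _)).continuousAt.eventually
      ((chartAt E z).open_source.mem_nhds (mem_chart_source E z))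
  have hev : D.sprayCoord z =ᶠ[𝓝 v] fun w ↦ -∑ i, b.repr (fiberCoord z w) i •
      fiberCoord z (⟨w.proj, D.toFun (σ i) w.proj w.snd⟩ : TangentBundle 𝓘(ℝ, E) M) := by
    have h2 : ∀ᶠ w in 𝓝 v, ∀ᶠ x in 𝓝 w.proj, ∀ i,
        fiberCoord z (⟨x, σ i x⟩ : TangentBundle 𝓘(ℝ, E) M) = b i :=
      (FiberBundle.continuous_proj E (TangentSpace 𝓘(ℝ, E) : M → Type _)).continuousAt.eventually
        (eventually_eventually_nhds.2 (eventually_all.2 hσz))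
    filter_upwards [hsrc, h2] with w hw hw2
    exact D.sprayCoord_eq_sum b hσ hw hw2
  refine ContMDiffAt.congr_of_eventuallyEq ?_ hev
  have hsm : ∀ i, ContMDiffAt 𝓘(ℝ, E).tangent 𝓘(ℝ, E) ∞ (fun w : TangentBundle 𝓘(ℝ, E) M ↦
      b.repr (fiberCoord z w) i • fiberCoord z
        (⟨w.proj, D.toFun (σ i) w.proj w.snd⟩ : TangentBundle 𝓘(ℝ, E) M)) v := fun i ↦ ?_
  · exact ContMDiffAt.neg (contMDiffAt_finsetSum fun i _ ↦ hsm i)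
  refine ContMDiffAt.smul (G := ℝ) (M := E) (I := 𝓘(ℝ, ℝ)) (I' := 𝓘(ℝ, E)) (f := fun w ↦ b.repr (fiberCoord z w) i) ?_ ?_
  · have h1 := contMDiffAt_fiberCoord (E := E) (x := z) (v := v) (mem_chart_source E z)
    exact ((LinearMap.toContinuousLinearMap (b.coord i)).contMDiff.contMDiffAt).comp v h1
  · have h1 : ContMDiff 𝓘(ℝ, E) (𝓘(ℝ, E).prod 𝓘(ℝ, E →L[ℝ] E)) ∞
        (fun x ↦ TotalSpace.mk' (E →L[ℝ] E) (E := fun x : M ↦ (TangentSpace 𝓘(ℝ, E) x →L[ℝ]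
          TangentSpace 𝓘(ℝ, E) x)) x (D.toFun (σ i) x)) :=
      contMDiffOn_univ.1 (D.smooth.contMDiff.contMDiff (hσ i).contMDiffOn)
    have hπ : ContMDiff 𝓘(ℝ, E).tangent 𝓘(ℝ, E) ∞
        (fun w : TangentBundle 𝓘(ℝ, E) M ↦ w.proj) :=
      contMDiff_proj (TangentSpace 𝓘(ℝ, E) : M → Type _)
    have h2 := h1.comp hπ
    have h3 : ContMDiffAt 𝓘(ℝ, E).tangent 𝓘(ℝ, E).tangent ∞
        (fun w : TangentBundle 𝓘(ℝ, E) M ↦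
          (⟨w.proj, D.toFun (σ i) w.proj w.snd⟩ : TangentBundle 𝓘(ℝ, E) M)) v :=
      ContMDiffAt.clm_bundle_apply (b := fun w : TangentBundle 𝓘(ℝ, E) M ↦ w.proj)
        (E₁ := (TangentSpace 𝓘(ℝ, E) : M → Type _)) (E₂ := (TangentSpace 𝓘(ℝ, E) : M → Type _))
        (ϕ := fun w ↦ D.toFun (σ i) w.proj) (v := fun w ↦ w.snd) h2.contMDiffAt
        contMDiffAt_id
    exact ContMDiffAt.comp v (g := fiberCoord (E := E) z)
      (contMDiffAt_fiberCoord (mem_chart_source E z)) h3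

/-- The geodesic spray of a smooth connection is a smooth vector field. -/
lemma LinearConnection.contMDiff_geodesicSpray [FiniteDimensional ℝ E] [T2Space M]
    (D : LinearConnection E M) : ContMDiff 𝓘(ℝ, E).tangent 𝓘(ℝ, E).tangent.tangent 1
      (fun v ↦ (⟨v, D.geodesicSpray v⟩ :
        TangentBundle 𝓘(ℝ, E).tangent (TangentBundle 𝓘(ℝ, E) M))) := by
  intro v
  rw [contMDiffAt_section]
  have hsrc : ∀ᶠ w in 𝓝 v, w.proj ∈ (chartAt E v.proj).source :=
    (FiberBundle.continuous_proj E (TangentSpace 𝓘(ℝ, E) : M → Type _)).continuousAt.eventually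
      ((chartAt E v.proj).open_source.mem_nhds (mem_chart_source E v.proj))
  have h1 : ContMDiffAt 𝓘(ℝ, E).tangent 𝓘(ℝ, E × E) 1
      (fun w ↦ (fiberCoord v.proj w, D.sprayCoord v.proj w)) v :=
    ((contMDiffAt_fiberCoord (E := E) (x := v.proj) (v := v)
      (mem_chart_source E v.proj)).of_le (by simp)).prodMk_space
      ((D.contMDiffAt_sprayCoord v).of_le (by simp))
  refine h1.congr_of_eventuallyEq ?_
  filter_upwards [hsrc] with w hw
  exact D.tangentCoordChange_geodesicSpray hw

end SpraySmooth

/-! ### Fibre scaling, and geodesics versus integral curves of the spray -/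

section SprayCurves

variable {E : Type*} [NormedAddCommGroup E] [NormedSpace ℝ E]
  {M : Type*} [TopologicalSpace M] [ChartedSpace E M] [IsManifold 𝓘(ℝ, E) ∞ M]

lemma TangentBundle.continuous_totalSpace_proj :
    Continuous (fun v : TangentBundle 𝓘(ℝ, E) M ↦ v.proj) :=
  FiberBundle.continuous_proj E (TangentSpace 𝓘(ℝ, E) : M → Type _)

/-- The tangent bundle of a Hausdorff manifold is Hausdorff. -/
lemma TangentBundle.t2Space [T2Space M] : T2Space (TangentBundle 𝓘(ℝ, E) M) := by
  refine ⟨fun v w hvw ↦ ?_⟩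
  by_cases hp : v.proj = w.proj
  · set e := trivializationAt E (TangentSpace 𝓘(ℝ, E)) v.proj
    have hv : v ∈ e.source := (Trivialization.mem_source _).2 (mem_chart_source E v.proj)
    have hw : w ∈ e.source := (Trivialization.mem_source _).2 (hp ▸ mem_chart_source E v.proj)
    obtain ⟨A, B, hA, hB, hvA, hwB, hAB⟩ := t2_separation (e.injOn.ne hv hw hvw)
    refine ⟨e.source ∩ e ⁻¹' A, e.source ∩ e ⁻¹' B, e.isOpen_inter_preimage hA,
      e.isOpen_inter_preimage hB, ⟨hv, hvA⟩, ⟨hw, hwB⟩, ?_⟩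
    exact (hAB.preimage e).mono inter_subset_right inter_subset_right
  · obtain ⟨A, B, hA, hB, hvA, hwB, hAB⟩ := t2_separation hp
    exact ⟨_, _, hA.preimage continuous_totalSpace_proj, hB.preimage continuous_totalSpace_proj, hvA, hwB,
      hAB.preimage _⟩

/-- Multiplication by `r` in the fibres of the tangent bundle. -/
noncomputable def TangentBundle.scale (r : ℝ) (v : TangentBundle 𝓘(ℝ, E) M) : TangentBundle 𝓘(ℝ, E) M :=
  ⟨v.proj, r • v.snd⟩

open TangentBundle

@[simp] lemma TangentBundle.scale_proj (r : ℝ) (v : TangentBundle 𝓘(ℝ, E) M) :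
    (scale r v).proj = v.proj := rfl

@[simp] lemma TangentBundle.scale_scale (r s : ℝ) (v : TangentBundle 𝓘(ℝ, E) M) :
    scale r (scale s v) = scale (r * s) v := by
  simp only [scale, mul_smul]
  rfl

@[simp] lemma TangentBundle.scale_one (v : TangentBundle 𝓘(ℝ, E) M) : scale 1 v = v := by
  obtain ⟨x, u⟩ := v
  simp [scale]

lemma fiberCoord_scale (x : M) (r : ℝ) (v : TangentBundle 𝓘(ℝ, E) M) :
    fiberCoord x (scale r v) = r • fiberCoord x v :=
  fiberCoord_smul x v.proj r v.snd

lemma TangentBundle.continuous_scale :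
    Continuous (fun x : ℝ × TangentBundle 𝓘(ℝ, E) M ↦ scale x.1 x.2) := by
  refine continuous_iff_continuousAt.2 fun x ↦ ?_
  rw [FiberBundle.continuousAt_totalSpace]
  refine ⟨(continuous_totalSpace_proj.comp continuous_snd).continuousAt, ?_⟩
  have h : (fun y : ℝ × TangentBundle 𝓘(ℝ, E) M ↦ (trivializationAt E (TangentSpace 𝓘(ℝ, E))
      (scale x.1 x.2).proj (scale y.1 y.2)).2) = fun y ↦ y.1 • fiberCoord x.2.proj y.2 := by
    ext1 y
    exact fiberCoord_scale x.2.proj y.1 y.2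
  rw [h]
  exact continuousAt_fst.smul (ContinuousAt.comp (g := fiberCoord (E := E) x.2.proj)
    (contMDiffAt_fiberCoord (mem_chart_source E _)).continuousAt continuousAt_snd)

namespace LinearConnection

variable (D : LinearConnection E M)

/-- Geodesics stay geodesics under affine changes of the parameter. -/
lemma hasMFDerivAt_scale_comp {w : ℝ → TangentBundle 𝓘(ℝ, E) M} {a r t : ℝ}
    (hw : HasMFDerivAt 𝓘(ℝ, ℝ) 𝓘(ℝ, E).tangent w (a + r * t)
      (ContinuousLinearMap.smulRight (1 : ℝ →L[ℝ] ℝ) (D.geodesicSpray (w (a + r * t))) :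
        ℝ →L[ℝ] E × E)) :
    HasMFDerivAt 𝓘(ℝ, ℝ) 𝓘(ℝ, E).tangent (fun t ↦ scale r (w (a + r * t))) t
      (ContinuousLinearMap.smulRight (1 : ℝ →L[ℝ] ℝ)
        (D.geodesicSpray (scale r (w (a + r * t)))) : ℝ →L[ℝ] E × E) := by
  set v := w (a + r * t) with hv
  have hvs : v.proj ∈ (chartAt E v.proj).source := mem_chart_source E _
  have h1 := hw.hasDerivAt_extChartAt_comp (p := v) (mem_extChartAt_source _)
  replace h1 : HasDerivAt (extChartAt 𝓘(ℝ, E).tangent v ∘ w)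
      (fiberCoord v.proj v, D.sprayCoord v.proj v) (a + r * t) := by
    refine h1.congr_deriv ?_
    exact D.tangentCoordChange_geodesicSpray hvs
  have haff : HasDerivAt (fun t : ℝ ↦ a + r * t) r t := by
    simpa using ((hasDerivAt_id t).const_mul r).const_add a
  have h2 := h1.scomp t haff
  have hcont : ContinuousAt (fun t ↦ scale r (w (a + r * t))) t := by
    have h3 : ContinuousAt (fun t ↦ w (a + r * t)) t :=
      ContinuousAt.comp (g := w) (f := fun t ↦ a + r * t) hw.continuousAt haff.continuousAt
    exact ContinuousAt.comp (g := fun v ↦ scale r v) (f := fun t ↦ w (a + r * t))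
      (continuous_scale.comp (Continuous.prodMk_right r)).continuousAt h3
  have h4 : tangentCoordChange 𝓘(ℝ, E).tangent (scale r v) (scale r v) (scale r v)
      (D.geodesicSpray (scale r v)) =
      (r • fiberCoord v.proj v, r ^ 2 • D.sprayCoord v.proj v) := by
    rw [D.tangentCoordChange_geodesicSpray (p := scale r v) (v := scale r v) hvs]
    rw [← D.sprayCoord_smul hvs, scale_proj, fiberCoord_scale]
    rfl
  refine hasMFDerivAt_of_hasDerivAt_extChartAt_comp (p := scale r v) hcont
    (mem_extChartAt_source _) ?_
  have h5 : HasDerivAt (extChartAt 𝓘(ℝ, E).tangent (scale r v) ∘ fun t ↦ scale r (w (a + r * t)))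
      (r • fiberCoord v.proj v, r ^ 2 • D.sprayCoord v.proj v) t := by
    have e1 : HasDerivAt (fun s ↦ extChartAt 𝓘(ℝ, E) v.proj (w (a + r * s)).proj)
        (r • fiberCoord v.proj v) t := by
      refine (hasFDerivAt_fst.comp_hasDerivAt t h2).congr_of_eventuallyEq (.of_forall fun s ↦ ?_)
      simp only [Function.comp_apply]
      rw [extChartAt_tangent_apply]
    have e2 : HasDerivAt (fun s ↦ r • fiberCoord v.proj (w (a + r * s)))
        (r ^ 2 • D.sprayCoord v.proj v) t := by
      rw [pow_two, mul_smul]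
      refine ((hasFDerivAt_snd.comp_hasDerivAt t h2).const_smul r).congr_of_eventuallyEq
        (.of_forall fun s ↦ ?_)
      simp only [Function.comp_apply, Pi.smul_apply]
      rw [extChartAt_tangent_apply]
    refine (e1.prodMk e2).congr_of_eventuallyEq (.of_forall fun s ↦ ?_)
    simp only [Function.comp_apply]
    rw [extChartAt_tangent_apply, scale_proj, scale_proj, fiberCoord_scale]
  exact h5.congr_deriv h4.symm

lemma isMIntegralCurveOn_scale_comp {w : ℝ → TangentBundle 𝓘(ℝ, E) M} {J : Set ℝ}
    (hJ : IsOpen J) (hw : IsMIntegralCurveOn w D.geodesicSpray J) (a r : ℝ) :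
    IsMIntegralCurveOn (fun t ↦ scale r (w (a + r * t))) D.geodesicSpray
      ((fun t ↦ a + r * t) ⁻¹' J) := fun t ht ↦
  (D.hasMFDerivAt_scale_comp ((hw _ ht).hasMFDerivAt (hJ.mem_nhds ht))).hasMFDerivWithinAt

lemma ordConnected_preimage_affine {J : Set ℝ} (hJ : J.OrdConnected) (a r : ℝ) :
    ((fun t ↦ a + r * t) ⁻¹' J).OrdConnected := by
  rcases le_total 0 r with hr | hr
  · exact hJ.preimage_mono fun x y hxy ↦ by
      simpa using mul_le_mul_of_nonneg_left hxy hr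
  · exact hJ.preimage_anti fun x y hxy ↦ by
      simpa using mul_le_mul_of_nonpos_left hxy hr

lemma _root_.IsMaximalMIntegralCurveOn.scale_comp {D : LinearConnection E M}
    {w : ℝ → TangentBundle 𝓘(ℝ, E) M} {J : Set ℝ}
    (hw : IsMaximalMIntegralCurveOn w D.geodesicSpray J) (a : ℝ) {r : ℝ} (hr : r ≠ 0) :
    IsMaximalMIntegralCurveOn (fun t ↦ scale r (w (a + r * t))) D.geodesicSpray
      ((fun t ↦ a + r * t) ⁻¹' J) where
  isOpen := hw.isOpen.preimage (by fun_prop)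
  ordConnected := ordConnected_preimage_affine hw.ordConnected a r
  isMIntegralCurveOn := D.isMIntegralCurveOn_scale_comp hw.isOpen hw.isMIntegralCurveOn a r
  subset w' J' hJ' hJc' hw' t ht ht' h := by
    have h1 := D.isMIntegralCurveOn_scale_comp hJ' hw' (-(r⁻¹ * a)) r⁻¹
    have hinv : ∀ s, -(r⁻¹ * a) + r⁻¹ * (a + r * s) = s := fun s ↦ by field_simp; ring
    have h2 := hw.subset _ _ (hJ'.preimage (by fun_prop)) (ordConnected_preimage_affine hJc' _ _) h1
      (a + r * t) ht (by rwa [mem_preimage, hinv]) (by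
        rw [hinv, ← h]
        simp [hr])
    intro s hs
    exact h2 (by rwa [mem_preimage, hinv])

/-- The horizontal part of the spray at v is v itself. Consequently every integral curve is the
natural lift of its projection. -/
lemma hasMFDerivAt_proj {w : ℝ → TangentBundle 𝓘(ℝ, E) M} {t : ℝ}
    (hw : HasMFDerivAt 𝓘(ℝ, ℝ) 𝓘(ℝ, E).tangent w t
      (ContinuousLinearMap.smulRight (1 : ℝ →L[ℝ] ℝ) (D.geodesicSpray (w t)) : ℝ →L[ℝ] E × E)) :
    HasMFDerivAt 𝓘(ℝ, ℝ) 𝓘(ℝ, E) (fun t ↦ (w t).proj) t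
      (ContinuousLinearMap.smulRight (1 : ℝ →L[ℝ] ℝ) (w t).snd : ℝ →L[ℝ] E) := by
  have h1 := hw.hasDerivAt_extChartAt_comp (p := w t) (mem_extChartAt_source _)
  have h2 := D.tangentCoordChange_geodesicSpray (p := w t) (v := w t) (mem_chart_source E _)
  have h3 := hasFDerivAt_fst.comp_hasDerivAt t (h1.congr_deriv h2)
  refine hasMFDerivAt_of_hasDerivAt_extChartAt_comp (p := (w t).proj)
    (continuous_totalSpace_proj.continuousAt.comp hw.continuousAt) (mem_extChartAt_source _) ?_
  refine (h3.congr_of_eventuallyEq (.of_forall fun s ↦ ?_)).congr_deriv rfl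
  simp only [Function.comp_apply]
  rw [extChartAt_tangent_apply]

lemma naturalLift_proj {w : ℝ → TangentBundle 𝓘(ℝ, E) M} {t : ℝ}
    (hw : HasMFDerivAt 𝓘(ℝ, ℝ) 𝓘(ℝ, E).tangent w t
      (ContinuousLinearMap.smulRight (1 : ℝ →L[ℝ] ℝ) (D.geodesicSpray (w t)) : ℝ →L[ℝ] E × E)) :
    naturalLift (E := E) (fun t ↦ (w t).proj) t = w t := by
  have h := (D.hasMFDerivAt_proj hw).mfderiv
  have h2 := congrArg (fun L : ℝ →L[ℝ] E ↦ L 1) h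
  have h3 : (mfderiv 𝓘(ℝ, ℝ) 𝓘(ℝ, E) (fun t ↦ (w t).proj) t : ℝ →L[ℝ] E) 1 = (w t).snd :=
    h2.trans (one_smul ℝ ((w t).snd : E))
  rw [naturalLift]
  exact congrArg (fun u : TangentSpace 𝓘(ℝ, E) (w t).proj ↦
    (⟨(w t).proj, u⟩ : TangentBundle 𝓘(ℝ, E) M)) h3

lemma naturalLift_congr {c c' : ℝ → M} {t : ℝ} (h : c =ᶠ[𝓝 t] c') :
    naturalLift (E := E) c t = naturalLift (E := E) c' t := by
  have h1 : (naturalLift (E := E) c t).proj = (naturalLift (E := E) c' t).proj := h.self_of_nhds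
  have h2 : mfderiv 𝓘(ℝ, ℝ) 𝓘(ℝ, E) c t = (mfderiv 𝓘(ℝ, ℝ) 𝓘(ℝ, E) c' t : ℝ →L[ℝ] E) :=
    h.mfderiv_eq
  have h3 := congrArg (fun L : ℝ →L[ℝ] E ↦ L 1) h2
  refine TotalSpace.ext h1 ?_
  exact heq_of_eq h3

lemma _root_.IsMIntegralCurveOn.eqOn_naturalLift {D : LinearConnection E M}
    {w : ℝ → TangentBundle 𝓘(ℝ, E) M} {J : Set ℝ} (hJ : IsOpen J)
    (hw : IsMIntegralCurveOn w D.geodesicSpray J) :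
    EqOn (naturalLift (E := E) fun t ↦ (w t).proj) w J := fun t ht ↦
  D.naturalLift_proj ((hw t ht).hasMFDerivAt (hJ.mem_nhds ht))

lemma _root_.IsMIntegralCurveOn.congr_of_eqOn {D : LinearConnection E M}
    {w w' : ℝ → TangentBundle 𝓘(ℝ, E) M} {J : Set ℝ} (hJ : IsOpen J)
    (hw : IsMIntegralCurveOn w D.geodesicSpray J) (he : EqOn w' w J) :
    IsMIntegralCurveOn w' D.geodesicSpray J := by
  intro t ht
  have h3 := ((hw t ht).hasMFDerivAt (hJ.mem_nhds ht)).congr_of_eventuallyEq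
    (he.eventuallyEq_of_mem (hJ.mem_nhds ht))
  rw [← he ht] at h3
  exact h3.hasMFDerivWithinAt

lemma _root_.IsMIntegralCurveOn.isGeodesicOn {D : LinearConnection E M}
    {w : ℝ → TangentBundle 𝓘(ℝ, E) M} {J : Set ℝ} (hne : J.Nonempty) (hJ : IsOpen J)
    (hJc : J.OrdConnected) (hw : IsMIntegralCurveOn w D.geodesicSpray J) :
    D.IsGeodesicOn (fun t ↦ (w t).proj) J :=
  ⟨hne, hJ, hJc, hw.congr_of_eqOn hJ (hw.eqOn_naturalLift hJ)⟩

lemma _root_.IsMaximalMIntegralCurveOn.isInextendibleGeodesicOn {D : LinearConnection E M}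
    {w : ℝ → TangentBundle 𝓘(ℝ, E) M} {J : Set ℝ} (hne : J.Nonempty)
    (hw : IsMaximalMIntegralCurveOn w D.geodesicSpray J) :
    D.IsInextendibleGeodesicOn (fun t ↦ (w t).proj) J := by
  refine ⟨hw.isMIntegralCurveOn.isGeodesicOn hne hw.isOpen hw.ordConnected, ?_⟩
  rintro c' J' ⟨-, hJ', hJc', hc'⟩ hsub heq
  refine Subset.antisymm ?_ hsub
  obtain ⟨t, ht⟩ := hne
  refine hw.subset _ J' hJ' hJc' hc' t ht (hsub ht) ?_
  rw [naturalLift_congr (heq.eventuallyEq_of_mem (hw.isOpen.mem_nhds ht))]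
  exact (hw.isMIntegralCurveOn.eqOn_naturalLift hw.isOpen ht).symm

variable [FiniteDimensional ℝ E] [T2Space M]

variable {D}

/-- An integral curve meeting the lift of c can be glued to it, and the projection of the result is
a geodesic extending c. -/
lemma IsInextendibleGeodesicOn.isMaximalMIntegralCurveOn {c : ℝ → M} {J : Set ℝ}
    (hc : D.IsInextendibleGeodesicOn c J) :
    IsMaximalMIntegralCurveOn (naturalLift (E := E) c) D.geodesicSpray J := by
  have : T2Space (TangentBundle 𝓘(ℝ, E) M) := TangentBundle.t2Space
  obtain ⟨⟨hne, hJ, hJc, hw⟩, hmax⟩ := hc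
  refine ⟨hJ, hJc, hw, fun w' J' hJ' hJc' hw' t ht ht' h ↦ ?_⟩
  obtain ⟨γ, hγ, h1, -⟩ := hw.exists_union D.contMDiff_geodesicSpray hJ hJc hJ' hJc' hw' ht ht' h
  have h2 := hmax (fun t ↦ (γ t).proj) (J ∪ J') (hγ.isGeodesicOn (hne.mono subset_union_left)
    (hJ.union hJ') (ordConnected_union_of_mem hJc hJc' ht ht')) subset_union_left
    (fun s hs ↦ by dsimp only; rw [h1 hs]; rfl)
  exact h2 ▸ subset_union_right

/-- A geodesic with vanishing velocity somewhere is constant. -/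
lemma _root_.IsMIntegralCurveOn.eq_of_scale_zero_eq {w : ℝ → TangentBundle 𝓘(ℝ, E) M} {J : Set ℝ}
    (hJ : IsOpen J) (hJc : J.OrdConnected) (hw : IsMIntegralCurveOn w D.geodesicSpray J)
    {t₀ : ℝ} (ht₀ : t₀ ∈ J) (h0 : scale 0 (w t₀) = w t₀) {t : ℝ} (ht : t ∈ J) : w t = w t₀ := by
  have : T2Space (TangentBundle 𝓘(ℝ, E) M) := TangentBundle.t2Space
  -- Reparametrisation with factor 0 yields a constant integral curve on ℝ, with which w agrees at
  -- t₀.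
  have h1 := D.isMIntegralCurveOn_scale_comp hJ hw t₀ 0
  have h2 : (fun t ↦ t₀ + 0 * t) ⁻¹' J = univ := by ext; simp [ht₀]
  rw [h2] at h1
  have h3 := hw.eqOn_inter D.contMDiff_geodesicSpray hJ hJc isOpen_univ ordConnected_univ h1 ht₀
    (mem_univ t₀) (by simp [h0]) ⟨ht, mem_univ t⟩
  rw [h3]
  simp [h0]

/-- Throughout, `scale 0 v ≠ v` expresses that v is not a zero vector. A zero velocity at one time
would make the geodesic constant. -/
lemma _root_.IsMIntegralCurveOn.scale_zero_ne_of_nontrivial {w : ℝ → TangentBundle 𝓘(ℝ, E) M}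
    {J : Set ℝ} (hJ : IsOpen J) (hJc : J.OrdConnected) (hw : IsMIntegralCurveOn w D.geodesicSpray J)
    (hn : ((fun t ↦ (w t).proj) '' J).Nontrivial) {t : ℝ} (ht : t ∈ J) :
    scale 0 (w t) ≠ w t := by
  intro h
  obtain ⟨_, ⟨a, ha, rfl⟩, _, ⟨b, hb, rfl⟩, hab⟩ := hn
  refine hab ?_
  dsimp only
  rw [hw.eq_of_scale_zero_eq hJ hJc ht h ha, hw.eq_of_scale_zero_eq hJ hJc ht h hb]

lemma _root_.IsMIntegralCurveOn.nontrivial_of_scale_zero_ne {w : ℝ → TangentBundle 𝓘(ℝ, E) M}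
    {J : Set ℝ} (hJ : IsOpen J) (hw : IsMIntegralCurveOn w D.geodesicSpray J)
    {t : ℝ} (ht : t ∈ J) (h : scale 0 (w t) ≠ w t) :
    ((fun t ↦ (w t).proj) '' J).Nontrivial := by
  by_contra hn
  rw [not_nontrivial_iff] at hn
  refine h ?_
  have h1 : (fun t ↦ (w t).proj) =ᶠ[𝓝 t] fun _ ↦ (w t).proj :=
    eventually_of_mem (hJ.mem_nhds ht) fun s hs ↦
      hn (mem_image_of_mem _ hs) (mem_image_of_mem (fun t ↦ (w t).proj) ht)
  have h2 := naturalLift_congr (E := E) h1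
  rw [hw.eqOn_naturalLift hJ ht] at h2
  have h3 : naturalLift (E := E) (fun _ ↦ (w t).proj) t =
      (⟨(w t).proj, 0⟩ : TangentBundle 𝓘(ℝ, E) M) := by
    rw [naturalLift, mfderiv_const]
    rfl
  rw [h2, h3]
  simp [scale]

end LinearConnection

end SprayCurves

/-! ### Limits of geodesics of converging connections -/

section Limits

variable {E : Type*} [NormedAddCommGroup E] [NormedSpace ℝ E] [FiniteDimensional ℝ E]
  {M : Type*} [TopologicalSpace M] [ChartedSpace E M] [IsManifold 𝓘(ℝ, E) ∞ M] [T2Space M]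
  {ι : Type*} {C : Set M}

open TangentBundle

lemma fiberCoord_ne_zero {x : M} {v : TangentBundle 𝓘(ℝ, E) M}
    (hv : v.proj ∈ (chartAt E x).source) (h : scale 0 v ≠ v) : fiberCoord x v ≠ 0 := by
  intro h0
  refine h ?_
  obtain ⟨y, u⟩ := v
  have h1 := fiberCoord_scale x 0 (⟨y, u⟩ : TangentBundle 𝓘(ℝ, E) M)
  rw [h0, smul_zero, ← h0] at h1
  have h2 := fiberCoord_injective (u := (0 : ℝ) • u) (w := u) hv h1
  rw [scale]
  dsimp only
  rw [h2]

/-- Nonzero tangent vectors over a compact set can be rescaled to converge to a nonzero vector. -/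
lemma exists_tendsto_scale (U : Ultrafilter ι) (hC : IsCompact C)
    {v : ι → TangentBundle 𝓘(ℝ, E) M} (hvC : ∀ k, (v k).proj ∈ C)
    (hv : ∀ k, scale 0 (v k) ≠ v k) :
    ∃ (r : ι → ℝ) (v₀ : TangentBundle 𝓘(ℝ, E) M), (∀ k, 0 < r k) ∧ scale 0 v₀ ≠ v₀ ∧
      Tendsto (fun k ↦ scale (r k) (v k)) U (𝓝 v₀) := by
  classical
  obtain ⟨x, -, hx⟩ := hC.ultrafilter_le_nhds (U.map fun k ↦ (v k).proj)
    (by rw [Ultrafilter.coe_map, le_principal_iff]; exact mem_map.2 (univ_mem' hvC))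
  replace hx : Tendsto (fun k ↦ (v k).proj) U (𝓝 x) := hx
  have hsrc := hx.eventually ((chartAt E x).open_source.mem_nhds (mem_chart_source E x))
  -- Normalisation in the chart at the limit x of the base points. The value 1 only keeps r positive
  -- for the indices where v k may lie outside that chart.
  set r : ι → ℝ := fun k ↦ if fiberCoord x (v k) = 0 then 1 else ‖fiberCoord x (v k)‖⁻¹ with hr
  have hunit : ∀ᶠ k in (U : Filter ι), fiberCoord x (scale (r k) (v k)) ∈ Metric.sphere (0 : E) 1 := by
    filter_upwards [hsrc] with k hk
    have h0 := fiberCoord_ne_zero hk (hv k)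
    rw [fiberCoord_scale, mem_sphere_zero_iff_norm]
    simp only [hr, h0, if_false]
    rw [norm_smul, norm_inv, norm_norm, inv_mul_cancel₀ (norm_ne_zero_iff.2 h0)]
  obtain ⟨e₀, he₀, he⟩ := (isCompact_sphere (0 : E) 1).ultrafilter_le_nhds
    (U.map fun k ↦ fiberCoord x (scale (r k) (v k)))
    (by rw [Ultrafilter.coe_map, le_principal_iff]; exact hunit)
  replace he : Tendsto (fun k ↦ fiberCoord x (scale (r k) (v k))) U (𝓝 e₀) := he
  set e := trivializationAt E (TangentSpace 𝓘(ℝ, E)) x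
  have hxe : (x, e₀) ∈ e.target := e.mem_target.2 (mem_chart_source E x)
  set v₀ := e.toOpenPartialHomeomorph.symm (x, e₀)
  have hv₀ : e v₀ = (x, e₀) := e.toOpenPartialHomeomorph.right_inv hxe
  refine ⟨r, v₀, fun k ↦ ?_, fun h ↦ ?_, ?_⟩
  · simp only [hr]
    split_ifs with h
    · exact one_pos
    · exact inv_pos.2 (norm_pos_iff.2 h)
  · have h1 := fiberCoord_scale x 0 v₀
    have h2 : fiberCoord x v₀ = e₀ := congrArg Prod.snd hv₀
    rw [h, h2, zero_smul] at h1
    simp [h1] at he₀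
  · have h1 := (e.toOpenPartialHomeomorph.continuousAt_symm hxe).tendsto.comp (hx.prodMk_nhds he)
    refine h1.congr' ?_
    filter_upwards [hsrc] with k hk
    have hk' : scale (r k) (v k) ∈ e.source := (Trivialization.mem_source _).2 hk
    have h3 : e (scale (r k) (v k)) = ((v k).proj, fiberCoord x (scale (r k) (v k))) :=
      Prod.ext (e.coe_fst hk') rfl
    simp only [Function.comp_apply]
    rw [← h3]
    exact e.toOpenPartialHomeomorph.left_inv hk'

variable {D : LinearConnection E M} {D' : ι → LinearConnection E M}

/-- Limits of geodesics of converging connections. -/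
lemma eventually_mem_of_forwardTimeSet {l : Filter ι} [l.NeBot]
    (hSS : TendstoLocallyUniformlyInCharts 𝓘(ℝ, E).tangent (fun k ↦ (D' k).geodesicSpray)
      D.geodesicSpray l ((fun v ↦ v.proj) ⁻¹' C))
    {γ : ℝ → TangentBundle 𝓘(ℝ, E) M} {J : Set ℝ}
    (hγ : IsMaximalMIntegralCurveOn γ D.geodesicSpray J) (h0 : 0 ∈ J)
    {w : ι → ℝ → TangentBundle 𝓘(ℝ, E) M} {J' T : ι → Set ℝ}
    (hw : ∀ k, IsMaximalMIntegralCurveOn (w k) (D' k).geodesicSpray (J' k))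
    (hT : ∀ k, IsForwardTimeSet (T k)) (hTJ : ∀ k, T k ⊆ J' k)
    (hTC : ∀ k, ∀ s ∈ T k, (w k s).proj ∈ C) (hw0 : Tendsto (fun k ↦ w k 0) l (𝓝 (γ 0)))
    {t : ℝ} (ht : t ∈ J) (ht0 : 0 ≤ t) {O : Set (TangentBundle 𝓘(ℝ, E) M)} (hO : O ∈ 𝓝 (γ t)) :
    ∀ᶠ x : ι × ℝ in l ×ˢ 𝓝 t, x.2 ∈ T x.1 → w x.1 x.2 ∈ O := by
  have : T2Space (TangentBundle 𝓘(ℝ, E) M) := TangentBundle.t2Space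
  have : CompleteSpace E := FiniteDimensional.complete ℝ E
  have : ProperSpace E := FiniteDimensional.proper ℝ E
  exact tendsto_of_isMIntegralCurve D.contMDiff_geodesicSpray hγ.isOpen hγ.ordConnected
    hγ.isMIntegralCurveOn hSS hT (fun k s hs ↦ (hw k).isMIntegralCurveOn.isMIntegralCurveAt
      ((hw k).isOpen.mem_nhds (hTJ k hs))) hTC hw0 h0 ht ht0 hO

/-- Convergence is locally uniform in time, so the evaluation times may vary with k; this handles
endpoints of segments whose lengths converge. -/
lemma tendsto_of_tendsto_time {l : Filter ι} [l.NeBot]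
    (hSS : TendstoLocallyUniformlyInCharts 𝓘(ℝ, E).tangent (fun k ↦ (D' k).geodesicSpray)
      D.geodesicSpray l ((fun v ↦ v.proj) ⁻¹' C))
    {γ : ℝ → TangentBundle 𝓘(ℝ, E) M} {J : Set ℝ}
    (hγ : IsMaximalMIntegralCurveOn γ D.geodesicSpray J) (h0 : 0 ∈ J)
    {w : ι → ℝ → TangentBundle 𝓘(ℝ, E) M} {J' T : ι → Set ℝ}
    (hw : ∀ k, IsMaximalMIntegralCurveOn (w k) (D' k).geodesicSpray (J' k))
    (hT : ∀ k, IsForwardTimeSet (T k)) (hTJ : ∀ k, T k ⊆ J' k)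
    (hTC : ∀ k, ∀ s ∈ T k, (w k s).proj ∈ C) (hw0 : Tendsto (fun k ↦ w k 0) l (𝓝 (γ 0)))
    {t : ℝ} (ht : t ∈ J) {b : ι → ℝ} (hb : Tendsto b l (𝓝 t)) (hbT : ∀ᶠ k in l, b k ∈ T k) :
    Tendsto (fun k ↦ w k (b k)) l (𝓝 (γ t)) := by
  have ht0 : 0 ≤ t := ge_of_tendsto hb (hbT.mono fun k hk ↦ (hT k _ hk).1)
  intro O hO
  have h := eventually_mem_of_forwardTimeSet hSS hγ h0 hw hT hTJ hTC hw0 ht ht0 hO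
  exact ((tendsto_id.prodMk hb).eventually h).mp (hbT.mono fun k hk hk2 ↦ hk2 hk)

lemma isForwardTimeSet_inter_Ici {J : Set ℝ} (hJ : J.OrdConnected) (h0 : 0 ∈ J) :
    IsForwardTimeSet (J ∩ Ici 0) := fun _ hs ↦
  ⟨hs.2, fun _ hx ↦ ⟨hJ.out h0 hs.1 hx, hx.1⟩⟩

lemma isForwardTimeSet_Icc (b : ℝ) : IsForwardTimeSet (Icc 0 b) := fun _ hs ↦
  ⟨hs.1, Icc_subset_Icc_right hs.2⟩

/-- Geodesics whose forward halves stay over `C` live at least as long as their limit. -/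
lemma eventually_mem_of_forward_subset (U : Ultrafilter ι)
    (hSS : TendstoLocallyUniformlyInCharts 𝓘(ℝ, E).tangent (fun k ↦ (D' k).geodesicSpray)
      D.geodesicSpray U ((fun v ↦ v.proj) ⁻¹' C))
    {γ : ℝ → TangentBundle 𝓘(ℝ, E) M} {J : Set ℝ}
    (hγ : IsMaximalMIntegralCurveOn γ D.geodesicSpray J) (h0 : 0 ∈ J)
    {w : ι → ℝ → TangentBundle 𝓘(ℝ, E) M} {J' : ι → Set ℝ}
    (hw : ∀ k, IsMaximalMIntegralCurveOn (w k) (D' k).geodesicSpray (J' k))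
    (h0' : ∀ k, 0 ∈ J' k) (hwC : ∀ k, ∀ s ∈ J' k, 0 ≤ s → (w k s).proj ∈ C)
    (hw0 : Tendsto (fun k ↦ w k 0) U (𝓝 (γ 0))) {t : ℝ} (ht : t ∈ J) (ht0 : 0 ≤ t) :
    ∀ᶠ k in (U : Filter ι), t ∈ J' k := by
  have : T2Space (TangentBundle 𝓘(ℝ, E) M) := TangentBundle.t2Space
  have : CompleteSpace E := FiniteDimensional.complete ℝ E
  have : ProperSpace E := FiniteDimensional.proper ℝ E
  have : LocallyCompactSpace (TangentBundle 𝓘(ℝ, E) M) :=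
    Manifold.locallyCompact_of_finiteDimensional 𝓘(ℝ, E).tangent
  by_contra hcon
  rw [← Ultrafilter.eventually_not] at hcon
  have hub : ∀ k, t ∉ J' k → ∀ s ∈ J' k, s ≤ t := fun k hk s hs ↦ by
    by_contra! hlt
    exact hk ((hw k).ordConnected.out (h0' k) hs ⟨ht0, hlt.le⟩)
  have hsup : ∀ᶠ k in (U : Filter ι), sSup (J' k) ∈ Icc 0 t := by
    filter_upwards [hcon] with k hk
    exact ⟨le_csSup ⟨t, hub k hk⟩ (h0' k), csSup_le ⟨0, h0' k⟩ (hub k hk)⟩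
  obtain ⟨b, hb, hbt⟩ := (isCompact_Icc (a := (0 : ℝ)) (b := t)).ultrafilter_le_nhds
    (U.map fun k ↦ sSup (J' k)) (by rw [Ultrafilter.coe_map, le_principal_iff]; exact hsup)
  replace hbt : Tendsto (fun k ↦ sSup (J' k)) U (𝓝 b) := hbt
  have hbJ : b ∈ J := hγ.ordConnected.out h0 ht hb
  -- Here b is the limit of the lifetimes. Near time b the curves stay in the compact set Z in TM,
  -- whereas a curve of bounded lifetime must leave Z just before its end.
  obtain ⟨Z, hZ, hZb⟩ := exists_compact_mem_nhds (γ b)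
  have h1 := eventually_mem_of_forwardTimeSet (T := fun k ↦ J' k ∩ Ici 0) hSS hγ h0 hw
    (fun k ↦ isForwardTimeSet_inter_Ici (hw k).ordConnected (h0' k)) (fun k ↦ inter_subset_left)
    (fun k s hs ↦ hwC k s hs.1 hs.2) hw0 hbJ hb.1 hZb
  rw [Filter.eventually_prod_iff] at h1
  obtain ⟨P, hP, Q, hQ, hPQ⟩ := h1
  obtain ⟨δ, hδ, hδQ⟩ := Metric.eventually_nhds_iff_ball.1 hQ
  rw [Real.ball_eq_Ioo] at hδQ
  obtain ⟨k, hk, hkP, hkb⟩ := (hcon.and (hP.and (hbt.eventually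
    (Ioo_mem_nhds (show b - δ < b by linarith) (show b < b + δ by linarith))))).exists
  have hbdd : BddAbove (J' k) := ⟨t, hub k hk⟩
  obtain ⟨s, hs, hbs⟩ := exists_lt_of_lt_csSup ⟨0, h0' k⟩ hkb.1
  have hs' : max s 0 ∈ J' k := by
    rcases max_choice s 0 with h | h <;> rw [h]
    exacts [hs, h0' k]
  obtain ⟨s', hs'J, hss, hsZ⟩ := (hw k).exists_notMem_of_bddAbove (D' k).contMDiff_geodesicSpray
    hbdd hs' hZ
  refine hsZ (hPQ hkP (hδQ s' ⟨?_, ?_⟩) ⟨hs'J, (le_max_right _ _).trans hss⟩)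
  · exact hbs.trans_le ((le_max_left _ _).trans hss)
  · exact (le_csSup hbdd hs'J).trans_lt hkb.2

/-- The approximating curves live long enough, so each point of the forward half of γ is over a
limit of points of the closed set C. -/
lemma mem_of_forward_subset (U : Ultrafilter ι) (hC : IsClosed C)
    (hSS : TendstoLocallyUniformlyInCharts 𝓘(ℝ, E).tangent (fun k ↦ (D' k).geodesicSpray)
      D.geodesicSpray U ((fun v ↦ v.proj) ⁻¹' C))
    {γ : ℝ → TangentBundle 𝓘(ℝ, E) M} {J : Set ℝ}
    (hγ : IsMaximalMIntegralCurveOn γ D.geodesicSpray J) (h0 : 0 ∈ J)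
    {w : ι → ℝ → TangentBundle 𝓘(ℝ, E) M} {J' : ι → Set ℝ}
    (hw : ∀ k, IsMaximalMIntegralCurveOn (w k) (D' k).geodesicSpray (J' k))
    (h0' : ∀ k, 0 ∈ J' k) (hwC : ∀ k, ∀ s ∈ J' k, 0 ≤ s → (w k s).proj ∈ C)
    (hw0 : Tendsto (fun k ↦ w k 0) U (𝓝 (γ 0))) {t : ℝ} (ht : t ∈ J) (ht0 : 0 ≤ t) :
    (γ t).proj ∈ C := by
  have h1 := eventually_mem_of_forward_subset U hSS hγ h0 hw h0' hwC hw0 ht ht0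
  have h2 := tendsto_of_tendsto_time (T := fun k ↦ J' k ∩ Ici 0) hSS hγ h0 hw
    (fun k ↦ isForwardTimeSet_inter_Ici (hw k).ordConnected (h0' k)) (fun k ↦ inter_subset_left)
    (fun k s hs ↦ hwC k s hs.1 hs.2) hw0 ht tendsto_const_nhds (h1.mono fun k hk ↦ ⟨hk, ht0⟩)
  exact hC.mem_of_tendsto (continuous_totalSpace_proj.continuousAt.tendsto.comp h2)
    (h1.mono fun k hk ↦ hwC k t hk ht0)

end Limits

/-! ### Trapped half geodesics and geodesic segments in the limit -/

section Imprisonment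

variable {E : Type*} [NormedAddCommGroup E] [NormedSpace ℝ E] [FiniteDimensional ℝ E]
  {M : Type*} [TopologicalSpace M] [ChartedSpace E M] [IsManifold 𝓘(ℝ, E) ∞ M] [T2Space M]
  {ι : Type*} {C : Set M} {D : LinearConnection E M} {D' : ι → LinearConnection E M}

open TangentBundle

lemma scale_zero_scale_ne {r : ℝ} (hr : r ≠ 0) {v : TangentBundle 𝓘(ℝ, E) M}
    (h : scale 0 v ≠ v) : scale 0 (scale r v) ≠ scale r v := by
  intro h1
  have h2 := congrArg (scale r⁻¹) h1
  rw [scale_scale, scale_scale, scale_scale, inv_mul_cancel₀ hr, scale_one] at h2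
  simp only [mul_zero, zero_mul] at h2
  exact h h2

lemma tendstoLocallyUniformlyInCharts_const {l : Filter ι} (D : LinearConnection E M)
    (Q : Set (TangentBundle 𝓘(ℝ, E) M)) :
    TendstoLocallyUniformlyInCharts 𝓘(ℝ, E).tangent (fun _ : ι ↦ D.geodesicSpray)
      D.geodesicSpray l Q := fun p ↦
  ⟨univ, univ_mem, fun ε hε ↦ .of_forall fun k q _ _ ↦ by rw [sub_self, norm_zero]; exact hε.le⟩

lemma LinearConnection.IsDisprisoning.exists_notMem (hD : D.IsDisprisoning) (hC : IsCompact C)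
    {γ : ℝ → TangentBundle 𝓘(ℝ, E) M} {J : Set ℝ}
    (hγ : IsMaximalMIntegralCurveOn γ D.geodesicSpray J) {t₀ : ℝ} (ht₀ : t₀ ∈ J)
    (hv : scale 0 (γ t₀) ≠ γ t₀) : ∃ t ∈ J, (γ t).proj ∉ C := by
  by_contra! hcon
  refine hD _ J (hγ.isInextendibleGeodesicOn ⟨t₀, ht₀⟩)
    (hγ.isMIntegralCurveOn.nontrivial_of_scale_zero_ne hγ.isOpen ht₀ hv) C hC ?_
  rintro _ ⟨t, ht, rfl⟩
  exact hcon t ht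

/-- The alternative for geodesic segments `[0, b k]` over `C` with converging initial velocity:
they are eventually longer than a given time, or their length converges to a time at which the
limit geodesic is defined. -/
lemma eventually_le_or_tendsto (U : Ultrafilter ι) {J : Set ℝ} (hJ : J.OrdConnected) (h0 : 0 ∈ J)
    {t : ℝ} (ht : t ∈ J) {b : ι → ℝ} (hb : ∀ k, 0 ≤ b k) :
    (∀ᶠ k in (U : Filter ι), t ≤ b k) ∨ ∃ β ∈ J, 0 ≤ β ∧ Tendsto b U (𝓝 β) := by
  by_contra! hcon
  obtain ⟨h1, h2⟩ := hcon
  obtain ⟨β, hβ, hbβ⟩ := (isCompact_Icc (a := (0 : ℝ)) (b := t)).ultrafilter_le_nhds (U.map b)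
    (by
      rw [Ultrafilter.coe_map, le_principal_iff]
      exact mem_map.2 (h1.mono fun k hk ↦ ⟨hb k, hk.le⟩))
  exact h2 β (hJ.out h0 ht hβ) hβ.1 hbβ

/-- In a disprisoning connection, no half of a nonconstant geodesic is contained in a compact
set. -/
lemma LinearConnection.IsDisprisoning.exists_ge_notMem (hD : D.IsDisprisoning) (hC : IsCompact C)
    {γ : ℝ → TangentBundle 𝓘(ℝ, E) M} {J : Set ℝ}
    (hγ : IsMaximalMIntegralCurveOn γ D.geodesicSpray J) (h0 : 0 ∈ J)
    (hv : scale 0 (γ 0) ≠ γ 0) : ∃ t ∈ J, 0 ≤ t ∧ (γ t).proj ∉ C := by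
  have hT2 : T2Space (TangentBundle 𝓘(ℝ, E) M) := TangentBundle.t2Space
  have : CompleteSpace E := FiniteDimensional.complete ℝ E
  by_contra! hcon
  have hne : ∀ t ∈ J, scale 0 (γ t) ≠ γ t := fun t ht ↦
    hγ.isMIntegralCurveOn.scale_zero_ne_of_nontrivial hγ.isOpen hγ.ordConnected
      (hγ.isMIntegralCurveOn.nontrivial_of_scale_zero_ne hγ.isOpen h0 hv) ht
  -- Indexing by the times themselves lets `atTop` mean "towards the end of J", whether J is bounded
  -- above or not.
  let ι := {t : ℝ // t ∈ J ∧ 0 ≤ t}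
  have : Nonempty ι := ⟨⟨0, h0, le_rfl⟩⟩
  let U : Ultrafilter ι := Ultrafilter.of atTop
  have hU : (U : Filter ι) ≤ atTop := Ultrafilter.of_le _
  obtain ⟨r, v, hr, hv0, hrv⟩ := exists_tendsto_scale U hC (v := fun k : ι ↦ γ k)
    (fun k ↦ hcon k k.2.1 k.2.2) (fun k ↦ hne k k.2.1)
  obtain ⟨σ, I, h0I, hσ0, hσ⟩ := exists_isMaximalMIntegralCurveOn D.contMDiff_geodesicSpray 0 v
  have hw : ∀ k : ι, IsMaximalMIntegralCurveOn (fun t ↦ scale (r k) (γ (k + r k * t)))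
      D.geodesicSpray ((fun t ↦ k + r k * t) ⁻¹' J) := fun k ↦ hγ.scale_comp k (hr k).ne'
  have hw0 : Tendsto (fun k : ι ↦ scale (r k) (γ (k + r k * 0))) U (𝓝 (σ 0)) := by
    simpa [hσ0] using hrv
  have hfwd : ∀ t ∈ I, 0 ≤ t → (σ t).proj ∈ C := fun t ht ht0 ↦
    mem_of_forward_subset U hC.isClosed (tendstoLocallyUniformlyInCharts_const D _) hσ h0I hw
      (fun k ↦ by simpa using k.2.1) (fun k s hs hs0 ↦ hcon _ hs
        (add_nonneg k.2.2 (mul_nonneg (hr k).le hs0))) hw0 ht ht0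
  -- the reversed curves
  have hσ' := hσ.scale_comp 0 (r := -1) (by norm_num)
  set σ' : ℝ → TangentBundle 𝓘(ℝ, E) M := fun t ↦ scale (-1) (σ (0 + -1 * t)) with hσ'def
  set I' : Set ℝ := (fun t ↦ 0 + -1 * t) ⁻¹' I with hI'def
  have h0I' : 0 ∈ I' := by simpa [hI'def] using h0I
  -- These curves run back along γ from time k and reach γ 0, up to scaling, at parameter k / r k;
  -- until then they stay over C.
  have hw' : ∀ k : ι, IsMaximalMIntegralCurveOn (fun t ↦ scale (-r k) (γ (k + -r k * t)))
      D.geodesicSpray ((fun t ↦ k + -r k * t) ⁻¹' J) := fun k ↦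
    hγ.scale_comp k (neg_ne_zero.2 (hr k).ne')
  have hw0' : Tendsto (fun k : ι ↦ scale (-r k) (γ (k + -r k * 0))) U (𝓝 (σ' 0)) := by
    have h1 := ((continuous_scale (E := E) (M := M)).comp
      (Continuous.prodMk_right (-1))).continuousAt.tendsto.comp hrv
    simpa [hσ'def, hσ0, Function.comp_def] using h1
  have hmemJ : ∀ k : ι, ∀ s ∈ Icc 0 ((k : ℝ) / r k), 0 ≤ (k : ℝ) + -r k * s ∧
      (k : ℝ) + -r k * s ∈ J := by
    intro k s hs
    have h1 : s * r k ≤ k := (le_div_iff₀ (hr k)).1 hs.2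
    have h2 : 0 ≤ (k : ℝ) + -r k * s := by nlinarith
    refine ⟨h2, hγ.ordConnected.out h0 k.2.1 ⟨h2, ?_⟩⟩
    have := mul_nonneg (hr k).le hs.1
    linarith
  have key := fun {t : ℝ} (ht : t ∈ I') (b : ι → ℝ) (hb : Tendsto b U (𝓝 t))
      (hbT : ∀ᶠ k : ι in (U : Filter ι), b k ∈ Icc 0 ((k : ℝ) / r k)) ↦
    tendsto_of_tendsto_time (T := fun k : ι ↦ Icc 0 ((k : ℝ) / r k)) (C := C)
      (tendstoLocallyUniformlyInCharts_const (l := (U : Filter ι)) D _) hσ' h0I' hw'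
      (fun k ↦ isForwardTimeSet_Icc _) (fun k s hs ↦ (hmemJ k s hs).2)
      (fun k s hs ↦ hcon _ (hmemJ k s hs).2 (hmemJ k s hs).1) hw0' ht hb hbT
  have hnn : ∀ k : ι, 0 ≤ (k : ℝ) / r k := fun k ↦ div_nonneg k.2.2 (hr k).le
  have hbwd : ∀ t ∈ I', 0 ≤ t → (σ' t).proj ∈ C := by
    intro t ht ht0
    rcases eventually_le_or_tendsto U hσ'.ordConnected h0I' ht hnn with h | ⟨β, hβ, -, hβt⟩
    · have h1 : ∀ᶠ k : ι in (U : Filter ι), t ∈ Icc 0 ((k : ℝ) / r k) := h.mono fun k hk ↦ ⟨ht0, hk⟩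
      refine hC.isClosed.mem_of_tendsto (continuous_totalSpace_proj.continuousAt.tendsto.comp
        (key ht (fun _ ↦ t) tendsto_const_nhds h1)) (h1.mono fun k hk ↦ ?_)
      exact hcon _ (hmemJ k t hk).2 (hmemJ k t hk).1
    -- Here k / r k converges to β, so σ' passes through a multiple of γ 0 and is a
    -- reparametrisation of γ. Then k has the limit β ρ in J, whereas k eventually exceeds every
    -- element of J.
    · exfalso
      have h1 := key hβ _ hβt (.of_forall fun k ↦ ⟨hnn k, le_rfl⟩)
      have h2 : (fun k : ι ↦ scale (-r k) (γ (k + -r k * (k / r k)))) =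
          fun k : ι ↦ scale (-r k) (γ 0) := by
        ext1 k
        have : (k : ℝ) + -r k * (k / r k) = 0 := by
          have := (hr k).ne'
          field_simp
          ring
        rw [this]
      rw [h2] at h1
      have h3 : (σ' β).proj = (γ 0).proj :=
        (tendsto_nhds_unique (continuous_totalSpace_proj.continuousAt.tendsto.comp h1)
          tendsto_const_nhds : _)
      set x := (γ 0).proj with hx
      have hx0 := fiberCoord_ne_zero (x := x) (mem_chart_source E _) hv
      have h4 : Tendsto (fun k ↦ ‖fiberCoord x (scale (-r k) (γ 0))‖) U
          (𝓝 ‖fiberCoord x (σ' β)‖) := by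
        have h5 := (contMDiffAt_fiberCoord (E := E) (x := x) (v := σ' β)
          (h3 ▸ mem_chart_source E _)).continuousAt
        exact (h5.tendsto.comp h1).norm
      have h5 : Tendsto r U (𝓝 (‖fiberCoord x (σ' β)‖ / ‖fiberCoord x (γ 0)‖)) := by
        refine (h4.div_const ‖fiberCoord x (γ 0)‖).congr fun k ↦ ?_
        rw [fiberCoord_scale, norm_smul, norm_neg, Real.norm_of_nonneg (hr k).le,
          mul_div_cancel_right₀ _ (norm_ne_zero_iff.2 hx0)]
      set ρ := ‖fiberCoord x (σ' β)‖ / ‖fiberCoord x (γ 0)‖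
      have h6 : Tendsto (fun k : ι ↦ scale (-r k) (γ 0)) U (𝓝 (scale (-ρ) (γ 0))) :=
        (continuous_scale (E := E) (M := M)).continuousAt.tendsto.comp
          (h5.neg.prodMk_nhds tendsto_const_nhds)
      have h7 : σ' β = scale (-ρ) (γ 0) := tendsto_nhds_unique h1 h6
      -- Otherwise σ' β would be a zero vector, and σ' would be constant.
      have hρ : ρ ≠ 0 := by
        intro h8
        have h9 := hσ'.isMIntegralCurveOn.scale_zero_ne_of_nontrivial hσ'.isOpen hσ'.ordConnected
          (hσ'.isMIntegralCurveOn.nontrivial_of_scale_zero_ne hσ'.isOpen h0I' (by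
            simp only [hσ'def, mul_zero, add_zero, hσ0]
            exact scale_zero_scale_ne (by norm_num) hv0)) hβ
        rw [h7, h8] at h9
        simp at h9
      have h8 : Tendsto (fun k : ι ↦ (k : ℝ)) U (𝓝 (β * ρ)) :=
        (hβt.mul h5).congr fun k ↦ div_mul_cancel₀ _ (hr k).ne'
      -- The maximal curve s ↦ scale (-ρ) (γ (ρ β - ρ s)) agrees with σ' at β, so its interval
      -- contains 0, which means ρ β ∈ J.
      have h9 := (hγ.scale_comp (ρ * β) (neg_ne_zero.2 hρ)).subset σ' I' hσ'.isOpen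
        hσ'.ordConnected hσ'.isMIntegralCurveOn β
        (by simpa [mem_preimage] using h0) hβ (by rw [h7]; simp) h0I'
      have h10 : β * ρ ∈ J := by simpa [mul_comm] using h9
      have h11 : 0 ≤ β * ρ := ge_of_tendsto h8 (.of_forall fun k : ι ↦ k.2.2)
      obtain ⟨ε, hε, hεJ⟩ := Metric.isOpen_iff.1 hγ.isOpen _ h10
      have h12 : β * ρ + ε / 2 ∈ J := hεJ (by
        rw [Real.ball_eq_Ioo]; constructor <;> linarith)
      have h13 : ∀ᶠ k : ι in (U : Filter ι), β * ρ + ε / 2 ≤ (k : ℝ) :=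
        hU (mem_atTop (⟨β * ρ + ε / 2, h12, by linarith⟩ : ι))
      have := ge_of_tendsto h8 h13
      linarith
  obtain ⟨t, ht, htC⟩ := hD.exists_notMem hC hσ h0I (hσ0.symm ▸ hv0)
  rcases le_total 0 t with h | h
  · exact htC (hfwd t ht h)
  · refine htC ?_
    have := hbwd (-t) (by simpa [hI'def] using ht) (by linarith)
    simpa [hσ'def] using this

/-- If `D` is disprisoning, geodesics of connections converging to `D` over the compact set `C`
do not have a half contained in `C`. -/
lemma LinearConnection.IsDisprisoning.not_forward_subset (hD : D.IsDisprisoning)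
    (U : Ultrafilter ι) (hC : IsCompact C)
    (hSS : TendstoLocallyUniformlyInCharts 𝓘(ℝ, E).tangent (fun k ↦ (D' k).geodesicSpray)
      D.geodesicSpray U ((fun v ↦ v.proj) ⁻¹' C))
    {w : ι → ℝ → TangentBundle 𝓘(ℝ, E) M} {J : ι → Set ℝ}
    (hw : ∀ k, IsMaximalMIntegralCurveOn (w k) (D' k).geodesicSpray (J k))
    (h0 : ∀ k, 0 ∈ J k) (hv : ∀ k, scale 0 (w k 0) ≠ w k 0)
    (hwC : ∀ k, ∀ s ∈ J k, 0 ≤ s → (w k s).proj ∈ C) : False := by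
  have hT2 : T2Space (TangentBundle 𝓘(ℝ, E) M) := TangentBundle.t2Space
  have : CompleteSpace E := FiniteDimensional.complete ℝ E
  obtain ⟨r, v, hr, hv0, hrv⟩ := exists_tendsto_scale U hC (v := fun k ↦ w k 0)
    (fun k ↦ hwC k 0 (h0 k) le_rfl) hv
  obtain ⟨σ, I, h0I, hσ0, hσ⟩ := exists_isMaximalMIntegralCurveOn D.contMDiff_geodesicSpray 0 v
  obtain ⟨t, ht, ht0, htC⟩ := hD.exists_ge_notMem hC hσ h0I (hσ0.symm ▸ hv0)
  refine htC (mem_of_forward_subset U hC.isClosed hSS hσ h0I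
    (fun k ↦ (hw k).scale_comp 0 (hr k).ne') (fun k ↦ by simpa using h0 k)
    (fun k s hs hs0 ↦ hwC k _ hs (by simpa using mul_nonneg (hr k).le hs0)) ?_ ht ht0)
  simpa [hσ0] using hrv

/-- A limit geodesic of geodesic segments over `C` that end in the closed set `A` reaches `A`. -/
lemma LinearConnection.IsDisprisoning.exists_ge_mem (hD : D.IsDisprisoning)
    (U : Ultrafilter ι) (hC : IsCompact C)
    (hSS : TendstoLocallyUniformlyInCharts 𝓘(ℝ, E).tangent (fun k ↦ (D' k).geodesicSpray)
      D.geodesicSpray U ((fun v ↦ v.proj) ⁻¹' C))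
    {σ : ℝ → TangentBundle 𝓘(ℝ, E) M} {I : Set ℝ}
    (hσ : IsMaximalMIntegralCurveOn σ D.geodesicSpray I) (h0I : 0 ∈ I)
    (hσ0 : scale 0 (σ 0) ≠ σ 0)
    {w : ι → ℝ → TangentBundle 𝓘(ℝ, E) M} {J : ι → Set ℝ}
    (hw : ∀ k, IsMaximalMIntegralCurveOn (w k) (D' k).geodesicSpray (J k)) {b : ι → ℝ}
    (hb : ∀ k, 0 ≤ b k) (hbJ : ∀ k, Icc 0 (b k) ⊆ J k)
    (hbC : ∀ k, ∀ s ∈ Icc 0 (b k), (w k s).proj ∈ C)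
    (hw0 : Tendsto (fun k ↦ w k 0) U (𝓝 (σ 0))) {A : Set M} (hA : IsClosed A)
    (hbA : ∀ k, (w k (b k)).proj ∈ A) : ∃ t ∈ I, 0 ≤ t ∧ (σ t).proj ∈ A := by
  obtain ⟨t, ht, ht0, htC⟩ := hD.exists_ge_notMem hC hσ h0I hσ0
  have key := fun {t : ℝ} (ht : t ∈ I) (τ : ι → ℝ) (hτ : Tendsto τ U (𝓝 t))
      (hτT : ∀ᶠ k : ι in (U : Filter ι), τ k ∈ Icc 0 (b k)) ↦
    continuous_totalSpace_proj.continuousAt.tendsto.comp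
      (tendsto_of_tendsto_time (T := fun k : ι ↦ Icc 0 (b k)) hSS hσ h0I hw
      (fun k ↦ isForwardTimeSet_Icc _) hbJ hbC hw0 ht hτ hτT)
  -- Segments that eventually outlast t would force σ t to lie over C, against the choice of t.
  rcases eventually_le_or_tendsto U hσ.ordConnected h0I ht hb with h | ⟨β, hβ, hβ0, hβt⟩
  · have h1 : ∀ᶠ k in (U : Filter ι), t ∈ Icc 0 (b k) := h.mono fun k hk ↦ ⟨ht0, hk⟩
    exact absurd (hC.isClosed.mem_of_tendsto (key ht _ tendsto_const_nhds h1)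
      (h1.mono fun k hk ↦ hbC k t hk)) htC
  · exact ⟨β, hβ, hβ0, hA.mem_of_tendsto (key hβ _ hβt (.of_forall fun k ↦ ⟨hb k, le_rfl⟩))
      (.of_forall hbA)⟩

/-- If `D` is disprisoning and its geodesic segments with endpoints in the closed set `A` lie in
the open set `O`, then the same holds for segments over the compact set `C` for connections
converging to `D` over `C`. -/
lemma LinearConnection.IsDisprisoning.not_segments (hD : D.IsDisprisoning)
    (U : Ultrafilter ι) (hC : IsCompact C)
    (hSS : TendstoLocallyUniformlyInCharts 𝓘(ℝ, E).tangent (fun k ↦ (D' k).geodesicSpray)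
      D.geodesicSpray U ((fun v ↦ v.proj) ⁻¹' C))
    {A O : Set M} (hA : IsClosed A) (hO : IsOpen O)
    (hAO : ∀ (γ : ℝ → TangentBundle 𝓘(ℝ, E) M) (J : Set ℝ),
      IsMaximalMIntegralCurveOn γ D.geodesicSpray J → ∀ a ∈ J, ∀ b ∈ J, a ≤ b → (γ a).proj ∈ A →
      (γ b).proj ∈ A → ∀ t ∈ Icc a b, (γ t).proj ∈ O)
    {w : ι → ℝ → TangentBundle 𝓘(ℝ, E) M} {J : ι → Set ℝ}
    (hw : ∀ k, IsMaximalMIntegralCurveOn (w k) (D' k).geodesicSpray (J k)) {a b t : ι → ℝ}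
    (ha : ∀ k, a k ∈ J k) (hb : ∀ k, b k ∈ J k) (ht : ∀ k, t k ∈ Icc (a k) (b k))
    (hwC : ∀ k, ∀ s ∈ Icc (a k) (b k), (w k s).proj ∈ C)
    (haA : ∀ k, (w k (a k)).proj ∈ A) (hbA : ∀ k, (w k (b k)).proj ∈ A)
    (htO : ∀ k, (w k (t k)).proj ∉ O) : False := by
  have hT2 : T2Space (TangentBundle 𝓘(ℝ, E) M) := TangentBundle.t2Space
  have : CompleteSpace E := FiniteDimensional.complete ℝ E
  -- Seen from constant geodesics. It also makes the velocities at t k nonzero: a constant curve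
  -- would stay in A.
  have hsub : A ⊆ O := by
    intro x hx
    obtain ⟨γ, J, h0, hγ0, hγ⟩ := exists_isMaximalMIntegralCurveOn D.contMDiff_geodesicSpray 0
      (⟨x, 0⟩ : TangentBundle 𝓘(ℝ, E) M)
    have := hAO γ J hγ 0 h0 0 h0 le_rfl (by rwa [hγ0]) (by rwa [hγ0]) 0 (by simp)
    rwa [hγ0] at this
  have htJ : ∀ k, t k ∈ J k := fun k ↦ (hw k).ordConnected.out (ha k) (hb k) (ht k)
  have hv : ∀ k, scale 0 (w k (t k)) ≠ w k (t k) := fun k h ↦ by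
    have h1 := (hw k).isMIntegralCurveOn.eq_of_scale_zero_eq (hw k).isOpen (hw k).ordConnected
      (htJ k) h (ha k)
    exact htO k (h1 ▸ hsub (haA k))
  obtain ⟨r, v, hr, hv0, hrv⟩ := exists_tendsto_scale U hC (v := fun k ↦ w k (t k))
    (fun k ↦ hwC k _ (ht k)) hv
  obtain ⟨σ, I, h0I, hσ0, hσ⟩ := exists_isMaximalMIntegralCurveOn D.contMDiff_geodesicSpray 0 v
  have hmem : ∀ k, ∀ s ∈ Icc 0 ((b k - t k) / r k), t k + r k * s ∈ Icc (a k) (b k) := by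
    intro k s hs
    have h1 : s * r k ≤ b k - t k := (le_div_iff₀ (hr k)).1 hs.2
    have h2 := mul_nonneg (hr k).le hs.1
    exact ⟨(ht k).1.trans (by linarith), by linarith⟩
  have hmem' : ∀ k, ∀ s ∈ Icc 0 ((t k - a k) / r k), t k + -r k * s ∈ Icc (a k) (b k) := by
    intro k s hs
    have h1 : s * r k ≤ t k - a k := (le_div_iff₀ (hr k)).1 hs.2
    have h2 := mul_nonneg (hr k).le hs.1
    exact ⟨by linarith, le_trans (by linarith) (ht k).2⟩
  have hout : ∀ k, Icc (a k) (b k) ⊆ J k := fun k ↦ (hw k).ordConnected.out (ha k) (hb k)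
  -- The pieces from t k to b k give a point of σ over A at a time β ≥ 0; the reversed pieces from t
  -- k to a k give one at time -α ≤ 0.
  obtain ⟨β, hβ, hβ0, hβA⟩ := hD.exists_ge_mem U hC hSS hσ h0I (hσ0.symm ▸ hv0)
    (fun k ↦ (hw k).scale_comp (t k) (hr k).ne') (b := fun k ↦ (b k - t k) / r k)
    (fun k ↦ div_nonneg (sub_nonneg.2 (ht k).2) (hr k).le)
    (fun k s hs ↦ hout k (hmem k s hs)) (fun k s hs ↦ hwC k _ (hmem k s hs))
    (by simpa [hσ0] using hrv) hA (fun k ↦ by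
      have : t k + r k * ((b k - t k) / r k) = b k := by
        rw [mul_div_cancel₀ _ (hr k).ne']; ring
      simpa [this] using hbA k)
  have hσ' := hσ.scale_comp 0 (r := -1) (by norm_num)
  obtain ⟨α, hα, hα0, hαA⟩ := hD.exists_ge_mem U hC hSS hσ' (by simpa using h0I)
    (by simpa [hσ0] using scale_zero_scale_ne (r := -1) (by norm_num) hv0)
    (fun k ↦ (hw k).scale_comp (t k) (neg_ne_zero.2 (hr k).ne'))
    (b := fun k ↦ (t k - a k) / r k)
    (fun k ↦ div_nonneg (sub_nonneg.2 (ht k).1) (hr k).le)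
    (fun k s hs ↦ hout k (hmem' k s hs)) (fun k s hs ↦ hwC k _ (hmem' k s hs))
    (by
      have h1 := ((continuous_scale (E := E) (M := M)).comp
        (Continuous.prodMk_right (-1))).continuousAt.tendsto.comp hrv
      simpa [hσ0, Function.comp_def] using h1) hA (fun k ↦ by
      have : t k + -r k * ((t k - a k) / r k) = a k := by
        rw [neg_mul, mul_div_cancel₀ _ (hr k).ne']; ring
      simp only [this]
      exact haA k)
  have h1 := hAO σ I hσ _ hα β hβ (by linarith) hαA hβA 0 ⟨by linarith, hβ0⟩
  have h2 : (v.proj) ∉ O := hO.isClosed_compl.mem_of_tendsto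
    (continuous_totalSpace_proj.continuousAt.tendsto.comp hrv) (.of_forall htO)
  rw [hσ0] at h1
  exact h2 h1

end Imprisonment

/-! ### The C⁰ topology over a subset, and locally uniform convergence of sprays -/

section FineTopology

variable {E : Type*} [NormedAddCommGroup E] [NormedSpace ℝ E]
  {M : Type*} [TopologicalSpace M] [ChartedSpace E M] [IsManifold 𝓘(ℝ, E) ∞ M]

open TangentBundle

lemma Bundle.ContMDiffRiemannianMetric.continuous_inner_self
    (h : ContMDiffRiemannianMetric 𝓘(ℝ, E) ∞ E (TangentSpace 𝓘(ℝ, E) : M → Type _)) :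
    Continuous (fun v : TangentBundle 𝓘(ℝ, E) M ↦ h.inner v.proj v.snd v.snd) := by
  have hπ : ContMDiff 𝓘(ℝ, E).tangent 𝓘(ℝ, E) ∞ (fun w : TangentBundle 𝓘(ℝ, E) M ↦ w.proj) :=
    contMDiff_proj (TangentSpace 𝓘(ℝ, E) : M → Type _)
  have h1 := h.contMDiff.comp hπ
  have h2 : ContMDiff 𝓘(ℝ, E).tangent (𝓘(ℝ, E).prod 𝓘(ℝ, ℝ)) ∞
      (fun v : TangentBundle 𝓘(ℝ, E) M ↦ TotalSpace.mk' ℝ (E := Bundle.Trivial M ℝ) v.proj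
        (h.inner v.proj v.snd v.snd)) :=
    ContMDiff.clm_bundle_apply₂ (b := fun v : TangentBundle 𝓘(ℝ, E) M ↦ v.proj)
      (E₁ := (TangentSpace 𝓘(ℝ, E) : M → Type _)) (E₂ := (TangentSpace 𝓘(ℝ, E) : M → Type _))
      (E₃ := Bundle.Trivial M ℝ) (F₁ := E) (F₂ := E) (F₃ := ℝ)
      (ψ := fun v ↦ h.inner v.proj) (v := fun v ↦ v.snd) (w := fun v ↦ v.snd) h1
      contMDiff_id contMDiff_id
  refine continuous_iff_continuousAt.2 fun v ↦ ?_
  have h3 := h2.continuous.continuousAt (x := v)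
  rw [FiberBundle.continuousAt_totalSpace] at h3
  exact h3.2

lemma Bundle.ContMDiffRiemannianMetric.inner_self_scale
    (h : ContMDiffRiemannianMetric 𝓘(ℝ, E) ∞ E (TangentSpace 𝓘(ℝ, E) : M → Type _)) (r : ℝ)
    (v : TangentBundle 𝓘(ℝ, E) M) :
    h.inner (scale r v).proj (scale r v).snd (scale r v).snd =
      r ^ 2 * h.inner v.proj v.snd v.snd := by
  obtain ⟨x, u⟩ := v
  have h1 : ∀ (L : E →L[ℝ] E →L[ℝ] ℝ) (u : E), L (r • u) (r • u) = r ^ 2 * L u u := fun L u ↦ by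
    rw [map_smul, map_smul, smul_apply, smul_eq_mul, smul_eq_mul, pow_two, mul_assoc]
  exact h1 (h.inner x) u

/-- A tangent vector is zero or a positive multiple of a unit vector. -/
lemma Bundle.ContMDiffRiemannianMetric.exists_scale_eq
    (h : ContMDiffRiemannianMetric 𝓘(ℝ, E) ∞ E (TangentSpace 𝓘(ℝ, E) : M → Type _))
    (v : TangentBundle 𝓘(ℝ, E) M) :
    v = scale 0 v ∨ 0 < h.inner v.proj v.snd v.snd ∧ ∃ u : TangentBundle 𝓘(ℝ, E) M,
      u.proj = v.proj ∧ h.inner u.proj u.snd u.snd = 1 ∧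
      v = scale (√(h.inner v.proj v.snd v.snd)) u := by
  by_cases hv : v.snd = 0
  · left
    obtain ⟨x, u⟩ := v
    dsimp only at hv
    rw [hv, scale]
    simp
  right
  have hpos := h.pos v.proj v.snd hv
  set c := h.inner v.proj v.snd v.snd
  have hs : √c ≠ 0 := (Real.sqrt_pos.2 hpos).ne'
  refine ⟨hpos, scale (√c)⁻¹ v, rfl, ?_, ?_⟩
  · rw [h.inner_self_scale, inv_pow, Real.sq_sqrt hpos.le]
    exact inv_mul_cancel₀ hpos.ne'
  · rw [scale_scale, mul_inv_cancel₀ hs, scale_one]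

namespace LinearConnection

/-- The part over `C` of the section of `TTM` over the unit sphere bundle given by the spray. -/
noncomputable def unitSprayImage (D : LinearConnection E M)
    (h : ContMDiffRiemannianMetric 𝓘(ℝ, E) ∞ E (TangentSpace 𝓘(ℝ, E) : M → Type _)) (C : Set M) :
    Set (TangentBundle 𝓘(ℝ, E).tangent (TangentBundle 𝓘(ℝ, E) M)) :=
  (fun v : TangentBundle 𝓘(ℝ, E) M ↦ ⟨v, D.geodesicSpray v⟩) ''
    {v | v.proj ∈ C ∧ h.inner v.proj v.snd v.snd = 1}

/-- The filter of neighbourhoods of `D` in the `C⁰` topology over `C`. -/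
noncomputable def nhdsOver (D : LinearConnection E M)
    (h : ContMDiffRiemannianMetric 𝓘(ℝ, E) ∞ E (TangentSpace 𝓘(ℝ, E) : M → Type _)) (C : Set M) :
    Filter (LinearConnection E M) :=
  comap (fun D' ↦ D'.unitSprayImage h C) (𝓝ˢ (D.unitSprayImage h C)).smallSets

lemma eventually_nhdsOver_iff {D : LinearConnection E M}
    {h : ContMDiffRiemannianMetric 𝓘(ℝ, E) ∞ E (TangentSpace 𝓘(ℝ, E) : M → Type _)} {C : Set M}
    {P : LinearConnection E M → Prop} :
    (∀ᶠ D' in D.nhdsOver h C, P D') ↔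
      ∃ W : Set (TangentBundle 𝓘(ℝ, E).tangent (TangentBundle 𝓘(ℝ, E) M)), IsOpen W ∧
        D.unitSprayImage h C ⊆ W ∧ ∀ D' : LinearConnection E M, D'.unitSprayImage h C ⊆ W → P D' := by
  rw [nhdsOver, ((hasBasis_nhdsSet _).smallSets.comap _).eventually_iff]
  simp only [and_assoc]
  rfl

variable [FiniteDimensional ℝ E] [T2Space M]

/-- Convergence in the `C⁰` topology over `C` implies locally uniform convergence over `C`. -/
lemma tendstoLocallyUniformlyInCharts_nhdsOver (D : LinearConnection E M)
    (h : ContMDiffRiemannianMetric 𝓘(ℝ, E) ∞ E (TangentSpace 𝓘(ℝ, E) : M → Type _)) (C : Set M) :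
    TendstoLocallyUniformlyInCharts 𝓘(ℝ, E).tangent
      (fun D' : LinearConnection E M ↦ D'.geodesicSpray) D.geodesicSpray (D.nhdsOver h C)
      ((fun v ↦ v.proj) ⁻¹' C) := by
  have : CompleteSpace E := FiniteDimensional.complete ℝ E
  have : ProperSpace E := FiniteDimensional.proper ℝ E
  have : LocallyCompactSpace M := Manifold.locallyCompact_of_finiteDimensional 𝓘(ℝ, E)
  intro p
  set x := p.proj
  obtain ⟨B, hB, hBc, hBs⟩ := exists_mem_nhds_isClosed_subset
    ((chartAt E x).open_source.mem_nhds (mem_chart_source E x))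
  set Λ := h.inner p.proj p.snd p.snd + 1
  have hΛ : ∀ᶠ q in 𝓝 p, h.inner q.proj q.snd q.snd < Λ :=
    h.continuous_inner_self.continuousAt.eventually (gt_mem_nhds (lt_add_one _))
  refine ⟨(fun v ↦ v.proj) ⁻¹' B ∩ {q | h.inner q.proj q.snd q.snd < Λ},
    inter_mem (continuous_totalSpace_proj.continuousAt hB) hΛ, fun ε hε ↦ ?_⟩
  set e := trivializationAt (E × E) (TangentSpace 𝓘(ℝ, E).tangent) p
  have hcoord : ∀ (D' : LinearConnection E M) (q : TangentBundle 𝓘(ℝ, E) M),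
      (e (⟨q, D'.geodesicSpray q⟩ :
        TangentBundle 𝓘(ℝ, E).tangent (TangentBundle 𝓘(ℝ, E) M))).2 =
      tangentCoordChange 𝓘(ℝ, E).tangent q p q (D'.geodesicSpray q) := fun _ _ ↦ rfl
  -- By homogeneity the difference of two sprays at q is h(q, q) < Λ times their difference at the
  -- corresponding unit vector, so δ-closeness on unit vectors gives ε near p.
  set δ := ε / (|Λ| + 1) with hδ
  have hδ0 : 0 < δ := by positivity
  let f : TangentBundle 𝓘(ℝ, E).tangent (TangentBundle 𝓘(ℝ, E) M) → E × E := fun ξ ↦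
    (e ξ).2 - (e (⟨ξ.proj, D.geodesicSpray ξ.proj⟩ :
      TangentBundle 𝓘(ℝ, E).tangent (TangentBundle 𝓘(ℝ, E) M))).2
  have hcp : Continuous
      (fun ξ : TangentBundle 𝓘(ℝ, E).tangent (TangentBundle 𝓘(ℝ, E) M) ↦ ξ.proj) :=
    FiberBundle.continuous_proj (E × E)
      (TangentSpace 𝓘(ℝ, E).tangent : TangentBundle 𝓘(ℝ, E) M → Type _)
  have hmem : ∀ {ξ : TangentBundle 𝓘(ℝ, E).tangent (TangentBundle 𝓘(ℝ, E) M)},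
      ξ.proj.proj ∈ (chartAt E x).source → ξ ∈ e.source := fun hξ ↦
    (Trivialization.mem_source _).2 (TangentBundle.mem_chart_source_iff _ _ |>.2 hξ)
  have hf : ContinuousOn f ((fun ξ ↦ ξ.proj.proj) ⁻¹' (chartAt E x).source) := by
    refine ContinuousOn.sub ?_ ?_
    · exact continuous_snd.comp_continuousOn (e.continuousOn.mono fun ξ hξ ↦ hmem hξ)
    · exact continuous_snd.comp_continuousOn (e.continuousOn.comp
        (D.contMDiff_geodesicSpray.continuous.comp hcp).continuousOn fun ξ hξ ↦ hmem hξ)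
  have hopen : IsOpen ((fun ξ : TangentBundle 𝓘(ℝ, E).tangent (TangentBundle 𝓘(ℝ, E) M) ↦
      ξ.proj.proj) ⁻¹' (chartAt E x).source) :=
    (chartAt E x).open_source.preimage (continuous_totalSpace_proj.comp hcp)
  -- Closeness is demanded only over the closed set B inside the chart domain; the second piece
  -- leaves vectors over the complement of B unconstrained.
  have hW := (hf.isOpen_inter_preimage hopen (Metric.isOpen_ball (x := (0 : E × E)) (ε := δ))).union
    (hBc.isOpen_compl.preimage (continuous_totalSpace_proj.comp hcp))
  refine eventually_nhdsOver_iff.2 ⟨_, hW, ?_, fun D' hD' q hq hqC ↦ ?_⟩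
  · rintro _ ⟨v, hv, rfl⟩
    by_cases hvB : v.proj ∈ B
    · refine Or.inl ⟨hBs hvB, ?_⟩
      change f _ ∈ Metric.ball 0 δ
      simp [f, hδ0]
    · exact Or.inr hvB
  have hqs : q.proj ∈ (chartAt E p.proj).source := hBs hq.1
  have hunit : ∀ u : TangentBundle 𝓘(ℝ, E) M, u.proj = q.proj → h.inner u.proj u.snd u.snd = 1 →
      ‖D'.sprayCoord x u - D.sprayCoord x u‖ < δ := by
    intro u hu hu1
    rcases hD' ⟨u, ⟨hu ▸ hqC, hu1⟩, rfl⟩ with ⟨-, h1⟩ | h1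
    · have h2 : ‖tangentCoordChange 𝓘(ℝ, E).tangent u p u (D'.geodesicSpray u) -
          tangentCoordChange 𝓘(ℝ, E).tangent u p u (D.geodesicSpray u)‖ < δ :=
        mem_ball_zero_iff.1 h1
      have hus : u.proj ∈ (chartAt E p.proj).source := hu ▸ hqs
      rw [D.tangentCoordChange_geodesicSpray hus, D'.tangentCoordChange_geodesicSpray hus] at h2
      exact (norm_snd_le _).trans_lt h2
    · exact absurd (show u.proj ∈ B from hu ▸ hq.1) h1
  have key : ‖D'.sprayCoord x q - D.sprayCoord x q‖ ≤ ε := by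
    rcases h.exists_scale_eq q with h0 | ⟨hpos, u, hu, hu1, hqu⟩
    · have h1 : ∀ D₁ : LinearConnection E M, D₁.sprayCoord x q = 0 := fun D₁ ↦ by
        rw [h0]
        exact (D₁.sprayCoord_smul hqs 0).trans (by simp)
      rw [h1, h1]
      simpa using hε.le
    · have hus : u.proj ∈ (chartAt E p.proj).source := hu ▸ hqs
      have h1 : ∀ D₁ : LinearConnection E M, D₁.sprayCoord x q =
          (h.inner q.proj q.snd q.snd) • D₁.sprayCoord x u := fun D₁ ↦ by
        conv_lhs => rw [hqu]
        refine (D₁.sprayCoord_smul hus _).trans ?_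
        rw [Real.sq_sqrt hpos.le]
      rw [h1, h1, ← smul_sub, norm_smul, Real.norm_of_nonneg hpos.le]
      have h2 : h.inner q.proj q.snd q.snd ≤ |Λ| + 1 :=
        hq.2.le.trans ((le_abs_self _).trans (lt_add_one _).le)
      calc _ ≤ (|Λ| + 1) * δ := mul_le_mul h2 (hunit u hu hu1).le (norm_nonneg _) (by positivity)
        _ = ε := by rw [hδ]; field_simp
  rw [D.tangentCoordChange_geodesicSpray hqs, D'.tangentCoordChange_geodesicSpray hqs]
  have h3 : ((fiberCoord p.proj q, D'.sprayCoord p.proj q) : E × E) -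
      (fiberCoord p.proj q, D.sprayCoord p.proj q) =
      (0, D'.sprayCoord x q - D.sprayCoord x q) := by
    rw [Prod.mk_sub_mk, sub_self]
  rw [h3, Prod.norm_mk, norm_zero]
  exact max_le hε.le key

end LinearConnection

end FineTopology

/-! ### Exhaustion, shells, and the passage from local to global -/

section Stability

open TangentBundle

/-- A connected locally compact paracompact Hausdorff space is σ-compact. -/
lemma sigmaCompactSpace_of_connected_paracompact (X : Type*) [TopologicalSpace X] [T2Space X]
    [ConnectedSpace X] [ParacompactSpace X] [LocallyCompactSpace X] : SigmaCompactSpace X := by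
  choose Z hZ hZx using fun x : X ↦ exists_compact_mem_nhds x
  obtain ⟨V, hVo, hVu, hVf, hVs⟩ := precise_refinement (fun x ↦ interior (Z x))
    (fun x ↦ isOpen_interior) (iUnion_eq_univ_iff.2 fun x ↦ ⟨x, mem_interior_iff_mem_nhds.2 (hZx x)⟩)
  have hVc : ∀ x, IsCompact (closure (V x)) := fun x ↦
    (hZ x).closure_of_subset ((hVs x).trans interior_subset)
  -- The star of K in a locally finite cover is compact when K is. The iterated stars of a point
  -- have a clopen union, hence exhaust the space.
  let f : Set X → Set X := fun K ↦ ⋃ i ∈ {i | (V i ∩ K).Nonempty}, closure (V i)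
  have hf : ∀ K, IsCompact K → IsCompact (f K) := fun K hK ↦
    (hVf.finite_nonempty_inter_compact hK).isCompact_biUnion fun i _ ↦ hVc i
  obtain ⟨x₀⟩ := (inferInstance : Nonempty X)
  let K : ℕ → Set X := fun n ↦ f^[n] {x₀}
  have hKs : ∀ n, K (n + 1) = f (K n) := fun n ↦ Function.iterate_succ_apply' f n _
  have hK : ∀ n, IsCompact (K n) := by
    intro n
    induction n with
    | zero => exact isCompact_singleton
    | succ n ih => rw [hKs]; exact hf _ ih
  have hsub : ∀ {n i}, (V i ∩ K n).Nonempty → V i ⊆ K (n + 1) := fun {n i} hi ↦ by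
    rw [hKs]
    exact subset_closure.trans (subset_biUnion_of_mem (u := fun i ↦ closure (V i)) hi)
  have hopen : IsOpen (⋃ n, K n) := by
    refine isOpen_iff_mem_nhds.2 fun x hx ↦ ?_
    obtain ⟨n, hn⟩ := mem_iUnion.1 hx
    obtain ⟨i, hi⟩ := iUnion_eq_univ_iff.1 hVu x
    exact mem_of_superset ((hVo i).mem_nhds hi) ((hsub ⟨x, hi, hn⟩).trans (subset_iUnion K _))
  have hclosed : IsClosed (⋃ n, K n) := by
    refine ⟨isOpen_iff_mem_nhds.2 fun x hx ↦ ?_⟩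
    obtain ⟨i, hi⟩ := iUnion_eq_univ_iff.1 hVu x
    refine mem_of_superset ((hVo i).mem_nhds hi) fun y hy hyK ↦ hx ?_
    obtain ⟨n, hn⟩ := mem_iUnion.1 hyK
    exact mem_iUnion.2 ⟨n + 1, hsub ⟨y, hy, hn⟩ hi⟩
  have huniv : ⋃ n, K n = univ :=
    (isClopen_iff.1 ⟨hclosed, hopen⟩).resolve_left fun h ↦
      notMem_empty x₀ (h ▸ mem_iUnion.2 ⟨0, mem_singleton x₀⟩)
  exact SigmaCompactSpace.of_countable (range K) (countable_range K)
    (forall_mem_range.2 hK) (by rwa [sUnion_range])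

/-- Replaces a sequence of counterexamples: the ultrafilter lives on the failing points themselves,
so witnesses of failure can be chosen at every index. -/
lemma eventually_of_forall_ultrafilter {X : Type*} {l : Filter X} {P : X → Prop}
    (h : ∀ U : Ultrafilter {x // ¬ P x}, Tendsto Subtype.val (U : Filter {x // ¬ P x}) l → False) :
    ∀ᶠ x in l, P x := by
  by_contra hcon
  have hne : (comap (Subtype.val : {x // ¬ P x} → X) l).NeBot :=
    comap_neBot_iff_frequently.2 ((not_eventually.1 hcon).mono fun x hx ↦ ⟨⟨x, hx⟩, rfl⟩)
  exact h (Ultrafilter.of _) (tendsto_comap.mono_left (Ultrafilter.of_le _))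

variable {E : Type*} [NormedAddCommGroup E] [NormedSpace ℝ E] [FiniteDimensional ℝ E]
  {M : Type*} [TopologicalSpace M] [ChartedSpace E M] [IsManifold 𝓘(ℝ, E) ∞ M] [T2Space M]

namespace LinearConnection

/-- The geodesic segments of `D` over `C` with endpoints in `A` lie in `O`. -/
def SegmentsSubset (D : LinearConnection E M) (C A O : Set M) : Prop :=
  ∀ (w : ℝ → TangentBundle 𝓘(ℝ, E) M) (J : Set ℝ), IsMaximalMIntegralCurveOn w D.geodesicSpray J →
    ∀ a ∈ J, ∀ b ∈ J, (∀ s ∈ Icc a b, (w s).proj ∈ C) → (w a).proj ∈ A → (w b).proj ∈ A →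
    ∀ t ∈ Icc a b, (w t).proj ∈ O

/-- The forward half of a maximal nonconstant geodesic of `D` is not contained in `C`. -/
def LeavesForward (D : LinearConnection E M) (C : Set M) : Prop :=
  ∀ (w : ℝ → TangentBundle 𝓘(ℝ, E) M) (J : Set ℝ), IsMaximalMIntegralCurveOn w D.geodesicSpray J →
    0 ∈ J → scale 0 (w 0) ≠ w 0 → ∃ t ∈ J, 0 ≤ t ∧ (w t).proj ∉ C

variable {D : LinearConnection E M} {C : Set M}
  {h : ContMDiffRiemannianMetric 𝓘(ℝ, E) ∞ E (TangentSpace 𝓘(ℝ, E) : M → Type _)}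

lemma IsDisprisoning.eventually_leavesForward (hD : D.IsDisprisoning) (hC : IsCompact C) :
    ∀ᶠ D' in D.nhdsOver h C, D'.LeavesForward C := by
  refine eventually_of_forall_ultrafilter fun U hU ↦ ?_
  have hbad := fun k : {D' : LinearConnection E M // ¬ D'.LeavesForward C} ↦ k.2
  simp only [LeavesForward] at hbad
  push Not at hbad
  choose w J hw h0 hv hwC using hbad
  refine hD.not_forward_subset U hC (fun p ↦ ?_) hw h0 hv hwC
  obtain ⟨V, hV, hVε⟩ := D.tendstoLocallyUniformlyInCharts_nhdsOver h C p
  exact ⟨V, hV, fun ε hε ↦ hU.eventually (hVε ε hε)⟩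

lemma IsDisprisoning.eventually_segmentsSubset (hD : D.IsDisprisoning) (hC : IsCompact C)
    {A O : Set M} (hA : IsClosed A) (hO : IsOpen O)
    (hAO : D.SegmentsSubset univ A O) : ∀ᶠ D' in D.nhdsOver h C, D'.SegmentsSubset C A O := by
  refine eventually_of_forall_ultrafilter fun U hU ↦ ?_
  have hbad := fun k : {D' : LinearConnection E M // ¬ D'.SegmentsSubset C A O} ↦ k.2
  simp only [SegmentsSubset] at hbad
  push Not at hbad
  choose w J hw a ha b hb hwC haA hbA t ht htO using hbad
  refine hD.not_segments U hC (fun p ↦ ?_) hA hO (fun γ J hγ a ha b hb _ haA hbA t ht ↦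
    hAO γ J hγ a ha b hb (fun _ _ ↦ mem_univ _) haA hbA t ht) hw ha hb ht hwC haA hbA htO
  obtain ⟨V, hV, hVε⟩ := D.tendstoLocallyUniformlyInCharts_nhdsOver h C p
  exact ⟨V, hV, fun ε hε ↦ hU.eventually (hVε ε hε)⟩

/-- A pseudoconvex connection has an exhaustion by compact sets such that segments with endpoints
in one of them lie in the interior of the next. -/
lemma IsPseudoconvex.exists_exhaustion [SigmaCompactSpace M] [LocallyCompactSpace M]
    (hD : D.IsPseudoconvex) : ∃ A : ℕ → Set M, (∀ n, IsCompact (A n)) ∧ A 1 = ∅ ∧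
      (∀ n, A n ⊆ interior (A (n + 1))) ∧ (∀ K, IsCompact K → ∃ n, K ⊆ A n) ∧
      ∀ n, D.SegmentsSubset univ (A n) (interior (A (n + 1))) := by
  have hstep : ∀ K : Set M, ∃ L : Set M, IsCompact K → IsCompact L ∧ K ⊆ interior L ∧
      D.SegmentsSubset univ K (interior L) := by
    intro K
    by_cases hK : IsCompact K
    · obtain ⟨K', hK', hseg⟩ := hD K hK
      obtain ⟨L, hL, hKL⟩ := exists_compact_superset (hK.union hK')
      refine ⟨L, fun _ ↦ ⟨hL, subset_union_left.trans hKL, ?_⟩⟩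
      intro w J hw a ha b hb _ haA hbA t ht
      exact hKL (Or.inr (hseg _ J (hw.isMIntegralCurveOn.isGeodesicOn ⟨a, ha⟩ hw.isOpen
        hw.ordConnected) a ha b hb (ht.1.trans ht.2) haA hbA t ht))
    · exact ⟨∅, fun h ↦ absurd h hK⟩
  choose f hf using hstep
  let X : CompactExhaustion M := CompactExhaustion.choice M
  let B : ℕ → Set M := fun n ↦ Nat.rec ∅ (fun n K ↦ f (K ∪ X n)) n
  have hBs : ∀ n, B (n + 1) = f (B n ∪ X n) := fun n ↦ rfl
  have hB : ∀ n, IsCompact (B n) := by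
    intro n
    induction n with
    | zero => exact isCompact_empty
    | succ n ih => exact (hf _ (ih.union (X.isCompact n))).1
  have hB2 := fun n ↦ hf _ ((hB n).union (X.isCompact n))
  -- The truncated shift makes both A 0 and A 1 empty; the descent for disprisonment ends at A 1.
  refine ⟨fun n ↦ B (n - 1), fun n ↦ hB _, rfl, fun n ↦ ?_, fun K hK ↦ ?_, fun n ↦ ?_⟩
  · rcases n with _ | n
    · exact empty_subset _
    · exact subset_union_left.trans (hB2 n).2.1
  · obtain ⟨n, hn⟩ := X.exists_superset_of_isCompact hK
    exact ⟨n + 2, hn.trans (subset_union_right.trans ((hB2 n).2.1.trans interior_subset))⟩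
  · rcases n with _ | n
    · intro w J hw a ha b hb _ haA
      exact absurd haA (notMem_empty _)
    · intro w J hw a ha b hb hab haA hbA
      exact (hB2 n).2.2 w J hw a ha b hb hab (Or.inl haA) (Or.inl hbA)

lemma continuousAt_proj_comp {w : ℝ → TangentBundle 𝓘(ℝ, E) M} {J : Set ℝ}
    (hw : IsMaximalMIntegralCurveOn w D.geodesicSpray J) {t : ℝ} (ht : t ∈ J) :
    ContinuousAt (fun t ↦ (w t).proj) t :=
  continuous_totalSpace_proj.continuousAt.comp
    (hw.isMIntegralCurveOn.continuousOn.continuousAt (hw.isOpen.mem_nhds ht))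

/-- If segments over the shell `L \ interior A` with endpoints in `A` lie in `O`, then so do
segments over `L`, provided that `A ⊆ O`. -/
lemma SegmentsSubset.of_shell {L A O : Set M} (hA : IsClosed A) (hAO : A ⊆ O)
    (hD : D.SegmentsSubset (L \ interior A) A O) : D.SegmentsSubset L A O := by
  intro w J hw a ha b hb hL haA hbA t ht
  by_contra htO
  have htA : (w t).proj ∉ A := fun h ↦ htO (hAO h)
  have hJ : Icc a b ⊆ J := hw.ordConnected.out ha hb
  have hcont : ContinuousOn (fun t ↦ (w t).proj) (Icc a b) := fun s hs ↦
    (continuousAt_proj_comp hw (hJ hs)).continuousWithinAt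
  -- a' is the last time in A before t, and b' below is the first one after t. Strictly between them
  -- the curve avoids A, so on the closed interval it avoids int A by continuity.
  obtain ⟨a', ⟨ha', ha'A⟩, hmax⟩ := (isCompact_Icc.of_isClosed_subset
    ((hcont.mono (Icc_subset_Icc_right ht.2)).preimage_isClosed_of_isClosed isClosed_Icc hA)
    inter_subset_left).exists_isGreatest ⟨a, ⟨le_rfl, ht.1⟩, haA⟩
  obtain ⟨b', ⟨hb', hb'A⟩, hmin⟩ := (isCompact_Icc.of_isClosed_subset
    ((hcont.mono (Icc_subset_Icc_left ht.1)).preimage_isClosed_of_isClosed isClosed_Icc hA)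
    inter_subset_left).exists_isLeast ⟨b, ⟨ht.2, le_rfl⟩, hbA⟩
  have hat : a' < t := ha'.2.lt_of_ne fun h ↦ htA (h ▸ ha'A)
  have htb : t < b' := hb'.1.lt_of_ne fun h ↦ htA (h ▸ hb'A)
  have hout : ∀ s ∈ Ioo a' b', (w s).proj ∉ A := by
    intro s hs hsA
    rcases le_total s t with h | h
    · exact hs.1.not_ge (hmax ⟨⟨ha'.1.trans hs.1.le, h⟩, hsA⟩)
    · exact hs.2.not_ge (hmin ⟨⟨h, hs.2.le.trans hb'.2⟩, hsA⟩)
  have ha'J : a' ∈ J := hJ ⟨ha'.1, ha'.2.trans ht.2⟩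
  have hb'J : b' ∈ J := hJ ⟨ht.1.trans hb'.1, hb'.2⟩
  have hshell : ∀ s ∈ Icc a' b', (w s).proj ∉ interior A := by
    intro s hs hsA
    have hev := (continuousAt_proj_comp hw (hw.ordConnected.out ha'J hb'J hs)).eventually
      (isOpen_interior.mem_nhds hsA)
    rcases hs.2.lt_or_eq with hsb | hsb
    · obtain ⟨s', hs', hs'A⟩ := (Eventually.and (f := 𝓝[>] s) (Ioo_mem_nhdsGT hsb)
        (hev.filter_mono nhdsWithin_le_nhds)).exists
      exact hout s' ⟨hs.1.trans_lt hs'.1, hs'.2⟩ (interior_subset hs'A)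
    · obtain ⟨s', hs', hs'A⟩ := (Eventually.and (f := 𝓝[<] s)
        (Ioo_mem_nhdsLT (hat.trans (htb.trans_eq hsb.symm)))
        (hev.filter_mono nhdsWithin_le_nhds)).exists
      exact hout s' ⟨hs'.1, hs'.2.trans_eq hsb⟩ (interior_subset hs'A)
  exact htO (hD w J hw a' ha'J b' hb'J (fun s hs ↦ ⟨hL s ⟨ha'.1.trans hs.1, hs.2.trans hb'.2⟩,
    hshell s hs⟩) ha'A hb'A t ⟨hat.le, htb.le⟩)

lemma isPseudoconvex_of_exhaustion {A : ℕ → Set M} (hA : ∀ n, IsCompact (A n))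
    (hAn : ∀ n, A n ⊆ interior (A (n + 1))) (hAK : ∀ K, IsCompact K → ∃ n, K ⊆ A n)
    (hseg : ∀ n, D.SegmentsSubset (A (n + 2) \ interior (A n)) (A n) (interior (A (n + 1)))) : D.IsPseudoconvex := by
  have hT2 : T2Space (TangentBundle 𝓘(ℝ, E) M) := TangentBundle.t2Space
  have : CompleteSpace E := FiniteDimensional.complete ℝ E
  have hmono : Monotone A := monotone_nat_of_le_succ fun n ↦ (hAn n).trans interior_subset
  intro K hK
  obtain ⟨n, hn⟩ := hAK K hK
  refine ⟨A (n + 1), hA _, ?_⟩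
  rintro c J ⟨-, hJ, hJc, hc⟩ a ha b hb hab haK hbK
  obtain ⟨w, I, haI, hwa, hw⟩ := exists_isMaximalMIntegralCurveOn D.contMDiff_geodesicSpray a
    (naturalLift (E := E) c a)
  have hJI : J ⊆ I := hw.subset _ J hJ hJc hc a haI ha hwa
  have heq : ∀ t ∈ J, (w t).proj = c t := fun t ht ↦ by
    rw [hw.isMIntegralCurveOn.eqOn_inter D.contMDiff_geodesicSpray hw.isOpen hw.ordConnected hJ hJc
      hc haI ha hwa ⟨hJI ht, ht⟩]
    rfl
  have hIJ : Icc a b ⊆ J := hJc.out ha hb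
  have hcont : ContinuousOn (fun t ↦ (w t).proj) (Icc a b) := fun s hs ↦
    (continuousAt_proj_comp hw (hJI (hIJ hs))).continuousWithinAt
  obtain ⟨N, hN⟩ := hAK _ (isCompact_Icc.image_of_continuousOn hcont)
  -- Each descent from A (n + k + 2) to A (n + k + 1) uses the shell of index n + k; the endpoints
  -- lie in A n, hence in A (n + k).
  have key : ∀ k, (∀ t ∈ Icc a b, (w t).proj ∈ A (n + 1 + k)) →
      ∀ t ∈ Icc a b, (w t).proj ∈ A (n + 1) := by
    intro k
    induction k with
    | zero => exact id
    | succ k ih =>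
      intro hk
      refine ih fun t ht ↦ ?_
      have h1 := (hseg (n + k)).of_shell (hA _).isClosed (hAn _) w I hw a haI b (hJI hb)
        (fun s hs ↦ by have := hk s hs; rwa [show n + 1 + (k + 1) = n + k + 2 by ring] at this)
        (hmono (Nat.le_add_right n k) (hn (heq a ha ▸ haK)))
        (hmono (Nat.le_add_right n k) (hn (heq b hb ▸ hbK))) t ht
      rw [show n + 1 + k = n + k + 1 by ring]
      exact interior_subset h1
  intro t ht
  rw [← heq t (hIJ ht)]
  exact key N (fun s hs ↦ hmono (Nat.le_add_left _ _) (hN (mem_image_of_mem _ hs))) t ht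

lemma isDisprisoning_of_exhaustion {A : ℕ → Set M} (hA : ∀ n, IsCompact (A n))
    (hAn : ∀ n, A n ⊆ interior (A (n + 1))) (hAK : ∀ K, IsCompact K → ∃ n, K ⊆ A n)
    (hseg : ∀ n, D.SegmentsSubset (A (n + 2) \ interior (A n)) (A n) (interior (A (n + 1))))
    (hA1 : A 1 = ∅)
    (hleave : ∀ n, D.LeavesForward (A (n + 2) \ interior (A n))) : D.IsDisprisoning := by
  have hmono : Monotone A := monotone_nat_of_le_succ fun n ↦ (hAn n).trans interior_subset
  intro c J hc hnon K hK hcK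
  obtain ⟨N, hN⟩ := hAK K hK
  have hw := hc.isMaximalMIntegralCurveOn
  set w := naturalLift (E := E) c
  have hwc : ∀ t, (w t).proj = c t := fun t ↦ rfl
  have hne : ∀ t ∈ J, scale 0 (w t) ≠ w t := fun t ht ↦
    hw.isMIntegralCurveOn.scale_zero_ne_of_nontrivial hw.isOpen hw.ordConnected hnon ht
  have key : ∀ k, (∀ t ∈ J, c t ∈ A (k + 1)) → ∀ t ∈ J, c t ∈ A 1 := by
    intro k
    induction k with
    | zero => exact id
    | succ k ih =>
      intro hk
      refine ih fun t₀ ht₀ ↦ ?_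
      by_contra hcon
      -- If A k is met both before and after t₀, the segment condition applies at t₀. Otherwise one
      -- half from t₀ avoids A k and stays in the shell; for the past half, parameter reversal makes
      -- it a forward half.
      by_cases h1 : ∃ a ∈ J, a ≤ t₀ ∧ c a ∈ A k
      · by_cases h2 : ∃ b ∈ J, t₀ ≤ b ∧ c b ∈ A k
        · obtain ⟨a, ha, hat, haA⟩ := h1
          obtain ⟨b, hb, htb, hbA⟩ := h2
          exact hcon (interior_subset ((hseg k).of_shell (hA _).isClosed (hAn _) w J hw a ha b hb
            (fun s hs ↦ hk s (hw.ordConnected.out ha hb hs)) haA hbA t₀ ⟨hat, htb⟩))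
        · push Not at h2
          obtain ⟨t, ht, ht0, htA⟩ := hleave k _ _ (hw.scale_comp t₀ one_ne_zero)
            (by simpa using ht₀) (by simpa using hne t₀ ht₀)
          simp only [one_mul] at ht htA
          exact htA ⟨hk _ ht, fun h ↦ h2 _ ht (by linarith) (interior_subset h)⟩
      · push Not at h1
        obtain ⟨t, ht, ht0, htA⟩ := hleave k _ _ (hw.scale_comp t₀ (r := -1) (by norm_num))
          (by simpa using ht₀)
          (by simpa using scale_zero_scale_ne (r := -1) (by norm_num) (hne t₀ ht₀))
        exact htA ⟨hk _ ht, fun h ↦ h1 _ ht (by linarith) (interior_subset h)⟩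
  obtain ⟨t, ht⟩ := hc.1.1
  have := key N (fun t ht ↦ hmono (Nat.le_succ N) (hN (hcK (mem_image_of_mem c ht)))) t ht
  rw [hA1] at this
  exact this

/-- Conditions that hold near `D` over each member of a locally finite family of closed sets hold
simultaneously for all connections in a `C⁰`-fine neighbourhood of `D`. -/
lemma exists_isOpen_of_eventually_nhdsOver {ι : Type*} {C : ι → Set M} (hC : ∀ i, IsClosed (C i))
    (hCf : LocallyFinite C) {P : ι → LinearConnection E M → Prop}
    (hP : ∀ i, ∀ᶠ D' in D.nhdsOver h (C i), P i D') :
    ∃ U : Set (LinearConnection E M), IsOpen[c0FineTopology h] U ∧ D ∈ U ∧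
      ∀ D' ∈ U, ∀ i, P i D' := by
  choose W hWo hDW hWP using fun i ↦ eventually_nhdsOver_iff.1 (hP i)
  let base : TangentBundle 𝓘(ℝ, E).tangent (TangentBundle 𝓘(ℝ, E) M) → M := fun ξ ↦ ξ.proj.proj
  have hbase : Continuous base := continuous_totalSpace_proj.comp (FiberBundle.continuous_proj (E × E)
    (TangentSpace 𝓘(ℝ, E).tangent : TangentBundle 𝓘(ℝ, E) M → Type _))
  -- The complement of this union is the open subset of TTM that defines the fine neighbourhood:
  -- over each C i it imposes W i. Local finiteness makes the union closed.
  have hcl : IsClosed (⋃ i, (W i)ᶜ ∩ base ⁻¹' C i) :=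
    ((hCf.preimage_continuous hbase).subset fun i ↦ inter_subset_right).isClosed_iUnion
      fun i ↦ (hWo i).isClosed_compl.inter ((hC i).preimage hbase)
  refine ⟨_, TopologicalSpace.isOpen_generateFrom_of_mem ⟨_, hcl.isOpen_compl, rfl⟩, ?_, ?_⟩
  · intro v hv hmem
    obtain ⟨i, hi, hiC⟩ := mem_iUnion.1 hmem
    exact hi (hDW i ⟨v, ⟨hiC, hv⟩, rfl⟩)
  · intro D' hD' i
    refine hWP i D' ?_
    rintro _ ⟨v, ⟨hvC, hv⟩, rfl⟩
    by_contra hcon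
    exact hD' v hv (mem_iUnion.2 ⟨i, hcon, hvC⟩)

/-- A pseudoconvex disprisoning connection has a `C⁰`-fine neighbourhood of such connections. -/
lemma IsPseudoconvex.exists_isOpen [ParacompactSpace M] [ConnectedSpace M] (h' : D.IsPseudoconvex)
    (hD : D.IsDisprisoning) :
    ∃ U : Set (LinearConnection E M), IsOpen[c0FineTopology h] U ∧ D ∈ U ∧
      ∀ D' ∈ U, D'.IsPseudoconvex ∧ D'.IsDisprisoning := by
  have : LocallyCompactSpace M := Manifold.locallyCompact_of_finiteDimensional 𝓘(ℝ, E)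
  have : SigmaCompactSpace M := sigmaCompactSpace_of_connected_paracompact M
  obtain ⟨A, hA, hA1, hAn, hAK, hseg⟩ := h'.exists_exhaustion
  have hmono : Monotone A := monotone_nat_of_le_succ fun n ↦ (hAn n).trans interior_subset
  have hC : ∀ n, IsCompact (A (n + 2) \ interior (A n)) := fun n ↦ (hA _).diff isOpen_interior
  have hCf : LocallyFinite fun n ↦ A (n + 2) \ interior (A n) := by
    intro x
    obtain ⟨n, hn⟩ := hAK {x} isCompact_singleton
    -- This neighbourhood is disjoint from every shell of index j > n, which omits int A j ⊇ int A
    -- (n + 1).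
    refine ⟨interior (A (n + 1)), isOpen_interior.mem_nhds (hAn n (hn rfl)),
      (finite_Iic n).subset ?_⟩
    rintro j ⟨y, hy, hyn⟩
    by_contra hj
    exact hy.2 (interior_mono (hmono (Nat.succ_le_of_lt (not_le.1 hj))) hyn)
  obtain ⟨U, hU, hDU, hUP⟩ := exists_isOpen_of_eventually_nhdsOver (h := h)
    (fun n ↦ (hC n).isClosed) hCf (fun n ↦
      (hD.eventually_segmentsSubset (h := h) (hC n) (hA n).isClosed isOpen_interior (hseg n)).and
        (hD.eventually_leavesForward (hC n)))
  exact ⟨U, hU, hDU, fun D' hD' ↦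
    ⟨isPseudoconvex_of_exhaustion hA hAn hAK fun n ↦ (hUP D' hD' n).1,
      isDisprisoning_of_exhaustion hA hAn hAK (fun n ↦ (hUP D' hD' n).1) hA1
        fun n ↦ (hUP D' hD' n).2⟩⟩

end LinearConnection

end Stability

theorem mainTheorem7
    {E : Type*} [NormedAddCommGroup E] [NormedSpace ℝ E] [FiniteDimensional ℝ E]
    {M : Type*} [TopologicalSpace M] [ChartedSpace E M] [IsManifold 𝓘(ℝ, E) ∞ M]
    [T2Space M] [ParacompactSpace M] [ConnectedSpace M]
    (h : ContMDiffRiemannianMetric 𝓘(ℝ, E) ∞ E (TangentSpace 𝓘(ℝ, E) : M → Type _)) :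
    IsOpen[LinearConnection.c0FineTopology h]
        {D : LinearConnection E M | D.IsPseudoconvex ∧ D.IsDisprisoning} ∧
      ∀ (g : PseudoRiemannianMetric E M) (D : LinearConnection E M), D.IsLeviCivita g →
        D.IsPseudoconvex → D.IsDisprisoning →
        ∃ U : Set (LinearConnection E M), IsOpen[LinearConnection.c0FineTopology h] U ∧ D ∈ U ∧
          ∀ D' ∈ U, D'.IsPseudoconvex ∧ D'.IsDisprisoning := by
  refine ⟨?_, fun g D _ hD hD' ↦ hD.exists_isOpen hD'⟩
  let := LinearConnection.c0FineTopology h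
  refine isOpen_iff_forall_mem_open.2 fun D hD ↦ ?_
  obtain ⟨U, hU, hDU, hUP⟩ := hD.1.exists_isOpen (h := h) hD.2
  exact ⟨U, hUP, hU, hDU⟩
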